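/- **Theorem.** Let $D>4$, let $\eta=\mathrm{diag}(-1,1,\dots,1)$ be the Minkowski metric on $\mathbb R^D$, used to raise and lower indices, and let square brackets denote antisymmetrization with strength one. Consider the following variables, each together with all its (commuting) derivatives $\partial_{\mu_1}\cdots\partial_{\mu_r}$: * the field $T_{\alpha\beta\gamma}$, with $T_{\alpha\beta\gamma}=-T_{\beta\alpha\gamma}$ and $T_{\alpha\beta\gamma}+T_{\beta\gamma\alpha}+T_{\gamma\alpha\beta}=0$ (even, antifield number $0$); * the ghosts $S_{\alpha\beta}=S_{\beta\alpha}$ and $A_{\alpha\beta}=-A_{\beta\alpha}$ (odd, antifield number $0$) and the ghosts of ghosts $C_\alpha$ (even, antifield number $0$); * the antifields $T^{*\alpha\beta\gamma}$, with the same symmetries as $T$ (odd, antifield number $1$), $S^{*\alpha\beta}=S^{*\beta\alpha}$ and $A^{*\alpha\beta}=-A^{*\beta\alpha}$ (even, antifield number $2$), and $C^{*\alpha}$ (odd, antifield number $3$). Fix a real algebra $\mathcal K$ of smooth real functions on $\mathbb R^D$ that contains the constants and is stable under the partial derivatives (for example all smooth functions, all polynomials, or only the constants, i.e. no explicit $x$-dependence).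 Let $\Omega$ be the graded commutative algebra, with coefficients in $\mathcal K$, generated by these variables, their derivatives and the odd generators $dx^\mu$, and free apart from the stated symmetries; its elements are the local forms. Let $\Omega^p_q$ be the space of local forms of form degree $p$ and antifield number $q$. Let $d=dx^\mu\partial_\mu$ be the spacetime exterior derivative, where $\partial_\mu$ is the total derivative (acting also on $\mathcal K$). With $$F_{\alpha\beta\gamma\delta}=\partial_\alpha T_{\beta\gamma\delta}+\partial_\beta T_{\gamma\alpha\delta}+\partial_\gamma T_{\alpha\beta\delta},\qquad E_{\alpha\beta\delta\,\varepsilon\gamma}=\tfrac12(\partial_\varepsilon F_{\alpha\beta\delta\gamma}-\partial_\gamma F_{\alpha\beta\delta\varepsilon}),$$ $$E_{\alpha\beta\gamma}=\eta^{\varepsilon\delta}E_{\alpha\beta\delta\,\varepsilon\gamma},\qquad E_\alpha=\eta^{\beta\gamma}E_{\alpha\beta\gamma},$$ let the Koszul–Tate differential $\delta$ be the left antiderivation of $\Omega$ that commutes with the $\partial_\mu$, vanishes on $\mathcal K$, on the $dx^\mu$ and on $T,S,A,C$, and satisfies $$\delta T^{*\alpha\beta\gamma}=3\bigl(E^{\alpha\beta\gamma}+\eta^{\gamma[\alpha}E^{\beta]}\bigr),\qquad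 \delta S^{*\alpha\beta}=-\partial_\gamma\bigl(T^{*\gamma\alpha\beta}+T^{*\gamma\beta\alpha}\bigr),$$ $$\delta A^{*\alpha\beta}=-3\,\partial_\gamma\bigl(T^{*\gamma\alpha\beta}-T^{*\gamma\beta\alpha}\bigr),\qquad \delta C^{*\alpha}=6\,\partial_\mu S^{*\mu\alpha}+2\,\partial_\mu A^{*\mu\alpha}.$$ Let $H^p_q(\delta|d)$ be the space of all $a\in\Omega^p_q$ such that $\delta a+db=0$ for some $b\in\Omega^{p-1}_{q-1}$, modulo the trivial ones $a=\delta m+dn$ with $m\in\Omega^p_{q+1}$ and $n\in\Omega^{p-1}_q$. Then $$H^D_q(\delta|d)=0\qquad\text{for every } q>3 .$$ -/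

import Mathlib

open scoped TensorProduct ContDiff

noncomputable section

namespace HookGauge

/-! ### Generators -/

/-- The generators of the algebra of local forms of the free `(2,1)` tensor gauge theory in `D`
spacetime dimensions: the field `T`, the ghosts `S`, `A`, the ghosts of ghosts `C`, the antifields
`T*` (`Ts`), `S*` (`Ss`), `A*` (`As`), `C*` (`Cs`), all of them together with all their
derivatives, and the differentials `dx`.  The multiset `k = {μ₁, …, μᵣ}` records the
derivative `∂_{μ₁} ⋯ ∂_{μᵣ}`.  Field and ghost indices are lower ones, antifield
indices are upper ones. -/
inductive Gen (D : ℕ) : Type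
  | T (α β γ : Fin D) (k : Multiset (Fin D))
  | S (α β : Fin D) (k : Multiset (Fin D))
  | A (α β : Fin D) (k : Multiset (Fin D))
  | C (α : Fin D) (k : Multiset (Fin D))
  | Ts (α β γ : Fin D) (k : Multiset (Fin D))
  | Ss (α β : Fin D) (k : Multiset (Fin D))
  | As (α β : Fin D) (k : Multiset (Fin D))
  | Cs (α : Fin D) (k : Multiset (Fin D))
  | dx (μ : Fin D)

namespace Gen

variable {D : ℕ}

/-- Grassmann parity (`0` even, `1` odd). -/
def parity : Gen D → ℕ
  | T _ _ _ _ => 0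
  | S _ _ _ => 1
  | A _ _ _ => 1
  | C _ _ => 0
  | Ts _ _ _ _ => 1
  | Ss _ _ _ => 0
  | As _ _ _ => 0
  | Cs _ _ => 1
  | dx _ => 1

/-- Antifield (antighost) number. -/
def antigh : Gen D → ℤ
  | T _ _ _ _ => 0
  | S _ _ _ => 0
  | A _ _ _ => 0
  | C _ _ => 0
  | Ts _ _ _ _ => 1
  | Ss _ _ _ => 2
  | As _ _ _ => 2
  | Cs _ _ => 3
  | dx _ => 0

/-- Form degree. -/
def formDeg : Gen D → ℤ
  | dx _ => 1
  | _ => 0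

end Gen

open Gen Finsupp

/-- The linear relations (algebraic symmetries) satisfied by the generators: each listed linear
combination of generators is zero. -/
inductive LinRel (D : ℕ) : (Gen D →₀ ℝ) → Prop
  | T_antisymm (α β γ : Fin D) (k : Multiset (Fin D)) :
      LinRel D (single (T α β γ k) 1 + single (T β α γ k) 1)
  | T_cyclic (α β γ : Fin D) (k : Multiset (Fin D)) :
      LinRel D (single (T α β γ k) 1 + single (T β γ α k) 1 + single (T γ α β k) 1)
  | S_symm (α β : Fin D) (k : Multiset (Fin D)) :
      LinRel D (single (S α β k) 1 - single (S β α k) 1)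
  | A_antisymm (α β : Fin D) (k : Multiset (Fin D)) :
      LinRel D (single (A α β k) 1 + single (A β α k) 1)
  | Ts_antisymm (α β γ : Fin D) (k : Multiset (Fin D)) :
      LinRel D (single (Ts α β γ k) 1 + single (Ts β α γ k) 1)
  | Ts_cyclic (α β γ : Fin D) (k : Multiset (Fin D)) :
      LinRel D (single (Ts α β γ k) 1 + single (Ts β γ α k) 1 + single (Ts γ α β k) 1)
  | Ss_symm (α β : Fin D) (k : Multiset (Fin D)) :
      LinRel D (single (Ss α β k) 1 - single (Ss β α k) 1)
  | As_antisymm (α β : Fin D) (k : Multiset (Fin D)) :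
      LinRel D (single (As α β k) 1 + single (As β α k) 1)

/-! ### The graded commutative algebra -/

/-- Relations of the graded commutative algebra: graded commutativity of the generators and the
linear symmetries. -/
inductive Rel (D : ℕ) : FreeAlgebra ℝ (Gen D) → FreeAlgebra ℝ (Gen D) → Prop
  | comm (g h : Gen D) :
      Rel D (FreeAlgebra.ι ℝ g * FreeAlgebra.ι ℝ h)
        ((-1 : ℝ) ^ (g.parity * h.parity) • (FreeAlgebra.ι ℝ h * FreeAlgebra.ι ℝ g))
  | lin (v : Gen D →₀ ℝ) (hv : LinRel D v) :
      Rel D (linearCombination ℝ (FreeAlgebra.ι ℝ) v) 0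

/-- The free graded commutative real algebra on the generators `Gen D` subject to their linear
symmetries, i.e. forms `P_{μ₁⋯μₚ} dx^{μ₁} ⋯ dx^{μₚ}` whose coefficients are polynomials
without explicit `x`-dependence in the fields, ghosts, antifields and their derivatives. -/
def Alg (D : ℕ) : Type := RingQuot (Rel D)

instance (D : ℕ) : Ring (Alg D) := inferInstanceAs (Ring (RingQuot (Rel D)))

instance (D : ℕ) : Algebra ℝ (Alg D) := inferInstanceAs (Algebra ℝ (RingQuot (Rel D)))

/-- The quotient map from the free algebra. -/
def mkAlg (D : ℕ) : FreeAlgebra ℝ (Gen D) →ₐ[ℝ] Alg D := RingQuot.mkAlgHom ℝ (Rel D)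

variable {D : ℕ}

theorem mkAlg_surjective : Function.Surjective (mkAlg D) :=
  RingQuot.mkAlgHom_surjective ℝ (Rel D)

theorem mkAlg_rel {a b : FreeAlgebra ℝ (Gen D)} (h : Rel D a b) : mkAlg D a = mkAlg D b :=
  RingQuot.mkAlgHom_rel ℝ h

/-- The generator `g` as an element of the algebra. -/
def gen (g : Gen D) : Alg D := mkAlg D (FreeAlgebra.ι ℝ g)

theorem gen_comm (g h : Gen D) :
    gen g * gen h = (-1 : ℝ) ^ (g.parity * h.parity) • (gen h * gen g) := by
  have := mkAlg_rel (Rel.comm g h)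
  simpa [gen] using this

theorem gen_lin {v : Gen D →₀ ℝ} (hv : LinRel D v) : linearCombination ℝ gen v = 0 := by
  have := mkAlg_rel (Rel.lin v hv)
  rw [map_zero] at this
  rw [← this]
  exact (Finsupp.apply_linearCombination ℝ (mkAlg D).toLinearMap (FreeAlgebra.ι ℝ) v).symm

/-- `a` has the commutation rule of an element of parity `n` with all generators. -/
def SuperComm (n : ℕ) (a : Alg D) : Prop :=
  ∀ g : Gen D, a * gen g = (-1 : ℝ) ^ (n * g.parity) • (gen g * a)

theorem SuperComm.add {n : ℕ} {a b : Alg D} (ha : SuperComm n a) (hb : SuperComm n b) :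
    SuperComm n (a + b) := fun g => by rw [add_mul, mul_add, smul_add, ha g, hb g]

theorem SuperComm.smul {n : ℕ} {a : Alg D} (c : ℝ) (ha : SuperComm n a) :
    SuperComm n (c • a) := fun g => by
  rw [smul_mul_assoc, mul_smul_comm, ha g, smul_comm]

theorem SuperComm.neg {n : ℕ} {a : Alg D} (ha : SuperComm n a) : SuperComm n (-a) := by
  simpa using ha.smul (-1)

theorem SuperComm.sub {n : ℕ} {a b : Alg D} (ha : SuperComm n a) (hb : SuperComm n b) :
    SuperComm n (a - b) := by simpa [sub_eq_add_neg] using ha.add hb.neg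

theorem SuperComm.zero (n : ℕ) : SuperComm n (0 : Alg D) := fun g => by simp

theorem SuperComm.sum {n : ℕ} {ι : Type} {s : Finset ι} {f : ι → Alg D}
    (h : ∀ i, SuperComm n (f i)) : SuperComm n (∑ i ∈ s, f i) := by
  classical
  induction s using Finset.induction_on with
  | empty => simpa using SuperComm.zero n
  | insert i s hi ih => rw [Finset.sum_insert hi]; exact (h i).add ih

theorem superComm_gen (g : Gen D) : SuperComm g.parity (gen g) := fun h => gen_comm g h

theorem SuperComm.congr {n m : ℕ} {a : Alg D} (h : SuperComm n a) (hnm : n % 2 = m % 2) :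
    SuperComm m a := fun g => by
  rw [h g, pow_mul, pow_mul, neg_one_pow_eq_pow_mod_two (n := n), hnm,
    ← neg_one_pow_eq_pow_mod_two]

/-! ### Graded derivations -/

/-- Prescribed values of a graded derivation of parity `ε` on the generators. -/
structure DerData (D : ℕ) (ε : ℕ) where
  /-- value on a generator -/
  val : Gen D → Alg D
  superComm : ∀ g, SuperComm (g.parity + ε) (val g)
  lin : ∀ v, LinRel D v → linearCombination ℝ val v = 0

/-- The matrix that encodes a generator and the value of the derivation on it. -/
def DerData.mat {ε : ℕ} (X : DerData D ε) (g : Gen D) : Matrix (Fin 2) (Fin 2) (Alg D) :=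
  !![(-1 : ℝ) ^ (ε * g.parity) • gen g, X.val g; 0, gen g]

theorem sign_lin (ε : ℕ) {v : Gen D →₀ ℝ} (hv : LinRel D v) :
    linearCombination ℝ (fun g : Gen D => (-1 : ℝ) ^ (ε * g.parity) • gen g) v = 0 := by
  have h0 := gen_lin hv
  cases hv <;>
    simp only [map_add, map_sub, linearCombination_single, one_smul, Gen.parity,
      ← smul_add] at h0 ⊢ <;>
    first
      | rw [h0, smul_zero]
      | rw [← smul_sub, h0, smul_zero]

theorem mat_linearCombination {ε : ℕ} (X : DerData D ε) (v : Gen D →₀ ℝ) :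
    linearCombination ℝ X.mat v =
      !![linearCombination ℝ (fun g : Gen D => (-1 : ℝ) ^ (ε * g.parity) • gen g) v,
        linearCombination ℝ X.val v; 0, linearCombination ℝ gen v] := by
  induction v using Finsupp.induction_linear with
  | zero => ext i j; fin_cases i <;> fin_cases j <;> simp
  | add f g hf hg => rw [map_add, hf, hg]; ext i j; fin_cases i <;> fin_cases j <;> simp
  | single g c =>
    ext i j; fin_cases i <;> fin_cases j <;> simp [DerData.mat]

/-- The algebra homomorphism `a ↦ !![±a, X a; 0, a]` extending `DerData.mat`. -/
def DerData.hom {ε : ℕ} (X : DerData D ε) : Alg D →ₐ[ℝ] Matrix (Fin 2) (Fin 2) (Alg D) :=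
  RingQuot.liftAlgHom ℝ ⟨FreeAlgebra.lift ℝ X.mat, by
    rintro _ _ (⟨g, h⟩ | ⟨v, hv⟩)
    · have h1 : X.val h * gen g =
          (-1 : ℝ) ^ ((h.parity + ε) * g.parity) • (gen g * X.val h) := X.superComm h g
      have h2 : X.val g * gen h =
          (-1 : ℝ) ^ ((g.parity + ε) * h.parity) • (gen h * X.val g) := X.superComm g h
      have sq : ∀ n : ℕ, ((-1 : ℝ) ^ n) * (-1) ^ n = 1 := fun n => by
        rw [← mul_pow]; simp
      simp only [map_mul, map_smul, FreeAlgebra.lift_ι_apply]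
      ext i j
      fin_cases i <;> fin_cases j
      · simp only [DerData.mat, Matrix.mul_apply, Fin.sum_univ_two]
        simp [gen_comm g h, smul_smul]
        congr 1
        ring
      · simp only [DerData.mat, Matrix.mul_apply, Fin.sum_univ_two]
        simp [h1, h2, smul_smul]
        rw [add_comm]
        congr 2
        · rw [add_mul, pow_add, mul_comm g.parity h.parity]
        · rw [add_mul, pow_add, mul_comm h.parity g.parity, ← mul_assoc, sq, one_mul]
      · simp [DerData.mat, Matrix.mul_apply, Fin.sum_univ_two]
      · simp [DerData.mat, Matrix.mul_apply, Fin.sum_univ_two, gen_comm g h]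
    · have h1 := Finsupp.apply_linearCombination ℝ (FreeAlgebra.lift ℝ X.mat).toLinearMap
        (FreeAlgebra.ι ℝ) v
      have h2 : ((FreeAlgebra.lift ℝ X.mat).toLinearMap ∘ FreeAlgebra.ι ℝ) = X.mat := by
        ext1 g; simp
      rw [h2, AlgHom.toLinearMap_apply] at h1
      rw [h1, map_zero, mat_linearCombination, sign_lin ε hv, X.lin v hv, gen_lin hv]
      ext i j; fin_cases i <;> fin_cases j <;> simp⟩

/-- The left graded derivation of parity `ε` of the algebra with prescribed values on the
generators. -/
def DerData.der {ε : ℕ} (X : DerData D ε) : Alg D →ₗ[ℝ] Alg D :=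
  Matrix.entryLinearMap ℝ (Alg D) (0 : Fin 2) (1 : Fin 2) ∘ₗ X.hom.toLinearMap

theorem DerData.hom_gen {ε : ℕ} (X : DerData D ε) (g : Gen D) : X.hom (gen g) = X.mat g := by
  have h : X.hom (mkAlg D (FreeAlgebra.ι ℝ g)) =
      FreeAlgebra.lift ℝ X.mat (FreeAlgebra.ι ℝ g) := RingQuot.liftAlgHom_mkAlgHom_apply ..
  rw [gen, h, FreeAlgebra.lift_ι_apply]

@[simp]
theorem DerData.der_gen {ε : ℕ} (X : DerData D ε) (g : Gen D) : X.der (gen g) = X.val g := by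
  simp [DerData.der, X.hom_gen, DerData.mat]

/-- Graded Leibniz rule, for left multiplication by a generator. -/
theorem DerData.der_gen_mul {ε : ℕ} (X : DerData D ε) (g : Gen D) (a : Alg D) :
    X.der (gen g * a) = X.val g * a + (-1 : ℝ) ^ (ε * g.parity) • (gen g * X.der a) := by
  have key : X.hom a 1 1 = a := by
    have : ∀ a : Alg D, X.hom a 1 1 = a ∧ X.hom a 1 0 = 0 := by
      intro a
      obtain ⟨a, rfl⟩ := mkAlg_surjective a
      induction a using FreeAlgebra.induction with
      | grade0 r => simp [Matrix.algebraMap_matrix_apply]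
      | grade1 g =>
        change X.hom (gen g) 1 1 = gen g ∧ X.hom (gen g) 1 0 = 0
        simp [X.hom_gen, DerData.mat]
      | mul a b ha hb =>
        simp [Matrix.mul_apply, Fin.sum_univ_two, ha.1, ha.2, hb.1, hb.2]
      | add a b ha hb => simp [ha.1, ha.2, hb.1, hb.2]
    exact (this a).1
  have h : X.der (gen g * a) = (X.hom (gen g) * X.hom a) 0 1 := by
    rw [← map_mul]; rfl
  have h' : X.der a = X.hom a 0 1 := rfl
  rw [h, h', Matrix.mul_apply, Fin.sum_univ_two, key, X.hom_gen, add_comm]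
  simp [DerData.mat]

/-! ### The derivatives `∂_μ` on the generators -/

/-- Value of the derivative `∂_μ` on the generators. -/
def partialVal (μ : Fin D) : Gen D → Alg D
  | T α β γ k => gen (T α β γ (μ ::ₘ k))
  | S α β k => gen (S α β (μ ::ₘ k))
  | A α β k => gen (A α β (μ ::ₘ k))
  | C α k => gen (C α (μ ::ₘ k))
  | Ts α β γ k => gen (Ts α β γ (μ ::ₘ k))
  | Ss α β k => gen (Ss α β (μ ::ₘ k))
  | As α β k => gen (As α β (μ ::ₘ k))
  | Cs α k => gen (Cs α (μ ::ₘ k))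
  | dx _ => 0

def partialData (μ : Fin D) : DerData D 0 where
  val := partialVal μ
  superComm g := by
    cases g
    case dx => exact SuperComm.zero _
    all_goals exact superComm_gen _
  lin v hv := by
    cases hv
    case T_antisymm α β γ k => simpa [partialVal] using gen_lin (LinRel.T_antisymm α β γ (μ ::ₘ k))
    case T_cyclic α β γ k => simpa [partialVal] using gen_lin (LinRel.T_cyclic α β γ (μ ::ₘ k))
    case S_symm α β k => simpa [partialVal] using gen_lin (LinRel.S_symm α β (μ ::ₘ k))
    case A_antisymm α β k => simpa [partialVal] using gen_lin (LinRel.A_antisymm α β (μ ::ₘ k))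
    case Ts_antisymm α β γ k =>
      simpa [partialVal] using gen_lin (LinRel.Ts_antisymm α β γ (μ ::ₘ k))
    case Ts_cyclic α β γ k => simpa [partialVal] using gen_lin (LinRel.Ts_cyclic α β γ (μ ::ₘ k))
    case Ss_symm α β k => simpa [partialVal] using gen_lin (LinRel.Ss_symm α β (μ ::ₘ k))
    case As_antisymm α β k => simpa [partialVal] using gen_lin (LinRel.As_antisymm α β (μ ::ₘ k))

/-! ### The equations of motion -/

/-- Diagonal entries of the Minkowski metric `diag(-1, 1, …, 1)` (equal to those of its inverse). -/
def η (μ : Fin D) : ℝ := if (μ : ℕ) = 0 then -1 else 1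

/-- The components `η^{μν}`. -/
def metric (μ ν : Fin D) : ℝ := if μ = ν then η μ else 0

/-- `∂_k F_{[αβγ]δ}`, with
`F_{[αβγ]δ} = ∂_α T_{[βγ]δ} + ∂_β T_{[γα]δ} + ∂_γ T_{[αβ]δ}`. -/
def Fstr (α β γ δ : Fin D) (k : Multiset (Fin D)) : Alg D :=
  gen (T β γ δ (α ::ₘ k)) + gen (T γ α δ (β ::ₘ k)) + gen (T α β δ (γ ::ₘ k))

/-- `∂_k E_{[αβδ][εγ]}`, with
`E_{[αβδ][εγ]} = ½ (∂_ε F_{[αβδ]γ} - ∂_γ F_{[αβδ]ε})`. -/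
def curv (α β δ ε γ : Fin D) (k : Multiset (Fin D)) : Alg D :=
  (1 / 2 : ℝ) • (Fstr α β δ γ (ε ::ₘ k) - Fstr α β δ ε (γ ::ₘ k))

/-- `∂_k E_{[αβ]γ}`, with `E_{[αβ]γ} = η^{εδ} E_{[αβδ][εγ]}` (the metric is diagonal). -/
def ricci (α β γ : Fin D) (k : Multiset (Fin D)) : Alg D :=
  ∑ δ, η δ • curv α β δ δ γ k

/-- `∂_k E_α`, with `E_α = η^{βγ} E_{[αβ]γ}`. -/
def ricciTr (α : Fin D) (k : Multiset (Fin D)) : Alg D :=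
  ∑ β, η β • ricci α β β k

/-- `∂_k` of the Euler–Lagrange derivative `3 (E^{[αβ]γ} + η^{γ[α} E^{β]})`, where
the bracket antisymmetrizes with strength one and indices are raised with the diagonal metric. -/
def eom (α β γ : Fin D) (k : Multiset (Fin D)) : Alg D :=
  (3 : ℝ) • ((η α * η β * η γ) • ricci α β γ k +
    (1 / 2 : ℝ) • ((metric γ α * η β) • ricciTr β k - (metric γ β * η α) • ricciTr α k))

/-! ### The Koszul–Tate differential -/

/-- Value of the Koszul–Tate differential `δ` on the generators. -/
def koszulVal : Gen D → Alg D
  | Ts α β γ k => eom α β γ k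
  | Ss α β k => -∑ γ, (gen (Ts γ α β (γ ::ₘ k)) + gen (Ts γ β α (γ ::ₘ k)))
  | As α β k => -(3 : ℝ) • ∑ γ, (gen (Ts γ α β (γ ::ₘ k)) - gen (Ts γ β α (γ ::ₘ k)))
  | Cs α k => (6 : ℝ) • ∑ μ, gen (Ss μ α (μ ::ₘ k)) + (2 : ℝ) • ∑ μ, gen (As μ α (μ ::ₘ k))
  | _ => 0

theorem T_anti (α β γ : Fin D) (k : Multiset (Fin D)) :
    gen (T α β γ k) = -gen (T β α γ k) := by
  have := gen_lin (LinRel.T_antisymm α β γ k)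
  simp only [map_add, linearCombination_single, one_smul] at this
  exact eq_neg_of_add_eq_zero_left this

theorem T_cyc (α β γ : Fin D) (k : Multiset (Fin D)) :
    gen (T α β γ k) + gen (T β γ α k) + gen (T γ α β k) = 0 := by
  simpa using gen_lin (LinRel.T_cyclic α β γ k)

theorem Fstr_superComm (α β γ δ : Fin D) (k : Multiset (Fin D)) :
    SuperComm 0 (Fstr α β γ δ k) :=
  ((superComm_gen (T β γ δ _)).add (superComm_gen (T γ α δ _))).add (superComm_gen (T α β δ _))

theorem ricci_superComm (α β γ : Fin D) (k : Multiset (Fin D)) : SuperComm 0 (ricci α β γ k) :=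
  SuperComm.sum fun _ => (((Fstr_superComm _ _ _ _ _).sub (Fstr_superComm _ _ _ _ _)).smul _).smul _

theorem ricciTr_superComm (α : Fin D) (k : Multiset (Fin D)) : SuperComm 0 (ricciTr α k) :=
  SuperComm.sum fun _ => (ricci_superComm _ _ _ _).smul _

theorem eom_superComm (α β γ : Fin D) (k : Multiset (Fin D)) : SuperComm 0 (eom α β γ k) :=
  (((ricci_superComm _ _ _ _).smul _).add ((((ricciTr_superComm _ _).smul _).sub
    ((ricciTr_superComm _ _).smul _)).smul _)).smul _

theorem Fstr_anti (α β γ δ : Fin D) (k : Multiset (Fin D)) :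
    Fstr α β γ δ k = -Fstr β α γ δ k := by
  simp only [Fstr]
  rw [T_anti β γ, T_anti γ α, T_anti α β]
  abel

theorem ricci_anti (α β γ : Fin D) (k : Multiset (Fin D)) : ricci α β γ k = -ricci β α γ k := by
  simp only [ricci, curv, ← Finset.sum_neg_distrib]
  refine Finset.sum_congr rfl fun δ _ => ?_
  rw [Fstr_anti α β, Fstr_anti α β]
  module

theorem ricci_cyc (α β γ : Fin D) (k : Multiset (Fin D)) :
    ricci α β γ k + ricci β γ α k + ricci γ α β k = 0 := by
  simp only [ricci, ← Finset.sum_add_distrib]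
  refine Finset.sum_eq_zero fun δ _ => ?_
  rw [← smul_add, ← smul_add]
  refine smul_eq_zero_of_right _ ?_
  simp only [curv, Fstr, Multiset.cons_swap δ α, Multiset.cons_swap δ β, Multiset.cons_swap δ γ,
    Multiset.cons_swap β α, Multiset.cons_swap γ α, Multiset.cons_swap γ β]
  have a1 := T_cyc β δ γ (α ::ₘ δ ::ₘ k)
  have a2 := T_cyc γ δ α (β ::ₘ δ ::ₘ k)
  have a3 := T_cyc α δ β (γ ::ₘ δ ::ₘ k)
  have b := T_cyc α β γ (δ ::ₘ δ ::ₘ k)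
  rw [T_anti γ β δ] at a1
  rw [T_anti α γ δ] at a2
  rw [T_anti β α δ] at a3
  rw [T_anti β δ δ, T_anti γ δ δ, T_anti α δ δ]
  linear_combination (norm := module) (1 / 2 : ℝ) • (a1 + a2 + a3 + b)

theorem metric_comm (μ ν : Fin D) : metric μ ν = metric ν μ := by
  unfold metric
  by_cases h : μ = ν
  · subst h; rfl
  · rw [if_neg h, if_neg (Ne.symm h)]

theorem eom_anti (α β γ : Fin D) (k : Multiset (Fin D)) : eom α β γ k = -eom β α γ k := by
  simp only [eom]
  rw [ricci_anti α β]
  module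

theorem eom_cyc (α β γ : Fin D) (k : Multiset (Fin D)) :
    eom α β γ k + eom β γ α k + eom γ α β k = 0 := by
  have h := ricci_cyc α β γ k
  simp only [eom]
  rw [metric_comm α β, metric_comm β γ, metric_comm γ α]
  linear_combination (norm := module) (3 * (η α * η β * η γ)) • h

def koszulData : DerData D 1 where
  val := koszulVal
  superComm g := by
    cases g
    case Ts α β γ k => exact (eom_superComm α β γ k).congr (by simp [Gen.parity])
    case Ss α β k =>
      exact (SuperComm.sum fun γ =>
        (superComm_gen (Ts γ α β _)).add (superComm_gen (Ts γ β α _))).neg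
    case As α β k =>
      exact (SuperComm.sum fun γ =>
        (superComm_gen (Ts γ α β _)).sub (superComm_gen (Ts γ β α _))).smul _
    case Cs α k =>
      exact SuperComm.congr (n := 0) (((SuperComm.sum fun μ => superComm_gen (Ss μ α _)).smul _).add
        ((SuperComm.sum fun μ => superComm_gen (As μ α _)).smul _)) (by simp [Gen.parity])
    all_goals exact SuperComm.zero _
  lin v hv := by
    cases hv
    case Ts_antisymm α β γ k => simp [koszulVal, eom_anti α β γ k]
    case Ts_cyclic α β γ k => simpa [koszulVal] using eom_cyc α β γ k
    case Ss_symm α β k => simp [koszulVal, Finset.sum_add_distrib, add_comm]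
    case As_antisymm α β k =>
      simp only [koszulVal, map_add, linearCombination_single, one_smul, ← smul_add,
        ← Finset.sum_add_distrib]
      simp
    all_goals simp [koszulVal]

/-! ### Explicit dependence on the coordinates -/

/-- An admissible class of coefficient functions of the spacetime coordinates `x`: a real algebra
of smooth functions on `ℝ^D` that is stable under the partial derivatives.  The two extreme cases
are all smooth functions and the constants (no explicit `x`-dependence). -/
structure CoeffClass (D : ℕ) where
  /-- the algebra of coefficient functions -/
  alg : Subalgebra ℝ ((Fin D → ℝ) → ℝ)
  smooth : ∀ f ∈ alg, ContDiff ℝ ∞ f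
  stable : ∀ f ∈ alg, ∀ μ : Fin D, (fun x => fderiv ℝ f x (Pi.single μ 1)) ∈ alg

/-- All smooth functions of the coordinates. -/
def CoeffClass.allSmooth (D : ℕ) : CoeffClass D where
  alg :=
    { carrier := {f | ContDiff ℝ ∞ f}
      mul_mem' := fun {f g} (hf : ContDiff ℝ ∞ f) (hg : ContDiff ℝ ∞ g) => hf.mul hg
      add_mem' := fun {f g} (hf : ContDiff ℝ ∞ f) (hg : ContDiff ℝ ∞ g) => hf.add hg
      algebraMap_mem' := fun c => show ContDiff ℝ ∞ (fun _ => c) from contDiff_const }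
  smooth _ hf := hf
  stable f hf μ := by
    have hf : ContDiff ℝ ∞ f := hf
    exact (hf.fderiv_right (m := ∞) (by simp)).clm_apply contDiff_const

/-- The constants: no explicit dependence on the coordinates. -/
def CoeffClass.constants (D : ℕ) : CoeffClass D where
  alg := ⊥
  smooth f hf := by
    obtain ⟨c, rfl⟩ := Algebra.mem_bot.1 hf
    exact contDiff_const
  stable f hf μ := by
    obtain ⟨c, rfl⟩ := Algebra.mem_bot.1 hf
    have : (fun x : Fin D → ℝ =>
        fderiv ℝ (algebraMap ℝ ((Fin D → ℝ) → ℝ) c) x (Pi.single μ 1)) = 0 := by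
      funext x
      have h : fderiv ℝ (algebraMap ℝ ((Fin D → ℝ) → ℝ) c) x = 0 :=
        (hasFDerivAt_const c x).fderiv
      rw [h]; rfl
    rw [this]
    exact zero_mem _

/-- The type of coefficient functions of the class `K`. -/
def CoeffClass.Fn (K : CoeffClass D) : Type := K.alg

instance (K : CoeffClass D) : CommRing K.Fn := inferInstanceAs (CommRing K.alg)

instance (K : CoeffClass D) : Algebra ℝ K.Fn := inferInstanceAs (Algebra ℝ K.alg)

/-- The partial derivative `∂/∂x^μ` on coefficient functions. -/
def CoeffClass.pd (K : CoeffClass D) (μ : Fin D) : K.Fn →ₗ[ℝ] K.Fn where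
  toFun f := ⟨fun x => fderiv ℝ f.1 x (Pi.single μ 1), K.stable f.1 f.2 μ⟩
  map_add' f g := by
    refine Subtype.ext (funext fun x => ?_)
    have hf := (K.smooth f.1 f.2).differentiable (by simp) x
    have hg := (K.smooth g.1 g.2).differentiable (by simp) x
    change fderiv ℝ (f.1 + g.1) x _ = fderiv ℝ f.1 x _ + fderiv ℝ g.1 x _
    rw [fderiv_add hf hg]; rfl
  map_smul' c f := by
    refine Subtype.ext (funext fun x => ?_)
    have hf := (K.smooth f.1 f.2).differentiable (by simp) x
    change fderiv ℝ (c • f.1) x _ = c • fderiv ℝ f.1 x _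
    rw [fderiv_const_smul hf]; rfl

/-! ### Local forms, `δ`, `d` and the cohomology of `δ` modulo `d` -/

/-- Local forms: forms whose coefficients are polynomials in the fields, ghosts, antifields and
finitely many of their derivatives, with coefficient functions of `x` in the class `K`. -/
abbrev LocalForm (K : CoeffClass D) : Type := K.Fn ⊗[ℝ] Alg D

variable (K : CoeffClass D)

/-- The Koszul–Tate differential `δ`; it does not act on the coordinates. -/
def δ : LocalForm K →ₗ[ℝ] LocalForm K :=
  LinearMap.lTensor K.Fn koszulData.der

/-- The total derivative `∂_μ`. -/
def totalDeriv (μ : Fin D) : LocalForm K →ₗ[ℝ] LocalForm K :=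
  LinearMap.rTensor (Alg D) (K.pd μ) + LinearMap.lTensor K.Fn (partialData μ).der

/-- The spacetime exterior derivative `d = dx^μ ∂_μ`. -/
def d : LocalForm K →ₗ[ℝ] LocalForm K :=
  ∑ μ, LinearMap.lTensor K.Fn (LinearMap.mulLeft ℝ (gen (dx μ))) ∘ₗ totalDeriv K μ

/-- Local forms of form degree `p` and antifield number `q` (the zero space if `p < 0` or
`q < 0`). -/
def forms (p q : ℤ) : Submodule ℝ (LocalForm K) :=
  Submodule.span ℝ {a | ∃ (f : K.Fn) (l : List (Gen D)),
    (l.map Gen.formDeg).sum = p ∧ (l.map Gen.antigh).sum = q ∧ a = f ⊗ₜ[ℝ] (l.map gen).prod}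

/-- Cocycles of `δ` modulo `d`: forms `a` of form degree `p` and antifield number `q` such that
`δ a + d b = 0` for some `b` of form degree `p - 1` and antifield number `q - 1`. -/
def cocycles (p q : ℤ) : Submodule ℝ (LocalForm K) where
  carrier := {a | a ∈ forms K p q ∧ ∃ b ∈ forms K (p - 1) (q - 1), δ K a + d K b = 0}
  zero_mem' := ⟨zero_mem _, 0, zero_mem _, by simp⟩
  add_mem' := by
    rintro a a' ⟨ha, b, hb, h⟩ ⟨ha', b', hb', h'⟩
    refine ⟨add_mem ha ha', b + b', add_mem hb hb', ?_⟩
    rw [map_add, map_add, add_add_add_comm, h, h', add_zero]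
  smul_mem' := by
    rintro c a ⟨ha, b, hb, h⟩
    refine ⟨Submodule.smul_mem _ c ha, c • b, Submodule.smul_mem _ c hb, ?_⟩
    rw [map_smul, map_smul, ← smul_add, h, smul_zero]

/-- Trivial cocycles: `δ m + d n`, with `m` of form degree `p` and antifield number `q + 1`, and `n`
of form degree `p - 1` and antifield number `q`. -/
def coboundaries (p q : ℤ) : Submodule ℝ (LocalForm K) :=
  (forms K p (q + 1)).map (δ K) ⊔ (forms K (p - 1) q).map (d K)

/-- The cohomology group `H^p_q(δ|d)`. -/
abbrev H (p q : ℤ) : Type :=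
  cocycles K p q ⧸ (coboundaries K p q).submoduleOf (cocycles K p q)

end HookGauge

end

/-!
On forms linear in the variables, `δ` is a complex of modules over the polynomial ring `ℝ[∂]`. On
tensors with polynomial entries it acts on `T*` by the field equations, on `S*` and `A*` by the
gauge transformations, and on `C*` by the reducibility of these. It is exact at the antifields: a
solution of the field equations has vanishing curvature, because the d'Alembertian annihilates the
curvature on shell and is not a zero divisor; a tensor with vanishing curvature is pure gauge and
the gauge parameters which act trivially are reducible, because polynomial Koszul complexes are
exact in low degrees. The resulting contracting homotopy of the linear forms extends to a derivation
of all forms. Its anticommutator with `δ` has positive integer eigenvalues in positive antifield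
number, hence `δ` is acyclic there.

The Euler–Lagrange derivatives annihilate divergences, and they intertwine `δ` with the sum of `±δ`
on the coefficients and the adjoint of the linearised `δ`. As the variables have antifield number
at most `3`, the Euler–Lagrange derivatives of a cocycle with `q > 3` have positive antifield
number, so acyclicity of `δ` makes them exact for this differential. By Euler's formula
`N a = ∑ z_l EL_l(a)` up to a divergence, where `N` counts the variables, `N a` is `δ`-exact up to a
divergence, and divergences of forms of top degree are `d`-exact. Finally, `N` is invertible in
positive antifield number.
-/

noncomputable section

namespace HookGauge

variable {D : ℕ}

theorem Gen.parity_eq_zero_or_one (g : Gen D) : g.parity = 0 ∨ g.parity = 1 := by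
  cases g <;> simp [Gen.parity]

theorem alg_induction {p : Alg D → Prop} (a : Alg D) (one : p 1)
    (add : ∀ a b, p a → p b → p (a + b)) (smul : ∀ (c : ℝ) a, p a → p (c • a))
    (gen_mul : ∀ g a, p a → p (gen g * a)) : p a := by
  have mkAlg_mul : ∀ (x : FreeAlgebra ℝ (Gen D)) (b : Alg D), p b → p (mkAlg D x * b) := by
    intro x
    induction x using FreeAlgebra.induction with
    | grade0 r =>
      intro b hb
      rw [AlgHom.commutes, ← Algebra.smul_def]
      exact smul r b hb
    | grade1 g => intro b hb; exact gen_mul g b hb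
    | mul x y hx hy => intro b hb; rw [map_mul, mul_assoc]; exact hx _ (hy _ hb)
    | add x y hx hy => intro b hb; rw [map_add, add_mul]; exact add _ _ (hx _ hb) (hy _ hb)
  obtain ⟨x, rfl⟩ := mkAlg_surjective a
  simpa using mkAlg_mul x 1 one

theorem linearMap_ext_gen_mul {M : Type*} [AddCommGroup M] [Module ℝ M] {f h : Alg D →ₗ[ℝ] M}
    (one : f 1 = h 1) (gen_mul : ∀ g a, f a = h a → f (gen g * a) = h (gen g * a)) : f = h := by
  ext a
  induction a using alg_induction with
  | one => exact one
  | add a b ha hb => rw [map_add, map_add, ha, hb]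
  | smul c a ha => rw [map_smul, map_smul, ha]
  | gen_mul g a ha => exact gen_mul g a ha

section Lift

variable {𝒜 : Type*} [Ring 𝒜] [Algebra ℝ 𝒜]

/-- The universal property of `Alg D`: the algebra homomorphism with prescribed values on the
generators. -/
def liftAlg (f : Gen D → 𝒜)
    (comm : ∀ g h, f g * f h = (-1 : ℝ) ^ (g.parity * h.parity) • (f h * f g))
    (lin : ∀ v, LinRel D v → Finsupp.linearCombination ℝ f v = 0) : Alg D →ₐ[ℝ] 𝒜 :=
  RingQuot.liftAlgHom ℝ ⟨FreeAlgebra.lift ℝ f, by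
    rintro _ _ (⟨g, h⟩ | ⟨v, hv⟩)
    · simpa using comm g h
    · have lift_ι : (FreeAlgebra.lift ℝ f).toLinearMap ∘ FreeAlgebra.ι ℝ = f := by ext1 g; simp
      rw [map_zero, ← lin v hv]
      nth_rewrite 2 [← lift_ι]
      exact Finsupp.apply_linearCombination ℝ (FreeAlgebra.lift ℝ f).toLinearMap _ v⟩

@[simp]
theorem liftAlg_gen (f : Gen D → 𝒜) (comm) (lin) (g : Gen D) :
    liftAlg f comm lin (gen g) = f g := by
  have lift_mkAlg : liftAlg f comm lin (mkAlg D (FreeAlgebra.ι ℝ g)) =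
      FreeAlgebra.lift ℝ f (FreeAlgebra.ι ℝ g) := RingQuot.liftAlgHom_mkAlgHom_apply ..
  rw [gen, lift_mkAlg, FreeAlgebra.lift_ι_apply]

end Lift

/-- The `ε`-th power of the parity automorphism `a ↦ (-1)^{|a|} a`. -/
def paritySign (D ε : ℕ) : Alg D →ₐ[ℝ] Alg D :=
  liftAlg (fun g => (-1 : ℝ) ^ (ε * g.parity) • gen g)
    (fun g h => by
      simp only [smul_mul_smul_comm, gen_comm g h, smul_smul]
      congr 1
      ring)
    (fun _ hv => sign_lin ε hv)

@[simp]
theorem paritySign_gen (ε : ℕ) (g : Gen D) :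
    paritySign D ε (gen g) = (-1 : ℝ) ^ (ε * g.parity) • gen g :=
  liftAlg_gen ..

theorem paritySign_of_even {ε : ℕ} (hε : Even ε) (a : Alg D) : paritySign D ε a = a := by
  refine LinearMap.congr_fun (f := (paritySign D ε).toLinearMap) (g := .id) ?_ a
  refine linearMap_ext_gen_mul (by simp) fun g a ha => ?_
  rw [AlgHom.toLinearMap_apply] at ha
  simp [ha, (hε.mul_right g.parity).neg_one_pow]

/-- The augmentation, which sends every generator to zero. -/
def augmentation (D : ℕ) : Alg D →ₐ[ℝ] ℝ :=
  liftAlg (fun _ => 0) (fun _ _ => by simp) (fun v _ => by simp [Finsupp.linearCombination_apply])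

@[simp]
theorem augmentation_gen (g : Gen D) : augmentation D (gen g) = 0 := liftAlg_gen ..

/-! ### Graded derivations -/

section IsDerAlong

variable {𝒜 : Type*} [Ring 𝒜] [Algebra ℝ 𝒜]

/-- `X` is a left graded derivation of parity `ε` along the algebra homomorphism `ι`.  Only products
with a generator on the left occur in the Leibniz rule; `IsDerAlong.mul` is the general one. -/
structure IsDerAlong (ι : Alg D →ₐ[ℝ] 𝒜) (ε : ℕ) (X : Alg D →ₗ[ℝ] 𝒜) : Prop where
  one : X 1 = 0
  gen_mul : ∀ g a, X (gen g * a) =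
    X (gen g) * ι a + (-1 : ℝ) ^ (ε * g.parity) • (ι (gen g) * X a)

variable {ι : Alg D →ₐ[ℝ] 𝒜} {ε : ℕ} {X Y : Alg D →ₗ[ℝ] 𝒜}

theorem IsDerAlong.ext (hX : IsDerAlong ι ε X) (hY : IsDerAlong ι ε Y)
    (h : ∀ g, X (gen g) = Y (gen g)) : X = Y :=
  linearMap_ext_gen_mul (by rw [hX.one, hY.one]) fun g a ha => by
    rw [hX.gen_mul, hY.gen_mul, ha, h]

theorem IsDerAlong.mul (hX : IsDerAlong ι ε X) (u a : Alg D) :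
    X (u * a) = X u * ι a + ι (paritySign D ε u) * X a := by
  induction u using alg_induction with
  | one => simp [hX.one]
  | add u v hu hv => rw [add_mul, map_add, hu, hv, map_add, map_add, map_add]; noncomm_ring
  | smul c u hu => simp [hu]
  | gen_mul g u hu =>
    rw [mul_assoc, hX.gen_mul, hX.gen_mul, hu, map_mul, map_mul, map_mul, paritySign_gen, map_smul]
    simp only [smul_mul_assoc, mul_add, add_mul, smul_add, mul_assoc, add_assoc]

/-- The matrix that encodes the generator `g` together with the value `val g` at `g` of a derivation
of parity `ε` along `ι`. -/
def derMatrix (ι : Alg D →ₐ[ℝ] 𝒜) (ε : ℕ) (val : Gen D → 𝒜) (g : Gen D) :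
    Matrix (Fin 2) (Fin 2) 𝒜 :=
  !![(-1 : ℝ) ^ (ε * g.parity) • ι (gen g), val g; 0, ι (gen g)]

variable {val : Gen D → 𝒜}

theorem derMatrix_comm
    (superComm : ∀ g h, val g * ι (gen h) =
      (-1 : ℝ) ^ ((g.parity + ε) * h.parity) • (ι (gen h) * val g)) (g h : Gen D) :
    derMatrix ι ε val g * derMatrix ι ε val h =
      (-1 : ℝ) ^ (g.parity * h.parity) • (derMatrix ι ε val h * derMatrix ι ε val g) := by
  have gen_comm' : ι (gen g) * ι (gen h) =
      (-1 : ℝ) ^ (g.parity * h.parity) • (ι (gen h) * ι (gen g)) := by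
    rw [← map_mul, gen_comm g h, map_smul, map_mul]
  have sign_mul_self (n : ℕ) : (-1 : ℝ) ^ n * (-1) ^ n = 1 := by rw [← mul_pow]; simp
  ext i j
  fin_cases i <;> fin_cases j <;> simp only [derMatrix, Matrix.mul_apply, Fin.sum_univ_two]
  · simp only [gen_comm', Matrix.of_apply, Matrix.cons_val', Matrix.cons_val_zero,
      Matrix.cons_val_one, Matrix.cons_val_fin_one, Fin.mk_zero, mul_zero, add_zero,
      smul_mul_smul_comm, smul_smul, Matrix.smul_apply, Matrix.mul_apply, Fin.sum_univ_two]
    congr 1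
    ring
  · simp only [superComm h g, superComm g h, smul_mul_assoc, smul_smul, smul_add, Matrix.of_apply,
      Matrix.cons_val', Matrix.cons_val_zero, Matrix.cons_val_one, Matrix.cons_val_fin_one,
      Fin.mk_one, Fin.mk_zero, Matrix.smul_apply, Matrix.mul_apply, Fin.sum_univ_two]
    rw [add_comm]
    congr 2
    · rw [add_mul, pow_add, mul_comm g.parity h.parity]
    · rw [add_mul, pow_add, mul_comm h.parity g.parity, ← mul_assoc, sign_mul_self, one_mul]
  · simp
  · simp [gen_comm']

theorem linearCombination_derMatrix (v : Gen D →₀ ℝ) :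
    Finsupp.linearCombination ℝ (derMatrix ι ε val) v =
      !![ι (Finsupp.linearCombination ℝ (fun g : Gen D => (-1 : ℝ) ^ (ε * g.parity) • gen g) v),
        Finsupp.linearCombination ℝ val v; 0, ι (Finsupp.linearCombination ℝ gen v)] := by
  induction v using Finsupp.induction_linear with
  | zero => ext i j; fin_cases i <;> fin_cases j <;> simp
  | add f g hf hg => rw [map_add, hf, hg]; ext i j; fin_cases i <;> fin_cases j <;> simp
  | single g c => ext i j; fin_cases i <;> fin_cases j <;> simp [derMatrix]

theorem lower_row_of_derMatrix {φ : Alg D →ₐ[ℝ] Matrix (Fin 2) (Fin 2) 𝒜}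
    (hφ : ∀ g, φ (gen g) = derMatrix ι ε val g) (a : Alg D) : φ a 1 1 = ι a ∧ φ a 1 0 = 0 := by
  induction a using alg_induction with
  | one => simp
  | add a b ha hb => simp [ha.1, ha.2, hb.1, hb.2]
  | smul c a ha => simp [ha.1, ha.2]
  | gen_mul g a ha =>
    simp [Matrix.mul_apply, Fin.sum_univ_two, ha.1, ha.2, hφ, derMatrix]

theorem exists_isDerAlong
    (superComm : ∀ g h, val g * ι (gen h) =
      (-1 : ℝ) ^ ((g.parity + ε) * h.parity) • (ι (gen h) * val g))
    (lin : ∀ v, LinRel D v → Finsupp.linearCombination ℝ val v = 0) :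
    ∃ X : Alg D →ₗ[ℝ] 𝒜, IsDerAlong ι ε X ∧ ∀ g, X (gen g) = val g := by
  let φ : Alg D →ₐ[ℝ] Matrix (Fin 2) (Fin 2) 𝒜 :=
    liftAlg (derMatrix ι ε val) (derMatrix_comm superComm) fun v hv => by
      rw [linearCombination_derMatrix, sign_lin ε hv, lin v hv, gen_lin hv]
      ext i j; fin_cases i <;> fin_cases j <;> simp
  have hφ : ∀ g, φ (gen g) = derMatrix ι ε val g := fun g => liftAlg_gen ..
  refine ⟨Matrix.entryLinearMap ℝ 𝒜 (0 : Fin 2) (1 : Fin 2) ∘ₗ φ.toLinearMap,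
    ⟨by simp, fun g a => ?_⟩, fun g => by simp [hφ, derMatrix]⟩
  change φ (gen g * a) 0 1 = φ (gen g) 0 1 * ι a + _ • (ι (gen g) * φ a 0 1)
  rw [map_mul, Matrix.mul_apply, Fin.sum_univ_two, (lower_row_of_derMatrix hφ a).1, hφ, add_comm]
  simp [derMatrix]

end IsDerAlong

/-- Left graded derivations of `Alg D` of parity `ε`. -/
abbrev IsDer (ε : ℕ) (X : Alg D →ₗ[ℝ] Alg D) : Prop := IsDerAlong (AlgHom.id ℝ (Alg D)) ε X

theorem DerData.isDer {ε : ℕ} (X : DerData D ε) : IsDer ε X.der where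
  one := by simp [DerData.der]
  gen_mul g a := by simp [X.der_gen_mul]

/-- `a` is homogeneous of Grassmann parity `n`; only `n` modulo two matters. -/
def HasParity (n : ℕ) (a : Alg D) : Prop := ∀ ε, paritySign D ε a = (-1 : ℝ) ^ (ε * n) • a

namespace HasParity

variable {n m : ℕ} {a b : Alg D}

theorem gen (g : Gen D) : HasParity g.parity (gen g) := fun ε => paritySign_gen ε g

theorem zero (n : ℕ) : HasParity n (0 : Alg D) := fun ε => by simp

theorem add (ha : HasParity n a) (hb : HasParity n b) : HasParity n (a + b) := fun ε => by
  rw [map_add, ha, hb, smul_add]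

theorem smul (c : ℝ) (ha : HasParity n a) : HasParity n (c • a) := fun ε => by
  rw [map_smul, ha, smul_comm]

theorem congr (ha : HasParity n a) (h : n % 2 = m % 2) : HasParity m a := fun ε => by
  rw [ha, mul_comm ε, mul_comm ε, pow_mul, pow_mul, neg_one_pow_eq_pow_mod_two (n := n), h,
    ← neg_one_pow_eq_pow_mod_two]

end HasParity

section Derivations

variable {ε ε' : ℕ} {X Y : Alg D →ₗ[ℝ] Alg D}

theorem IsDerAlong.apply_gen_mul (hX : IsDer ε X) (g : Gen D) (a : Alg D) :
    X (gen g * a) = X (gen g) * a + (-1 : ℝ) ^ (ε * g.parity) • (gen g * X a) := hX.gen_mul g a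

theorem IsDerAlong.apply_mul_of_hasParity (hX : IsDer ε X) {n : ℕ} {u : Alg D}
    (hu : HasParity n u) (a : Alg D) : X (u * a) = X u * a + (-1 : ℝ) ^ (ε * n) • (u * X a) := by
  rw [hX.mul, AlgHom.id_apply, AlgHom.id_apply, hu, smul_mul_assoc]

theorem isDer_zero (ε : ℕ) : IsDer ε (0 : Alg D →ₗ[ℝ] Alg D) where
  one := rfl
  gen_mul g a := by simp

theorem IsDerAlong.bracket (hX : IsDer ε X) (hY : IsDer ε' Y)
    (parityX : ∀ g, HasParity (g.parity + ε) (X (gen g)))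
    (parityY : ∀ g, HasParity (g.parity + ε') (Y (gen g))) :
    IsDer (ε + ε') (X ∘ₗ Y - (-1 : ℝ) ^ (ε * ε') • Y ∘ₗ X) where
  one := by simp [hX.one, hY.one]
  gen_mul g a := by
    simp only [AlgHom.id_apply, LinearMap.sub_apply, LinearMap.smul_apply, LinearMap.comp_apply,
      hX.apply_gen_mul, hY.apply_gen_mul, map_add, map_smul, hX.apply_mul_of_hasParity (parityY g),
      hY.apply_mul_of_hasParity (parityX g), smul_add, smul_mul_assoc, mul_sub, sub_mul, smul_sub,
      mul_smul_comm, smul_smul, mul_add, add_mul, pow_add, mul_comm ε' ε]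
    have sign_sq : (-1 : ℝ) ^ (ε * ε') * (-1 : ℝ) ^ (ε * ε') = 1 := by rw [← mul_pow]; simp
    generalize (-1 : ℝ) ^ (ε * ε') = s at *
    generalize (-1 : ℝ) ^ (ε * g.parity) = s1
    generalize (-1 : ℝ) ^ (ε' * g.parity) = s2
    match_scalars
    all_goals first | ring1 | linear_combination (-s2) * sign_sq

theorem IsDerAlong.comp_eq_of_gen (hX : IsDer ε X) (hY : IsDer 0 Y)
    (parityX : ∀ g, HasParity (g.parity + ε) (X (gen g)))
    (parityY : ∀ g, HasParity g.parity (Y (gen g)))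
    (h : ∀ g, X (Y (gen g)) = Y (X (gen g))) (a : Alg D) : X (Y a) = Y (X a) := by
  have commutator := (hX.bracket hY parityX parityY).ext (isDer_zero _) fun g => by simp [h g]
  simpa [sub_eq_zero] using LinearMap.congr_fun commutator a

end Derivations

/-! ### Form degree and antifield number -/

/-- Local forms without explicit dependence on the coordinates, of form degree `p` and antifield
number `q`. -/
def algForms (D : ℕ) (p q : ℤ) : Submodule ℝ (Alg D) :=
  Submodule.span ℝ {a | ∃ l : List (Gen D),
    (l.map Gen.formDeg).sum = p ∧ (l.map Gen.antigh).sum = q ∧ a = (l.map gen).prod}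

theorem prod_gen_mem_algForms (l : List (Gen D)) :
    (l.map gen).prod ∈ algForms D (l.map Gen.formDeg).sum (l.map Gen.antigh).sum :=
  Submodule.subset_span ⟨l, rfl, rfl, rfl⟩

theorem one_mem_algForms : (1 : Alg D) ∈ algForms D 0 0 := prod_gen_mem_algForms []

theorem gen_mem_algForms (g : Gen D) : gen g ∈ algForms D g.formDeg g.antigh := by
  simpa using prod_gen_mem_algForms [g]

theorem mul_mem_algForms {p q p' q' : ℤ} {a b : Alg D} (ha : a ∈ algForms D p q)
    (hb : b ∈ algForms D p' q') : a * b ∈ algForms D (p + p') (q + q') := by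
  have hab := Submodule.mul_mem_mul ha hb
  rw [algForms, algForms, Submodule.span_mul_span] at hab
  refine Submodule.span_mono ?_ hab
  rintro _ ⟨_, ⟨l, rfl, rfl, rfl⟩, _, ⟨l', rfl, rfl, rfl⟩, rfl⟩
  exact ⟨l ++ l', by simp⟩

theorem IsDerAlong.mem_algForms {ε : ℕ} {X : Alg D →ₗ[ℝ] Alg D} (hX : IsDer ε X) {dp dq : ℤ}
    (h : ∀ g : Gen D, X (gen g) ∈ algForms D (g.formDeg + dp) (g.antigh + dq)) {p q : ℤ}
    {a : Alg D} (ha : a ∈ algForms D p q) : X a ∈ algForms D (p + dp) (q + dq) := by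
  suffices ∀ l : List (Gen D), X (l.map gen).prod ∈
      algForms D ((l.map Gen.formDeg).sum + dp) ((l.map Gen.antigh).sum + dq) by
    refine Submodule.span_le (p := (algForms D (p + dp) (q + dq)).comap X) |>.2 ?_ ha
    rintro _ ⟨l, rfl, rfl, rfl⟩
    exact this l
  intro l
  induction l with
  | nil => simp [hX.one]
  | cons g l ih =>
    simp only [List.map_cons, List.prod_cons, List.sum_cons, hX.apply_gen_mul]
    refine add_mem ?_ (Submodule.smul_mem _ _ ?_)
    · convert mul_mem_algForms (h g) (prod_gen_mem_algForms l) using 2 <;> ring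
    · convert mul_mem_algForms (gen_mem_algForms g) ih using 2 <;> ring

/-! ### Labels of the undifferentiated fields and the Young projector -/

/-- The undifferentiated fields, ghosts and antifields, indexed by their components. -/
inductive Lab (D : ℕ) : Type
  | T (α β γ : Fin D)
  | S (α β : Fin D)
  | A (α β : Fin D)
  | C (α : Fin D)
  | Ts (α β γ : Fin D)
  | Ss (α β : Fin D)
  | As (α β : Fin D)
  | Cs (α : Fin D)

/-- The labels as a sum type, which makes them a finite type. -/
def labEquiv (D : ℕ) : ((Fin D × Fin D × Fin D) ⊕ (Fin D × Fin D) ⊕ (Fin D × Fin D) ⊕ Fin D) ⊕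
    ((Fin D × Fin D × Fin D) ⊕ (Fin D × Fin D) ⊕ (Fin D × Fin D) ⊕ Fin D) ≃ Lab D where
  toFun
    | .inl (.inl (a, b, c)) => .T a b c
    | .inl (.inr (.inl (a, b))) => .S a b
    | .inl (.inr (.inr (.inl (a, b)))) => .A a b
    | .inl (.inr (.inr (.inr a))) => .C a
    | .inr (.inl (a, b, c)) => .Ts a b c
    | .inr (.inr (.inl (a, b))) => .Ss a b
    | .inr (.inr (.inr (.inl (a, b)))) => .As a b
    | .inr (.inr (.inr (.inr a))) => .Cs a
  invFun
    | .T a b c => .inl (.inl (a, b, c))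
    | .S a b => .inl (.inr (.inl (a, b)))
    | .A a b => .inl (.inr (.inr (.inl (a, b))))
    | .C a => .inl (.inr (.inr (.inr a)))
    | .Ts a b c => .inr (.inl (a, b, c))
    | .Ss a b => .inr (.inr (.inl (a, b)))
    | .As a b => .inr (.inr (.inr (.inl (a, b))))
    | .Cs a => .inr (.inr (.inr (.inr a)))
  left_inv x := by rcases x with (x | x | x | x) | (x | x | x | x) <;> rfl
  right_inv x := by cases x <;> rfl

instance : Fintype (Lab D) := Fintype.ofEquiv _ (labEquiv D)

instance : DecidableEq (Lab D) := Classical.decEq _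

theorem sum_lab {M : Type*} [AddCommMonoid M] (f : Lab D → M) :
    ∑ l, f l = ((∑ a, ∑ b, ∑ c, f (.T a b c)) + ((∑ a, ∑ b, f (.S a b)) +
      ((∑ a, ∑ b, f (.A a b)) + ∑ a, f (.C a)))) +
      ((∑ a, ∑ b, ∑ c, f (.Ts a b c)) + ((∑ a, ∑ b, f (.Ss a b)) +
      ((∑ a, ∑ b, f (.As a b)) + ∑ a, f (.Cs a)))) := by
  rw [← (labEquiv D).sum_comp]
  simp only [Fintype.sum_sum_type, Fintype.sum_prod_type]
  rfl

/-- The derivative `∂_k` of the variable with label `l`. -/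
def Lab.at : Lab D → Multiset (Fin D) → Gen D
  | .T a b c, k => .T a b c k
  | .S a b, k => .S a b k
  | .A a b, k => .A a b k
  | .C a, k => .C a k
  | .Ts a b c, k => .Ts a b c k
  | .Ss a b, k => .Ss a b k
  | .As a b, k => .As a b k
  | .Cs a, k => .Cs a k

/-- The kind of a variable: the label without its tensor indices. -/
def Lab.kind : Lab D → ℕ
  | .T _ _ _ => 0
  | .S _ _ => 1
  | .A _ _ => 2
  | .C _ => 3
  | .Ts _ _ _ => 4
  | .Ss _ _ => 5
  | .As _ _ => 6
  | .Cs _ => 7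

/-- Grassmann parity of a variable and all its derivatives. -/
def Lab.parity (l : Lab D) : ℕ := (l.at 0).parity

/-- Antifield number of a variable and all its derivatives. -/
def Lab.antigh (l : Lab D) : ℤ := (l.at 0).antigh

/-- The level of a variable: its antifield number, except that the ghosts, on which the
Koszul–Tate differential acts trivially, are set apart at level `5`. -/
def Lab.lev : Lab D → ℕ
  | .T _ _ _ => 0
  | .S _ _ => 5
  | .A _ _ => 5
  | .C _ => 5
  | .Ts _ _ _ => 1
  | .Ss _ _ => 2
  | .As _ _ => 2
  | .Cs _ => 3

@[simp]
theorem parity_at (l : Lab D) (k : Multiset (Fin D)) : (l.at k).parity = l.parity := by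
  cases l <;> rfl

@[simp]
theorem antigh_at (l : Lab D) (k : Multiset (Fin D)) : (l.at k).antigh = l.antigh := by
  cases l <;> rfl

@[simp]
theorem formDeg_at (l : Lab D) (k : Multiset (Fin D)) : (l.at k).formDeg = 0 := by
  cases l <;> rfl

theorem Lab.parity_eq_of_kind {l m : Lab D} (h : l.kind = m.kind) : l.parity = m.parity := by
  cases l <;> cases m <;> first | rfl | simp [Lab.kind] at h

theorem Lab.antigh_eq_of_kind {l m : Lab D} (h : l.kind = m.kind) : l.antigh = m.antigh := by
  cases l <;> cases m <;> first | rfl | simp [Lab.kind] at h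

theorem Lab.lev_eq_of_kind {l m : Lab D} (h : l.kind = m.kind) : l.lev = m.lev := by
  cases l <;> cases m <;> first | rfl | simp [Lab.kind] at h

theorem Lab.parity_add_one_of_lev {l m : Lab D} (h : m.lev = l.lev + 1) :
    m.parity % 2 = (l.parity + 1) % 2 := by
  cases l <;> cases m <;> simp_all [Lab.lev, Lab.parity, Lab.at, Gen.parity]

theorem Lab.neg_one_pow_parity_of_lev {l m : Lab D} (h : m.lev = l.lev + 1) :
    (-1 : ℝ) ^ m.parity = (-1) ^ (l.parity + 1) := by
  rw [neg_one_pow_eq_pow_mod_two, Lab.parity_add_one_of_lev h, ← neg_one_pow_eq_pow_mod_two]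

theorem Lab.antigh_add_one_of_lev {l m : Lab D} (h : m.lev = l.lev + 1) :
    m.antigh = l.antigh + 1 := by
  cases l <;> cases m <;> simp_all [Lab.lev, Lab.antigh, Lab.at, Gen.antigh]

theorem Gen.eq_dx_or_at (g : Gen D) : (∃ μ, g = .dx μ) ∨ ∃ l : Lab D, ∃ k, g = l.at k := by
  cases g with
  | T a b c k => exact .inr ⟨.T a b c, k, rfl⟩
  | S a b k => exact .inr ⟨.S a b, k, rfl⟩
  | A a b k => exact .inr ⟨.A a b, k, rfl⟩
  | C a k => exact .inr ⟨.C a, k, rfl⟩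
  | Ts a b c k => exact .inr ⟨.Ts a b c, k, rfl⟩
  | Ss a b k => exact .inr ⟨.Ss a b, k, rfl⟩
  | As a b k => exact .inr ⟨.As a b, k, rfl⟩
  | Cs a k => exact .inr ⟨.Cs a, k, rfl⟩
  | dx μ => exact .inl ⟨μ, rfl⟩

section Young

variable {M N : Type*} [AddCommGroup M] [Module ℝ M] [AddCommGroup N] [Module ℝ N]

/-- The projector onto tensors that are antisymmetric in the first two indices and have vanishing
cyclic sum. -/
def hook (x : Fin D → Fin D → Fin D → M) (a b c : Fin D) : M :=
  (1 / 3 : ℝ) • (x a b c - x b a c) - (1 / 6 : ℝ) • (x b c a - x c b a + x c a b - x a c b)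

/-- The projector onto families of tensors with the symmetries of the generators. -/
def young : (Lab D → M) →ₗ[ℝ] (Lab D → M) where
  toFun v
    | .T a b c => hook (fun a b c => v (.T a b c)) a b c
    | .S a b => (1 / 2 : ℝ) • (v (.S a b) + v (.S b a))
    | .A a b => (1 / 2 : ℝ) • (v (.A a b) - v (.A b a))
    | .C a => v (.C a)
    | .Ts a b c => hook (fun a b c => v (.Ts a b c)) a b c
    | .Ss a b => (1 / 2 : ℝ) • (v (.Ss a b) + v (.Ss b a))
    | .As a b => (1 / 2 : ℝ) • (v (.As a b) - v (.As b a))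
    | .Cs a => v (.Cs a)
  map_add' v w := by
    funext l; cases l <;> simp only [hook, Pi.add_apply] <;> module
  map_smul' r v := by
    funext l; cases l <;> simp only [hook, Pi.smul_apply, RingHom.id_apply] <;> module

/-- The symmetries of the generators, for families of tensors with values in a module. -/
structure IsSym (v : Lab D → M) : Prop where
  T_anti : ∀ a b c, v (.T a b c) = -v (.T b a c)
  T_cyc : ∀ a b c, v (.T a b c) + v (.T b c a) + v (.T c a b) = 0
  S_symm : ∀ a b, v (.S a b) = v (.S b a)
  A_anti : ∀ a b, v (.A a b) = -v (.A b a)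
  Ts_anti : ∀ a b c, v (.Ts a b c) = -v (.Ts b a c)
  Ts_cyc : ∀ a b c, v (.Ts a b c) + v (.Ts b c a) + v (.Ts c a b) = 0
  Ss_symm : ∀ a b, v (.Ss a b) = v (.Ss b a)
  As_anti : ∀ a b, v (.As a b) = -v (.As b a)

theorem hook_eq_self {x : Fin D → Fin D → Fin D → M} (anti : ∀ a b c, x a b c = -x b a c)
    (cyc : ∀ a b c, x a b c + x b c a + x c a b = 0) (a b c : Fin D) : hook x a b c = x a b c := by
  rw [hook, anti b a c, anti c b a, anti a c b]
  linear_combination (norm := module) (-1 / 3 : ℝ) • cyc a b c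

theorem IsSym.young_eq {v : Lab D → M} (h : IsSym v) : young v = v := by
  funext l
  cases l with
  | T a b c => exact hook_eq_self h.T_anti h.T_cyc a b c
  | S a b => simp only [young, LinearMap.coe_mk, AddHom.coe_mk, h.S_symm b a]; module
  | A a b => simp only [young, LinearMap.coe_mk, AddHom.coe_mk, h.A_anti b a]; module
  | C a => rfl
  | Ts a b c => exact hook_eq_self h.Ts_anti h.Ts_cyc a b c
  | Ss a b => simp only [young, LinearMap.coe_mk, AddHom.coe_mk, h.Ss_symm b a]; module
  | As a b => simp only [young, LinearMap.coe_mk, AddHom.coe_mk, h.As_anti b a]; module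
  | Cs a => rfl

theorem isSym_young (v : Lab D → M) : IsSym (young v) := by
  constructor <;> intros <;> simp only [young, LinearMap.coe_mk, AddHom.coe_mk, hook] <;> module

theorem isSym_iff {v : Lab D → M} : IsSym v ↔ young v = v :=
  ⟨fun h => h.young_eq, fun h => h ▸ isSym_young v⟩

theorem young_young (v : Lab D → M) : young (young v) = young v := (isSym_young v).young_eq

theorem young_map (f : M →ₗ[ℝ] N) (v : Lab D → M) :
    young (fun l => f (v l)) = fun l => f (young v l) := by
  funext l
  cases l <;> simp [young, hook]

theorem young_eq_zero_of_kind {v : Lab D → M} {l : Lab D}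
    (h : ∀ m : Lab D, m.kind = l.kind → v m = 0) : young v l = 0 := by
  cases l <;> simp only [Lab.kind] at h <;>
    simp only [young, LinearMap.coe_mk, AddHom.coe_mk, hook] <;> simp [h]

theorem sum_hook_adjoint (ψ : Fin D → Fin D → Fin D → (N →ₗ[ℝ] M)) (x : Fin D → Fin D → Fin D → N) :
    ∑ a, ∑ b, ∑ c, ψ a b c (hook x a b c) = ∑ a, ∑ b, ∑ c, hook ψ a b c (x a b c) := by
  have swap_first : ∀ f : Fin D → Fin D → Fin D → M,
      ∑ a, ∑ b, ∑ c, f b a c = ∑ a, ∑ b, ∑ c, f a b c := fun f => Finset.sum_comm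
  have swap_last : ∀ f : Fin D → Fin D → Fin D → M,
      ∑ a, ∑ b, ∑ c, f a c b = ∑ a, ∑ b, ∑ c, f a b c := fun f =>
    Finset.sum_congr rfl fun a _ => Finset.sum_comm
  have cycle : ∀ f : Fin D → Fin D → Fin D → M,
      ∑ a, ∑ b, ∑ c, f b c a = ∑ a, ∑ b, ∑ c, f a b c := fun f => by
    rw [swap_first fun a b c => f a c b, swap_last]
  have cycle_inv : ∀ f : Fin D → Fin D → Fin D → M,
      ∑ a, ∑ b, ∑ c, f c a b = ∑ a, ∑ b, ∑ c, f a b c := fun f => by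
    rw [swap_last fun a b c => f b a c, swap_first]
  have reverse : ∀ f : Fin D → Fin D → Fin D → M,
      ∑ a, ∑ b, ∑ c, f c b a = ∑ a, ∑ b, ∑ c, f a b c := fun f => by
    rw [cycle fun a b c => f b a c, swap_first]
  simp only [hook, map_sub, map_add, map_smul, LinearMap.sub_apply, LinearMap.add_apply,
    LinearMap.smul_apply, Finset.sum_sub_distrib, Finset.sum_add_distrib, ← Finset.smul_sum]
  rw [← swap_first fun a b c => ψ a b c (x b a c), ← reverse fun a b c => ψ a b c (x c b a),
    ← swap_last fun a b c => ψ a b c (x a c b), ← cycle fun a b c => ψ a b c (x c a b),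
    ← cycle_inv fun a b c => ψ a b c (x b c a)]
  module

theorem sum_young_adjoint (ψ : Lab D → (N →ₗ[ℝ] M)) (v : Lab D → N) :
    ∑ l, ψ l (young v l) = ∑ l, young ψ l (v l) := by
  have swap : ∀ f : Fin D → Fin D → M, ∑ a, ∑ b, f b a = ∑ a, ∑ b, f a b :=
    fun f => Finset.sum_comm
  rw [sum_lab, sum_lab]
  simp only [young, LinearMap.coe_mk, AddHom.coe_mk]
  rw [sum_hook_adjoint (fun a b c => ψ (.T a b c)), sum_hook_adjoint (fun a b c => ψ (.Ts a b c))]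
  simp only [map_sub, map_add, map_smul, LinearMap.sub_apply, LinearMap.add_apply,
    LinearMap.smul_apply, Finset.sum_sub_distrib, Finset.sum_add_distrib, ← Finset.smul_sum]
  rw [← swap fun a b => ψ (.S a b) (v (.S b a)), ← swap fun a b => ψ (.A a b) (v (.A b a)),
    ← swap fun a b => ψ (.Ss a b) (v (.Ss b a)), ← swap fun a b => ψ (.As a b) (v (.As b a))]

theorem sum_apply_single {ι : Type*} [Fintype ι] [DecidableEq ι] (ψ : ι → (N →ₗ[ℝ] M)) (i : ι)
    (x : N) : ∑ j, ψ j (Pi.single (M := fun _ => N) i x j) = ψ i x := by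
  rw [Finset.sum_eq_single i]
  · simp
  · intro j _ hj; simp [hj]
  · simp

theorem young_single_apply (l m : Lab D) (x : M) :
    young (Pi.single l x) m = young (Pi.single m (LinearMap.id : M →ₗ[ℝ] M)) l x := by
  have adjoint := sum_young_adjoint (Pi.single m (LinearMap.id : M →ₗ[ℝ] M)) (Pi.single l x)
  rw [sum_apply_single] at adjoint
  rw [← adjoint, Finset.sum_eq_single m]
  · simp
  · intro n _ hn; simp [hn]
  · simp

theorem isSym_young_single (x : M) : IsSym fun l : Lab D => young (Pi.single l x) := by
  refine isSym_iff.2 (funext₂ fun l m => ?_)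
  let symmetrizer : Lab D → (M →ₗ[ℝ] M) := young (Pi.single m LinearMap.id)
  have single_apply (l : Lab D) : young (Pi.single l x) m = symmetrizer l x :=
    young_single_apply l m x
  calc young (fun l => young (Pi.single l x)) l m
    _ = young (fun l => young (Pi.single l x) m) l :=
      (congrFun (young_map (LinearMap.proj (φ := fun _ : Lab D => M) m)
        fun l => young (Pi.single l x)) l).symm
    _ = young (fun l => symmetrizer l x) l := by simp only [single_apply]
    _ = young symmetrizer l x := congrFun (young_map (LinearMap.applyₗ x) _) l
    _ = young (Pi.single l x) m := by
      rw [single_apply, young_young]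

end Young

/-! ### The linear part of the algebra as a module over the differential operators -/

/-- Differential operators with constant coefficients, as polynomials in the derivatives `∂_μ`. -/
abbrev Op (D : ℕ) : Type := MvPolynomial (Fin D) ℝ

/-- The operator `∂_k`. -/
def mono (k : Multiset (Fin D)) : Op D := MvPolynomial.monomial (Multiset.toFinsupp k) 1

theorem mono_zero : mono (0 : Multiset (Fin D)) = 1 := by simp [mono]

theorem mono_cons (μ : Fin D) (k : Multiset (Fin D)) :
    mono (μ ::ₘ k) = MvPolynomial.X μ * mono k := by
  rw [mono, ← Multiset.singleton_add, map_add, Multiset.toFinsupp_singleton, MvPolynomial.X, mono,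
    MvPolynomial.monomial_mul, one_mul]

theorem op_induction {p : Op D → Prop} (r : Op D) (mono : ∀ k, p (mono k))
    (add : ∀ r s, p r → p s → p (r + s)) (smul : ∀ (c : ℝ) r, p r → p (c • r)) : p r := by
  induction r using MvPolynomial.induction_on' with
  | monomial u a =>
    have monomial_eq : MvPolynomial.monomial u a = a • HookGauge.mono (Finsupp.toMultiset u) := by
      rw [HookGauge.mono, Finsupp.toMultiset_toFinsupp, MvPolynomial.smul_monomial, smul_eq_mul,
        mul_one]
    rw [monomial_eq]
    exact smul _ _ (mono _)
  | add r s hr hs => exact add _ _ hr hs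

theorem op_linearMap_ext {M : Type*} [AddCommGroup M] [Module ℝ M] {f h : Op D →ₗ[ℝ] M}
    (eq_mono : ∀ k, f (mono k) = h (mono k)) : f = h := by
  refine LinearMap.ext fun r => ?_
  induction r using op_induction with
  | mono k => exact eq_mono k
  | add r s hr hs => rw [map_add, map_add, hr, hs]
  | smul c r hr => rw [map_smul, map_smul, hr]

/-- The derivatives `r ↦ r(∂) z` of the variable `z` with label `l`. -/
def genOp (l : Lab D) : Op D →ₗ[ℝ] Alg D :=
  (MvPolynomial.basisMonomials (Fin D) ℝ).constr ℝ fun s => gen (l.at (Finsupp.toMultiset s))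

@[simp]
theorem genOp_mono (l : Lab D) (k : Multiset (Fin D)) : genOp l (mono k) = gen (l.at k) := by
  simpa [genOp, mono] using (MvPolynomial.basisMonomials (Fin D) ℝ).constr_basis ℝ
    (fun s => gen (l.at (Finsupp.toMultiset s))) (Multiset.toFinsupp k)

theorem linRel_eq_zero {M : Type*} [AddCommGroup M] [Module ℝ M] {f : Gen D → M}
    (h : ∀ k, IsSym fun l : Lab D => f (l.at k)) {v : Gen D →₀ ℝ} (hv : LinRel D v) :
    Finsupp.linearCombination ℝ f v = 0 := by
  cases hv with
  | T_antisymm a b c k => simp [show f (.T a b c k) = _ from (h k).T_anti a b c, Lab.at]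
  | T_cyclic a b c k => simpa [Lab.at] using (h k).T_cyc a b c
  | S_symm a b k => simp [show f (.S a b k) = _ from (h k).S_symm a b, Lab.at]
  | A_antisymm a b k => simp [show f (.A a b k) = _ from (h k).A_anti a b, Lab.at]
  | Ts_antisymm a b c k => simp [show f (.Ts a b c k) = _ from (h k).Ts_anti a b c, Lab.at]
  | Ts_cyclic a b c k => simpa [Lab.at] using (h k).Ts_cyc a b c
  | Ss_symm a b k => simp [show f (.Ss a b k) = _ from (h k).Ss_symm a b, Lab.at]
  | As_antisymm a b k => simp [show f (.As a b k) = _ from (h k).As_anti a b, Lab.at]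

theorem isSym_of_linRel {M : Type*} [AddCommGroup M] [Module ℝ M] {f : Gen D → M}
    (h : ∀ v, LinRel D v → Finsupp.linearCombination ℝ f v = 0) (k : Multiset (Fin D)) :
    IsSym fun l : Lab D => f (l.at k) where
  T_anti a b c :=
    eq_neg_of_add_eq_zero_left (by simpa [Lab.at] using h _ (.T_antisymm a b c k))
  T_cyc a b c := by simpa [Lab.at] using h _ (.T_cyclic a b c k)
  S_symm a b := by simpa [sub_eq_zero, Lab.at] using h _ (.S_symm a b k)
  A_anti a b :=
    eq_neg_of_add_eq_zero_left (by simpa [Lab.at] using h _ (.A_antisymm a b k))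
  Ts_anti a b c :=
    eq_neg_of_add_eq_zero_left (by simpa [Lab.at] using h _ (.Ts_antisymm a b c k))
  Ts_cyc a b c := by simpa [Lab.at] using h _ (.Ts_cyclic a b c k)
  Ss_symm a b := by simpa [sub_eq_zero, Lab.at] using h _ (.Ss_symm a b k)
  As_anti a b :=
    eq_neg_of_add_eq_zero_left (by simpa [Lab.at] using h _ (.As_antisymm a b k))

theorem isSym_gen (k : Multiset (Fin D)) : IsSym fun l : Lab D => gen (l.at k) :=
  isSym_of_linRel (fun _ hv => gen_lin hv) k

theorem isSym_genOp : IsSym (genOp : Lab D → (Op D →ₗ[ℝ] Alg D)) :=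
  isSym_iff.2 <| funext fun l => op_linearMap_ext fun k => by
    have evaluated := congrFun (young_map (LinearMap.applyₗ (mono k)) genOp) l
    simpa [(isSym_gen k).young_eq] using evaluated.symm

/-- Linear combinations of the variables with differential operators as coefficients.  The
symmetries of the variables are not divided out, but see `young`. -/
abbrev Lin (D : ℕ) : Type := Lab D → Op D

/-- The element of the algebra represented by a linear combination of the variables. -/
def toAlg : Lin D →ₗ[ℝ] Alg D := ∑ l, genOp l ∘ₗ LinearMap.proj l

theorem toAlg_apply (v : Lin D) : toAlg v = ∑ l, genOp l (v l) := by
  simp [toAlg]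

@[simp]
theorem toAlg_young (v : Lin D) : toAlg (young v) = toAlg v := by
  rw [toAlg_apply, toAlg_apply, sum_young_adjoint, isSym_genOp.young_eq]

theorem toAlg_single (l : Lab D) (r : Op D) : toAlg (Pi.single l r) = genOp l r := by
  rw [toAlg_apply]
  exact sum_apply_single genOp l r

theorem lin_induction {p : Lin D → Prop} (v : Lin D) (zero : p 0)
    (single : ∀ l k, p (Pi.single l (mono k))) (add : ∀ v w, p v → p w → p (v + w))
    (smul : ∀ (c : ℝ) v, p v → p (c • v)) : p v := by
  have single_op (l : Lab D) (r : Op D) : p (Pi.single l r) := by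
    induction r using op_induction with
    | mono k => exact single l k
    | add r s hr hs => rw [Pi.single_add]; exact add _ _ hr hs
    | smul c r hr => rw [Pi.single_smul]; exact smul _ _ hr
  rw [← Finset.univ_sum_single v]
  exact Finset.sum_induction _ p add zero fun l _ => single_op l _

/-- The representative of a generator in `Lin D` that has the symmetries of the generators; the
differentials `dx` are not represented. -/
def toLin : Gen D → Lin D
  | .T a b c k => young (Pi.single (.T a b c) (mono k))
  | .S a b k => young (Pi.single (.S a b) (mono k))
  | .A a b k => young (Pi.single (.A a b) (mono k))
  | .C a k => young (Pi.single (.C a) (mono k))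
  | .Ts a b c k => young (Pi.single (.Ts a b c) (mono k))
  | .Ss a b k => young (Pi.single (.Ss a b) (mono k))
  | .As a b k => young (Pi.single (.As a b) (mono k))
  | .Cs a k => young (Pi.single (.Cs a) (mono k))
  | .dx _ => 0

theorem toLin_at (l : Lab D) (k : Multiset (Fin D)) :
    toLin (l.at k) = young (Pi.single l (mono k)) := by
  cases l <;> rfl

theorem young_toLin (g : Gen D) : young (toLin g) = toLin g := by
  rcases g.eq_dx_or_at with ⟨μ, rfl⟩ | ⟨l, k, rfl⟩
  · simp [toLin]
  · rw [toLin_at, young_young]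

theorem isSym_toLin (k : Multiset (Fin D)) : IsSym fun l : Lab D => toLin (l.at k) := by
  simpa only [toLin_at] using isSym_young_single (mono k)

@[simp]
theorem toAlg_toLin_at (l : Lab D) (k : Multiset (Fin D)) :
    toAlg (toLin (l.at k)) = gen (l.at k) := by
  rw [toLin_at, toAlg_young, toAlg_single, genOp_mono]

theorem toLin_at_of_kind {l m : Lab D} (h : m.kind ≠ l.kind) (k : Multiset (Fin D)) :
    toLin (l.at k) m = 0 := by
  rw [toLin_at]
  refine young_eq_zero_of_kind fun n hn => ?_
  rw [Pi.single_eq_of_ne]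
  rintro rfl
  exact h hn.symm

theorem parity_of_toLin_ne_zero {g : Gen D} {m : Lab D} (h : toLin g m ≠ 0) :
    g.parity = m.parity := by
  rcases g.eq_dx_or_at with ⟨μ, rfl⟩ | ⟨l, k, rfl⟩
  · simp [toLin] at h
  · rw [parity_at]
    by_contra parity_ne
    exact h (toLin_at_of_kind (fun e => parity_ne (Lab.parity_eq_of_kind e).symm) k)

theorem young_smul (r : Op D) (v : Lin D) : young (r • v) = r • young v :=
  young_map (LinearMap.mulLeft ℝ r) v

theorem toLin_cons (l : Lab D) (μ : Fin D) (k : Multiset (Fin D)) :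
    toLin (l.at (μ ::ₘ k)) = (MvPolynomial.X μ : Op D) • toLin (l.at k) := by
  rw [toLin_at, toLin_at, mono_cons, ← young_smul]
  congr 1
  rw [← smul_eq_mul, Pi.single_smul]

theorem partial_gen_at (l : Lab D) (μ : Fin D) (k : Multiset (Fin D)) :
    (partialData μ).der (gen (l.at k)) = gen (l.at (μ ::ₘ k)) := by
  rw [DerData.der_gen]
  cases l <;> rfl

theorem partial_gen_dx (μ ν : Fin D) : (partialData μ).der (gen (.dx ν)) = 0 := by
  rw [DerData.der_gen]
  rfl

theorem partial_toAlg (μ : Fin D) (v : Lin D) :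
    (partialData μ).der (toAlg v) = toAlg ((MvPolynomial.X μ : Op D) • v) := by
  induction v using lin_induction with
  | zero => simp
  | single l k =>
    rw [← Pi.single_smul, toAlg_single, toAlg_single, genOp_mono, partial_gen_at, smul_eq_mul,
      ← mono_cons, genOp_mono]
  | add v w hv hw => rw [map_add, map_add, hv, hw, smul_add, map_add]
  | smul c v hv => rw [map_smul, map_smul, hv, smul_comm, LinearMap.map_smul]

/-! ### Fréchet derivatives -/

theorem linearCombination_toLin {v : Gen D →₀ ℝ} (hv : LinRel D v) :
    Finsupp.linearCombination ℝ toLin v = 0 := linRel_eq_zero isSym_toLin hv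

theorem exists_frechet (l : Lab D) : ∃ X : Alg D →ₗ[ℝ] Op D ⊗[ℝ] Alg D,
    IsDerAlong Algebra.TensorProduct.includeRight l.parity X ∧
      ∀ g, X (gen g) = toLin g l ⊗ₜ[ℝ] 1 := by
  refine exists_isDerAlong (fun g h => ?_) (fun v hv => ?_)
  · by_cases hl : toLin g l = 0
    · simp [hl]
    · rw [parity_of_toLin_ne_zero hl, ← two_mul, mul_assoc, pow_mul]
      simp
  · have tmul_one := Finsupp.apply_linearCombination ℝ
      ((TensorProduct.mk ℝ (Op D) (Alg D)).flip 1 ∘ₗ LinearMap.proj l) toLin v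
    rw [linearCombination_toLin hv, map_zero] at tmul_one
    exact tmul_one.symm

/-- The Fréchet derivative with respect to the variable `z` with label `l`: it collects the
derivatives with respect to all `∂_k z` in the generating polynomial `a ↦ ∑_k ∂_k ⊗ ∂a/∂(∂_k z)`. -/
def frechet (l : Lab D) : Alg D →ₗ[ℝ] Op D ⊗[ℝ] Alg D := (exists_frechet l).choose

theorem isDerAlong_frechet (l : Lab D) :
    IsDerAlong Algebra.TensorProduct.includeRight l.parity (frechet l) :=
  (exists_frechet l).choose_spec.1

@[simp]
theorem frechet_gen (l : Lab D) (g : Gen D) : frechet l (gen g) = toLin g l ⊗ₜ[ℝ] 1 :=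
  (exists_frechet l).choose_spec.2 g

theorem lTensor_mul_left {ε : ℕ} {X : Alg D →ₗ[ℝ] Alg D} (hX : IsDer ε X) (u : Alg D)
    (x : Op D ⊗[ℝ] Alg D) : X.lTensor (Op D) (((1 : Op D) ⊗ₜ[ℝ] u) * x) =
      ((1 : Op D) ⊗ₜ[ℝ] X u) * x + ((1 : Op D) ⊗ₜ[ℝ] paritySign D ε u) * X.lTensor (Op D) x := by
  induction x using TensorProduct.induction_on with
  | zero => simp
  | tmul r a => simp [hX.mul, TensorProduct.tmul_add]
  | add x y hx hy => rw [mul_add, map_add, hx, hy, map_add, mul_add, mul_add]; abel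

theorem lTensor_coeff_mul (X : Alg D →ₗ[ℝ] Alg D) (r : Op D)
    (x : Op D ⊗[ℝ] Alg D) : X.lTensor (Op D) ((r ⊗ₜ[ℝ] (1 : Alg D)) * x) =
      (r ⊗ₜ[ℝ] (1 : Alg D)) * X.lTensor (Op D) x := by
  induction x using TensorProduct.induction_on with
  | zero => simp
  | tmul s a => simp
  | add x y hx hy => rw [mul_add, map_add, hx, hy, map_add, mul_add]

theorem hasParity_partial_gen (μ : Fin D) (g : Gen D) :
    HasParity g.parity ((partialData μ).der (gen g)) := by
  rcases g.eq_dx_or_at with ⟨ν, rfl⟩ | ⟨l, k, rfl⟩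
  · rw [partial_gen_dx]; exact HasParity.zero _
  · rw [partial_gen_at, parity_at, ← parity_at l (μ ::ₘ k)]; exact HasParity.gen _

theorem frechet_partial_gen (l : Lab D) (μ : Fin D) (g : Gen D) :
    frechet l ((partialData μ).der (gen g)) =
      ((MvPolynomial.X μ : Op D) ⊗ₜ[ℝ] (1 : Alg D)) * frechet l (gen g) := by
  rcases g.eq_dx_or_at with ⟨ν, rfl⟩ | ⟨m, k, rfl⟩
  · rw [partial_gen_dx]; simp [toLin]
  · rw [partial_gen_at, frechet_gen, frechet_gen, toLin_cons]; simp

theorem frechet_partial (l : Lab D) (μ : Fin D) (a : Alg D) :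
    frechet l ((partialData μ).der a) = (partialData μ).der.lTensor (Op D) (frechet l a) +
      ((MvPolynomial.X μ : Op D) ⊗ₜ[ℝ] (1 : Alg D)) * frechet l a := by
  have hP := isDerAlong_frechet l
  have hd := (partialData (D := D) μ).isDer
  suffices frechet l ∘ₗ (partialData μ).der = (partialData μ).der.lTensor (Op D) ∘ₗ frechet l +
      LinearMap.mulLeft ℝ ((MvPolynomial.X μ : Op D) ⊗ₜ[ℝ] (1 : Alg D)) ∘ₗ frechet l from
    LinearMap.congr_fun this a
  refine linearMap_ext_gen_mul (by simp [hP.one, hd.one]) fun g a ha => ?_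
  simp only [LinearMap.comp_apply, LinearMap.add_apply, LinearMap.mulLeft_apply] at ha ⊢
  have paritySign_zero : paritySign D 0 (gen g) = gen g := by simp
  rw [hd.apply_gen_mul, hP.gen_mul, map_add, hP.mul, map_smul, hP.gen_mul, ha, frechet_partial_gen,
    hasParity_partial_gen, frechet_gen]
  simp only [zero_mul, pow_zero, one_smul, map_add, map_smul,
    Algebra.TensorProduct.includeRight_apply, lTensor_coeff_mul, lTensor_mul_left hd,
    paritySign_zero, LinearMap.lTensor_tmul]
  simp only [mul_add, smul_add, smul_mul_assoc, mul_smul_comm, ← mul_assoc,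
    Algebra.TensorProduct.tmul_mul_tmul, mul_one, one_mul]
  abel

/-! ### The linear part and the Koszul–Tate operator on it -/

theorem augmentation_partial (μ : Fin D) (a : Alg D) :
    augmentation D ((partialData μ).der a) = 0 := by
  have hd := (partialData (D := D) μ).isDer
  induction a using alg_induction with
  | one => rw [hd.one, map_zero]
  | add a b ha hb => rw [map_add, map_add, ha, hb, add_zero]
  | smul c a ha => rw [map_smul, map_smul, ha, smul_zero]
  | gen_mul g a =>
    rw [hd.apply_gen_mul]
    rcases g.eq_dx_or_at with ⟨ν, rfl⟩ | ⟨m, k, rfl⟩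
    · rw [partial_gen_dx]; simp
    · rw [partial_gen_at]; simp

/-- The part of an element of the algebra that is linear in the variables. -/
def linPart : Alg D →ₗ[ℝ] Lin D :=
  LinearMap.pi fun l => (TensorProduct.rid ℝ (Op D)).toLinearMap ∘ₗ
    (augmentation D).toLinearMap.lTensor (Op D) ∘ₗ frechet l

theorem linPart_apply (a : Alg D) (l : Lab D) : linPart a l =
    TensorProduct.rid ℝ (Op D) ((augmentation D).toLinearMap.lTensor (Op D) (frechet l a)) := rfl

@[simp]
theorem linPart_gen (g : Gen D) : linPart (gen g) = toLin g := by
  funext l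
  simp [linPart_apply]

theorem linPart_partial (μ : Fin D) (a : Alg D) :
    linPart ((partialData μ).der a) = (MvPolynomial.X μ : Op D) • linPart a := by
  funext l
  rw [linPart_apply, frechet_partial, map_add, map_add, ← LinearMap.comp_apply,
    ← LinearMap.lTensor_comp]
  have augmentation_comp : (augmentation D).toLinearMap ∘ₗ (partialData μ).der = 0 := by
    ext a; simp [augmentation_partial]
  rw [augmentation_comp, LinearMap.lTensor_zero, LinearMap.zero_apply, map_zero, zero_add,
    Pi.smul_apply, linPart_apply]
  generalize frechet l a = x
  induction x using TensorProduct.induction_on with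
  | zero => simp
  | tmul r a => simp
  | add x y hx hy => rw [mul_add, map_add, map_add, hx, hy, map_add, map_add, smul_add]

theorem linPart_toAlg (v : Lin D) : linPart (toAlg v) = young v := by
  induction v using lin_induction with
  | zero => simp
  | single l k => rw [toAlg_single, genOp_mono, linPart_gen, toLin_at]
  | add v w hv hw => rw [map_add, map_add, hv, hw, map_add]
  | smul c v hv => rw [map_smul, map_smul, hv, map_smul]

/-! ### The Koszul–Tate differential on the linear part -/

/-- The span of the variables one level below `n`.  The Koszul–Tate differential of a variable of
level `n` lies there. -/
def below (D n : ℕ) : Submodule ℝ (Alg D) :=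
  Submodule.span ℝ {a | ∃ (m : Lab D) (k : Multiset (Fin D)), n = m.lev + 1 ∧ a = gen (m.at k)}

theorem gen_mem_below (m : Lab D) (k : Multiset (Fin D)) : gen (m.at k) ∈ below D (m.lev + 1) :=
  Submodule.subset_span ⟨m, k, rfl, rfl⟩

theorem Fstr_mem_below (α β γ δ : Fin D) (k : Multiset (Fin D)) : Fstr α β γ δ k ∈ below D 1 :=
  add_mem (add_mem (gen_mem_below (.T β γ δ) _) (gen_mem_below (.T γ α δ) _))
    (gen_mem_below (.T α β δ) _)

theorem ricci_mem_below (α β γ : Fin D) (k : Multiset (Fin D)) : ricci α β γ k ∈ below D 1 :=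
  sum_mem fun _ _ => Submodule.smul_mem _ _ (Submodule.smul_mem _ _
    (sub_mem (Fstr_mem_below _ _ _ _ _) (Fstr_mem_below _ _ _ _ _)))

theorem ricciTr_mem_below (α : Fin D) (k : Multiset (Fin D)) : ricciTr α k ∈ below D 1 :=
  sum_mem fun _ _ => Submodule.smul_mem _ _ (ricci_mem_below _ _ _ _)

theorem koszul_gen_mem_below (l : Lab D) (k : Multiset (Fin D)) :
    koszulData.der (gen (l.at k)) ∈ below D l.lev := by
  rw [DerData.der_gen]
  cases l with
  | Ts a b c =>
    exact Submodule.smul_mem _ _ (add_mem (Submodule.smul_mem _ _ (ricci_mem_below _ _ _ _))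
      (Submodule.smul_mem _ _ (sub_mem (Submodule.smul_mem _ _ (ricciTr_mem_below _ _))
      (Submodule.smul_mem _ _ (ricciTr_mem_below _ _)))))
  | Ss a b =>
    exact neg_mem (sum_mem fun c _ => add_mem (gen_mem_below (.Ts c a b) _)
      (gen_mem_below (.Ts c b a) _))
  | As a b =>
    exact Submodule.smul_mem _ _ (sum_mem fun c _ => sub_mem (gen_mem_below (.Ts c a b) _)
      (gen_mem_below (.Ts c b a) _))
  | Cs a =>
    exact add_mem (Submodule.smul_mem _ _ (sum_mem fun c _ => gen_mem_below (.Ss c a) _))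
      (Submodule.smul_mem _ _ (sum_mem fun c _ => gen_mem_below (.As c a) _))
  | _ => exact zero_mem _

theorem koszul_gen_dx (μ : Fin D) : koszulData.der (gen (.dx μ)) = 0 := by
  rw [DerData.der_gen]
  rfl

theorem below_le_range (n : ℕ) : below D n ≤ LinearMap.range (toAlg (D := D)) :=
  Submodule.span_le.2 <| by
    rintro _ ⟨m, k, -, rfl⟩
    exact ⟨toLin (m.at k), toAlg_toLin_at m k⟩

theorem toAlg_linPart {n : ℕ} {a : Alg D} (ha : a ∈ below D n) : toAlg (linPart a) = a := by
  obtain ⟨v, rfl⟩ := below_le_range n ha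
  rw [linPart_toAlg, toAlg_young]

theorem young_linPart {n : ℕ} {a : Alg D} (ha : a ∈ below D n) :
    young (linPart a) = linPart a := by
  obtain ⟨v, rfl⟩ := below_le_range n ha
  rw [linPart_toAlg, young_young]

theorem linPart_eq_zero_of_lev {n : ℕ} {a : Alg D} (ha : a ∈ below D n) {m : Lab D}
    (hm : n ≠ m.lev + 1) : linPart a m = 0 := by
  induction ha using Submodule.span_induction with
  | mem a ha =>
    obtain ⟨l, k, hl, rfl⟩ := ha
    rw [linPart_gen]
    refine toLin_at_of_kind (fun h => hm ?_) k
    rw [hl, Lab.lev_eq_of_kind h]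
  | zero => simp
  | add a b _ _ ha hb => rw [map_add, Pi.add_apply, ha, hb, add_zero]
  | smul c a _ ha => rw [map_smul, Pi.smul_apply, ha, smul_zero]

theorem hasParity_of_mem_below {l : Lab D} {a : Alg D} (ha : a ∈ below D l.lev) :
    HasParity (l.parity + 1) a := by
  induction ha using Submodule.span_induction with
  | mem a ha =>
    obtain ⟨m, k, hl, rfl⟩ := ha
    refine (HasParity.gen _).congr ?_
    have parity_add_one := Lab.parity_add_one_of_lev hl
    rw [parity_at]
    omega
  | zero => exact HasParity.zero _
  | add a b _ _ ha hb => exact ha.add hb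
  | smul c a _ ha => exact ha.smul c

theorem mem_algForms_of_mem_below {l : Lab D} {a : Alg D} (ha : a ∈ below D l.lev) :
    a ∈ algForms D 0 (l.antigh - 1) := by
  refine Submodule.span_le.2 ?_ ha
  rintro _ ⟨m, k, hl, rfl⟩
  have mem := gen_mem_algForms (m.at k)
  rw [formDeg_at, antigh_at] at mem
  rwa [Lab.antigh_add_one_of_lev hl, add_sub_cancel_right]

theorem hasParity_koszul_gen (g : Gen D) : HasParity (g.parity + 1) (koszulData.der (gen g)) := by
  rcases g.eq_dx_or_at with ⟨μ, rfl⟩ | ⟨l, k, rfl⟩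
  · rw [koszul_gen_dx]; exact HasParity.zero _
  · rw [parity_at]; exact hasParity_of_mem_below (koszul_gen_mem_below l k)

theorem koszul_mem_algForms {p q : ℤ} {a : Alg D} (ha : a ∈ algForms D p q) :
    koszulData.der a ∈ algForms D p (q - 1) := by
  have mem := koszulData.isDer.mem_algForms (dp := 0) (dq := -1) (fun g => ?_) ha
  · simpa [sub_eq_add_neg] using mem
  rcases g.eq_dx_or_at with ⟨μ, rfl⟩ | ⟨l, k, rfl⟩
  · rw [koszul_gen_dx]; exact zero_mem _
  · rw [antigh_at, formDeg_at]
    simpa [sub_eq_add_neg] using mem_algForms_of_mem_below (koszul_gen_mem_below l k)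

theorem partial_mem_algForms (μ : Fin D) {p q : ℤ} {a : Alg D} (ha : a ∈ algForms D p q) :
    (partialData μ).der a ∈ algForms D p q := by
  have mem := (partialData μ).isDer.mem_algForms (dp := 0) (dq := 0) (fun g => ?_) ha
  · simpa using mem
  rcases g.eq_dx_or_at with ⟨ν, rfl⟩ | ⟨l, k, rfl⟩
  · rw [partial_gen_dx]; exact zero_mem _
  · rw [partial_gen_at]
    simpa using gen_mem_algForms (l.at (μ ::ₘ k))

theorem partial_Fstr (μ α β γ δ : Fin D) (k : Multiset (Fin D)) :
    (partialData μ).der (Fstr α β γ δ k) = Fstr α β γ δ (μ ::ₘ k) := by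
  simp only [Fstr, map_add, DerData.der_gen, partialData, partialVal, Multiset.cons_swap μ]

theorem partial_ricci (μ α β γ : Fin D) (k : Multiset (Fin D)) :
    (partialData μ).der (ricci α β γ k) = ricci α β γ (μ ::ₘ k) := by
  simp only [ricci, curv, map_sum, map_smul, map_sub, partial_Fstr, Multiset.cons_swap μ]

theorem partial_ricciTr (μ α : Fin D) (k : Multiset (Fin D)) :
    (partialData μ).der (ricciTr α k) = ricciTr α (μ ::ₘ k) := by
  simp only [ricciTr, map_sum, map_smul, partial_ricci]

theorem koszul_gen_cons (l : Lab D) (μ : Fin D) (k : Multiset (Fin D)) :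
    koszulData.der (gen (l.at (μ ::ₘ k))) =
      (partialData μ).der (koszulData.der (gen (l.at k))) := by
  rw [DerData.der_gen, DerData.der_gen]
  cases l with
  | Ts a b c =>
    simp only [koszulData, koszulVal, Lab.at, eom, map_smul, map_add, map_sub, partial_ricci,
      partial_ricciTr]
  | Ss a b =>
    simp only [koszulData, koszulVal, Lab.at, map_neg, map_sum, map_add, DerData.der_gen,
      partialData, partialVal, Multiset.cons_swap μ]
  | As a b =>
    simp only [koszulData, koszulVal, Lab.at, map_smul, map_sum, map_sub, DerData.der_gen,
      partialData, partialVal, Multiset.cons_swap μ]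
  | Cs a =>
    simp only [koszulData, koszulVal, Lab.at, map_smul, map_sum, map_add, DerData.der_gen,
      partialData, partialVal, Multiset.cons_swap μ]
  | _ => exact (map_zero _).symm

theorem koszul_partial (μ : Fin D) (a : Alg D) :
    koszulData.der ((partialData μ).der a) = (partialData μ).der (koszulData.der a) := by
  refine koszulData.isDer.comp_eq_of_gen (partialData μ).isDer hasParity_koszul_gen
    (hasParity_partial_gen μ) (fun g => ?_) a
  rcases g.eq_dx_or_at with ⟨ν, rfl⟩ | ⟨l, k, rfl⟩
  · rw [partial_gen_dx, koszul_gen_dx, map_zero, map_zero]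
  · rw [partial_gen_at, koszul_gen_cons]

theorem partial_comm (μ ν : Fin D) (a : Alg D) :
    (partialData μ).der ((partialData ν).der a) = (partialData ν).der ((partialData μ).der a) := by
  refine (partialData μ).isDer.comp_eq_of_gen (partialData ν).isDer (hasParity_partial_gen μ)
    (hasParity_partial_gen ν) (fun g => ?_) a
  rcases g.eq_dx_or_at with ⟨σ, rfl⟩ | ⟨l, k, rfl⟩
  · simp only [partial_gen_dx, map_zero]
  · simp only [partial_gen_at, Multiset.cons_swap μ]

/-- The Koszul–Tate differential on the linear forms, see `toAlg_koszulLin`. -/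
def koszulLin : Lin D →ₗ[Op D] Lin D where
  toFun v := ∑ l, v l • linPart (koszulData.der (gen (l.at 0)))
  map_add' v w := by simp [add_smul, Finset.sum_add_distrib]
  map_smul' r v := by simp [mul_smul, Finset.smul_sum]

theorem koszulLin_apply (v : Lin D) :
    koszulLin v = ∑ l, v l • linPart (koszulData.der (gen (l.at 0))) := rfl

theorem koszulLin_real_smul (c : ℝ) (v : Lin D) : koszulLin (c • v) = c • koszulLin v :=
  (koszulLin.restrictScalars ℝ).map_smul c v

theorem koszulLin_single (l : Lab D) (r : Op D) :
    koszulLin (Pi.single l r) = r • linPart (koszulData.der (gen (l.at 0))) := by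
  rw [koszulLin_apply, Finset.sum_eq_single l]
  · simp
  · intro m _ hm; simp [hm]
  · simp

theorem linPart_koszul_gen_at (l : Lab D) (k : Multiset (Fin D)) :
    linPart (koszulData.der (gen (l.at k))) =
      mono k • linPart (koszulData.der (gen (l.at 0))) := by
  induction k using Multiset.induction_on with
  | empty => rw [mono_zero, one_smul]
  | cons μ k ih => rw [koszul_gen_cons, linPart_partial, ih, mono_cons, mul_smul]

theorem linPart_koszul_toAlg (v : Lin D) :
    linPart (koszulData.der (toAlg v)) = koszulLin v := by
  induction v using lin_induction with
  | zero => simp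
  | single l k => rw [toAlg_single, genOp_mono, linPart_koszul_gen_at, koszulLin_single]
  | add v w hv hw => rw [map_add, map_add, map_add, hv, hw, map_add]
  | smul c v hv => rw [map_smul, map_smul, map_smul, hv, koszulLin_real_smul]

theorem toAlg_koszulLin (v : Lin D) : toAlg (koszulLin v) = koszulData.der (toAlg v) := by
  induction v using lin_induction with
  | zero => simp
  | single l k =>
    rw [koszulLin_single, ← linPart_koszul_gen_at, toAlg_single, genOp_mono,
      toAlg_linPart (koszul_gen_mem_below l k)]
  | add v w hv hw => rw [map_add, map_add, map_add, hv, hw, map_add]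
  | smul c v hv => rw [koszulLin_real_smul, LinearMap.map_smul, hv, map_smul, map_smul]

@[simp]
theorem koszulLin_young (v : Lin D) : koszulLin (young v) = koszulLin v := by
  rw [← linPart_koszul_toAlg, toAlg_young, linPart_koszul_toAlg]

@[simp]
theorem young_koszulLin (v : Lin D) : young (koszulLin v) = koszulLin v := by
  rw [koszulLin_apply, map_sum]
  refine Finset.sum_congr rfl fun l _ => ?_
  rw [young_smul, young_linPart (koszul_gen_mem_below l 0)]

theorem koszulLin_toLin (g : Gen D) : koszulLin (toLin g) = linPart (koszulData.der (gen g)) := by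
  rcases g.eq_dx_or_at with ⟨ν, rfl⟩ | ⟨l, k, rfl⟩
  · simp [koszul_gen_dx, toLin, -DerData.der_gen]
  · rw [toLin_at, koszulLin_young, koszulLin_single, linPart_koszul_gen_at l k]

/-- The matrix of `koszulLin` over the ring of differential operators; the column index comes
second. -/
def koszulMat (l m : Lab D) : Op D := linPart (koszulData.der (gen (m.at 0))) l

theorem koszulMat_eq_zero {l m : Lab D} (h : m.lev ≠ l.lev + 1) : koszulMat l m = 0 :=
  linPart_eq_zero_of_lev (koszul_gen_mem_below m 0) h

theorem koszulLin_apply_apply (v : Lin D) (l : Lab D) :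
    koszulLin v l = ∑ m, v m * koszulMat l m := by
  simp [koszulLin_apply, koszulMat, Finset.sum_apply]

theorem frechet_toAlg (l : Lab D) (v : Lin D) : frechet l (toAlg v) = young v l ⊗ₜ[ℝ] 1 := by
  induction v using lin_induction with
  | zero => simp
  | single m k => rw [toAlg_single, genOp_mono, frechet_gen, toLin_at]
  | add v w hv hw => rw [map_add, map_add, map_add, hv, hw, Pi.add_apply, TensorProduct.add_tmul]
  | smul c v hv =>
    rw [map_smul, map_smul, map_smul, hv, Pi.smul_apply, TensorProduct.smul_tmul']

theorem koszul_gen_eq (g : Gen D) : koszulData.der (gen g) = toAlg (koszulLin (toLin g)) := by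
  rcases g.eq_dx_or_at with ⟨ν, rfl⟩ | ⟨l, k, rfl⟩
  · simp [koszul_gen_dx, toLin, -DerData.der_gen]
  · rw [koszulLin_toLin, toAlg_linPart (koszul_gen_mem_below l k)]

theorem frechet_koszul_gen (l : Lab D) (g : Gen D) :
    frechet l (koszulData.der (gen g)) =
      ∑ m, (koszulMat l m ⊗ₜ[ℝ] (1 : Alg D)) * frechet m (gen g) := by
  rw [koszul_gen_eq, frechet_toAlg, young_koszulLin, koszulLin_apply_apply,
    TensorProduct.sum_tmul]
  refine Finset.sum_congr rfl fun m _ => ?_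
  rw [frechet_gen, Algebra.TensorProduct.tmul_mul_tmul, one_mul, mul_comm]

theorem sum_koszulMat_mul_frechet_gen_mul (l : Lab D) (g : Gen D) (a : Alg D) :
    ∑ m, (koszulMat l m ⊗ₜ[ℝ] (1 : Alg D)) * frechet m (gen g * a) =
      frechet l (koszulData.der (gen g)) * ((1 : Op D) ⊗ₜ[ℝ] a) +
      (-1 : ℝ) ^ ((l.parity + 1) * g.parity) • (((1 : Op D) ⊗ₜ[ℝ] gen g) *
        ∑ m, (koszulMat l m ⊗ₜ[ℝ] (1 : Alg D)) * frechet m a) := by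
  rw [frechet_koszul_gen, Finset.sum_mul, Finset.mul_sum, Finset.smul_sum,
    ← Finset.sum_add_distrib]
  refine Finset.sum_congr rfl fun m _ => ?_
  rw [(isDerAlong_frechet m).gen_mul, mul_add, ← mul_assoc]
  congr 1
  by_cases hm : m.lev = l.lev + 1
  · rw [pow_mul, Lab.neg_one_pow_parity_of_lev hm, ← pow_mul, mul_smul_comm, ← mul_assoc,
      ← mul_assoc]
    simp
  · simp [koszulMat_eq_zero hm]

theorem neg_one_pow_smul_frechet_gen (l : Lab D) (g : Gen D) :
    (-1 : ℝ) ^ l.parity • frechet l (gen g) = (-1 : ℝ) ^ g.parity • frechet l (gen g) := by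
  by_cases hl : toLin g l = 0
  · simp [hl]
  · rw [parity_of_toLin_ne_zero hl]

theorem frechet_koszul (l : Lab D) (a : Alg D) :
    frechet l (koszulData.der a) =
      (-1 : ℝ) ^ l.parity • koszulData.der.lTensor (Op D) (frechet l a) +
      ∑ m, (koszulMat l m ⊗ₜ[ℝ] (1 : Alg D)) * frechet m a := by
  have hP := isDerAlong_frechet l
  have hd := (koszulData (D := D)).isDer
  suffices frechet l ∘ₗ koszulData.der =
      (-1 : ℝ) ^ l.parity • koszulData.der.lTensor (Op D) ∘ₗ frechet l +
      ∑ m, LinearMap.mulLeft ℝ (koszulMat l m ⊗ₜ[ℝ] (1 : Alg D)) ∘ₗ frechet m by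
    simpa using LinearMap.congr_fun this a
  refine linearMap_ext_gen_mul (by simp [hP.one, hd.one, (isDerAlong_frechet _).one])
    fun g a ha => ?_
  simp only [LinearMap.comp_apply, LinearMap.add_apply, LinearMap.mulLeft_apply,
    LinearMap.smul_apply, LinearMap.sum_apply] at ha ⊢
  have lTensor_koszul_mul : ∀ x, koszulData.der.lTensor (Op D) (frechet l (gen g) * x) =
      frechet l (gen g) * koszulData.der.lTensor (Op D) x := fun x => by
    rw [frechet_gen, lTensor_coeff_mul]
  rw [sum_koszulMat_mul_frechet_gen_mul, hd.apply_gen_mul, hP.gen_mul, map_add, hP.mul, map_smul,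
    hP.gen_mul, ha, hasParity_koszul_gen]
  simp only [map_add, map_smul, lTensor_koszul_mul, Algebra.TensorProduct.includeRight_apply,
    lTensor_mul_left hd, paritySign_gen, LinearMap.lTensor_tmul]
  have sign_exchange := congrArg (· * ((1 : Op D) ⊗ₜ[ℝ] koszulData.der a))
    (neg_one_pow_smul_frechet_gen l g)
  simp only [smul_mul_assoc] at sign_exchange
  simp only [mul_add, smul_add, smul_mul_assoc, mul_smul_comm, TensorProduct.tmul_smul, smul_smul,
    one_mul, add_mul, pow_add, mul_one]
  rcases g.parity_eq_zero_or_one with parity_g | parity_g <;>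
    rw [parity_g] at sign_exchange ⊢ <;>
    simp only [mul_zero, pow_zero, mul_one, pow_one] at sign_exchange ⊢ <;>
    linear_combination (norm := module) (-1 : ℝ) • sign_exchange

/-! ### Exactness of the polynomial Koszul complex in low degrees -/

open MvPolynomial in
/-- The inverse of `∑ c, X c ∂/∂(X c) + s`, for `s > 0`.  Composed with the contraction
`u ↦ ∑ c, ∂(u c)/∂(X c)` it gives the contracting homotopy of the Koszul complex. -/
def eulerInv (D s : ℕ) : Op D →ₗ[ℝ] Op D :=
  (basisMonomials (Fin D) ℝ).constr ℝ fun k =>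
    ((Multiset.card (Finsupp.toMultiset k) : ℝ) + s)⁻¹ • monomial k 1

theorem eulerInv_mono (s : ℕ) (k : Multiset (Fin D)) :
    eulerInv D s (mono k) = ((Multiset.card k : ℝ) + s)⁻¹ • mono k := by
  simpa [eulerInv, mono] using (MvPolynomial.basisMonomials (Fin D) ℝ).constr_basis ℝ
    (fun k => ((Multiset.card (Finsupp.toMultiset k) : ℝ) + s)⁻¹ • MvPolynomial.monomial k (1 : ℝ))
    (Multiset.toFinsupp k)

theorem X_mul_eulerInv (s : ℕ) (a : Fin D) (r : Op D) :
    MvPolynomial.X a * eulerInv D (s + 1) r = eulerInv D s (MvPolynomial.X a * r) := by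
  induction r using op_induction with
  | mono k =>
    rw [eulerInv_mono, ← mono_cons, eulerInv_mono, mul_smul_comm, ← mono_cons, Multiset.card_cons]
    push_cast
    rw [add_right_comm, add_assoc]
  | add r t hr ht => rw [map_add, mul_add, mul_add, map_add, hr, ht]
  | smul c r hr => rw [map_smul, mul_smul_comm, mul_smul_comm, LinearMap.map_smul, hr]

theorem sum_X_mul_pderiv_mono (k : Multiset (Fin D)) :
    ∑ c, MvPolynomial.X c * MvPolynomial.pderiv c (mono k) = (Multiset.card k : ℝ) • mono k := by
  induction k using Multiset.induction_on with
  | empty => simp [mono_zero]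
  | cons a k ih =>
    rw [mono_cons]
    simp only [MvPolynomial.pderiv_mul, mul_add, Finset.sum_add_distrib]
    have on_first_factor : ∑ c, (MvPolynomial.X c : Op D) *
        (MvPolynomial.pderiv c (MvPolynomial.X a) * mono k) = MvPolynomial.X a * mono k := by
      rw [Finset.sum_eq_single a]
      · simp
      · intro c _ hc; simp [MvPolynomial.pderiv_X_of_ne hc.symm]
      · simp
    have on_remaining_factors : ∑ c, (MvPolynomial.X c : Op D) *
        (MvPolynomial.X a * MvPolynomial.pderiv c (mono k)) =
          MvPolynomial.X a * ∑ c, MvPolynomial.X c * MvPolynomial.pderiv c (mono k) := by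
      rw [Finset.mul_sum]
      exact Finset.sum_congr rfl fun c _ => by ring
    rw [on_first_factor, on_remaining_factors, ih, Multiset.card_cons, mul_smul_comm]
    push_cast
    module

theorem eulerInv_sum_pderiv_X_mul {n s : ℕ} (hs : 0 < s) (hn : n + s = D) (r : Op D) :
    eulerInv D s (∑ c, MvPolynomial.pderiv c (MvPolynomial.X c * r) - (n : ℝ) • r) = r := by
  induction r using op_induction with
  | mono k =>
    have divergence_mono : ∑ c, MvPolynomial.pderiv c (MvPolynomial.X c * mono k) -
        (n : ℝ) • mono k = ((Multiset.card k : ℝ) + s) • mono k := by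
      simp only [MvPolynomial.pderiv_mul, MvPolynomial.pderiv_X_self, one_mul,
        Finset.sum_add_distrib, sum_X_mul_pderiv_mono, Finset.sum_const, Finset.card_univ,
        Fintype.card_fin]
      have hD : (D : ℝ) = n + s := by exact_mod_cast hn.symm
      rw [← Nat.cast_smul_eq_nsmul ℝ, hD]
      module
    have eigenvalue_ne_zero : ((Multiset.card k : ℝ) + s) ≠ 0 := by positivity
    rw [divergence_mono, map_smul, eulerInv_mono, smul_smul, mul_inv_cancel₀ eigenvalue_ne_zero,
      one_smul]
  | add r t hr ht =>
    nth_rewrite 3 [← hr]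
    nth_rewrite 3 [← ht]
    rw [← map_add]
    congr 1
    simp only [mul_add, map_add, Finset.sum_add_distrib]
    module
  | smul c r hr =>
    nth_rewrite 3 [← hr]
    rw [← map_smul]
    congr 1
    simp only [mul_smul_comm, Derivation.map_smul, ← Finset.smul_sum]
    module

theorem X_mul_pderiv (a c : Fin D) (r : Op D) :
    MvPolynomial.X a * MvPolynomial.pderiv c r =
      MvPolynomial.pderiv c (MvPolynomial.X a * r) - if c = a then r else 0 := by
  rw [MvPolynomial.pderiv_mul]
  split_ifs with h
  · subst h; simp
  · simp [MvPolynomial.pderiv_X_of_ne (Ne.symm h)]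

theorem X_mul_sum_pderiv (a : Fin D) (r : Fin D → Op D) :
    MvPolynomial.X a * ∑ c, MvPolynomial.pderiv c (r c) =
      ∑ c, MvPolynomial.pderiv c (MvPolynomial.X a * r c) - r a := by
  simp only [Finset.mul_sum, X_mul_pderiv, Finset.sum_sub_distrib]
  simp

theorem exists_primitive_one_form (hD : 1 < D) (u : Fin D → Op D)
    (closed : ∀ a c, MvPolynomial.X c * u a = MvPolynomial.X a * u c) :
    ∃ w : Op D, ∀ a, u a = MvPolynomial.X a * w := by
  obtain ⟨s, rfl⟩ : ∃ s, D = s + 2 := ⟨D - 2, by omega⟩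
  refine ⟨eulerInv (s + 2) (s + 1 + 1) (∑ c, MvPolynomial.pderiv c (u c)), fun a => ?_⟩
  rw [X_mul_eulerInv, X_mul_sum_pderiv]
  conv_lhs => rw [← eulerInv_sum_pderiv_X_mul (n := 1) (s := s + 1) (by omega) (by omega) (u a)]
  congr 1
  simp only [closed a, Nat.cast_one, one_smul]

theorem exists_primitive_two_form (hD : 2 < D) (u : Fin D → Fin D → Op D)
    (swap : ∀ a b, u a b = -u b a)
    (closed : ∀ a b c, MvPolynomial.X c * u a b =
      MvPolynomial.X a * u c b - MvPolynomial.X b * u c a) :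
    ∃ w : Fin D → Op D, ∀ a b, u a b = MvPolynomial.X a * w b - MvPolynomial.X b * w a := by
  obtain ⟨s, rfl⟩ : ∃ s, D = s + 3 := ⟨D - 3, by omega⟩
  refine ⟨fun b => eulerInv (s + 3) (s + 1 + 1) (∑ c, MvPolynomial.pderiv c (u c b)),
    fun a b => ?_⟩
  rw [X_mul_eulerInv, X_mul_eulerInv, X_mul_sum_pderiv a, X_mul_sum_pderiv b, ← map_sub]
  conv_lhs => rw [← eulerInv_sum_pderiv_X_mul (n := 2) (s := s + 1) (by omega) (by omega) (u a b)]
  congr 1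
  simp only [closed a b, map_sub, Finset.sum_sub_distrib]
  rw [swap b a]
  push_cast
  module

theorem exists_primitive_three_form (hD : 3 < D) (u : Fin D → Fin D → Fin D → Op D)
    (swap_left : ∀ a b c, u a b c = -u b a c) (swap_right : ∀ a b c, u a b c = -u a c b)
    (closed : ∀ a b c d, MvPolynomial.X d * u a b c = MvPolynomial.X a * u d b c +
      MvPolynomial.X b * u d c a + MvPolynomial.X c * u d a b) :
    ∃ w : Fin D → Fin D → Op D, (∀ a b, w a b = -w b a) ∧ ∀ a b c, u a b c =
      MvPolynomial.X a * w b c + MvPolynomial.X b * w c a + MvPolynomial.X c * w a b := by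
  obtain ⟨s, rfl⟩ : ∃ s, D = s + 4 := ⟨D - 4, by omega⟩
  refine ⟨fun a b => eulerInv (s + 4) (s + 1 + 1) (∑ c, MvPolynomial.pderiv c (u c a b)),
    fun a b => ?_, fun a b c => ?_⟩
  · simp only [← map_neg, ← Finset.sum_neg_distrib, swap_right _ a b]
  · simp only [X_mul_eulerInv]
    rw [X_mul_sum_pderiv a, X_mul_sum_pderiv b, X_mul_sum_pderiv c, ← map_add, ← map_add]
    conv_lhs =>
      rw [← eulerInv_sum_pderiv_X_mul (n := 3) (s := s + 1) (by omega) (by omega) (u a b c)]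
    congr 1
    simp only [closed a b c, map_add, Finset.sum_add_distrib]
    rw [swap_right b c a, swap_left b a c, swap_left c a b, swap_right a c b]
    push_cast
    module

/-- The diagonal entries of the metric as constant differential operators. -/
def met (d : Fin D) : Op D := algebraMap ℝ (Op D) (η d)

theorem met_mul_self (d : Fin D) : met d * met d = 1 := by
  rw [met, ← map_mul, η]
  split_ifs <;> simp

/-- The partial derivative `∂_a`, read as an indeterminate of the ring of constant coefficient
operators. -/
abbrev mom (a : Fin D) : Op D := MvPolynomial.X a

/-- Tensors with operator coefficients and the symmetries of the field `T`, namely those of a Young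
tableau of hook shape `(2, 1)`. -/
structure IsHook (T : Fin D → Fin D → Fin D → Op D) : Prop where
  anti : ∀ a b c, T a b c = -T b a c
  cyc : ∀ a b c, T a b c + T b c a + T c a b = 0

/-- The field strength `F_{abcd}` of a tensor with operator coefficients. -/
def fieldStr (T : Fin D → Fin D → Fin D → Op D) (a b c d : Fin D) : Op D :=
  mom a * T b c d + mom b * T c a d + mom c * T a b d

/-- Twice the trace `E_{abc}` of the curvature; doubled to avoid the factor `1 / 2`. -/
def ric (T : Fin D → Fin D → Fin D → Op D) (a b c : Fin D) : Op D :=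
  ∑ d, met d * (mom d * fieldStr T a b d c - mom c * fieldStr T a b d d)

/-- Twice the double trace `E_a` of the curvature. -/
def ricTr (T : Fin D → Fin D → Fin D → Op D) (a : Fin D) : Op D := ∑ b, met b * ric T a b b

/-- The left-hand side of the field equations, `4 / 3` times `δ T^{*abc}`. -/
def fieldEq (T : Fin D → Fin D → Fin D → Op D) (a b c : Fin D) : Op D :=
  2 * (met a * met b * met c * ric T a b c) +
    ((if c = a then met c * met b * ricTr T b else 0) -
      if c = b then met c * met a * ricTr T a else 0)

/-- The divergence of a tensor on its second index. -/
def dvg (T : Fin D → Fin D → Fin D → Op D) (b c : Fin D) : Op D := ∑ d, met d * mom d * T b d c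

/-- The trace of a tensor over its last two indices. -/
def trc (T : Fin D → Fin D → Fin D → Op D) (b : Fin D) : Op D := ∑ d, met d * T b d d

/-- The divergence of the trace of a tensor. -/
def dvgTrc (T : Fin D → Fin D → Fin D → Op D) : Op D := ∑ d, met d * mom d * trc T d

/-- The double divergence of a tensor on its last two indices. -/
def ddvg (T : Fin D → Fin D → Fin D → Op D) (a : Fin D) : Op D := ∑ d, met d * mom d * dvg T a d

/-- The d'Alembertian. -/
def box (D : ℕ) : Op D := ∑ d, met d * mom d * mom d

section Identities

variable {T P : Fin D → Fin D → Fin D → Op D}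

theorem sum_dvg_last (hT : IsHook T) (a b : Fin D) :
    ∑ d, met d * mom d * T a b d = dvg T a b - dvg T b a := by
  simp only [dvg, ← Finset.sum_sub_distrib]
  refine Finset.sum_congr rfl fun d _ => ?_
  linear_combination (met d * mom d) * (hT.cyc a b d - hT.anti d a b)

theorem ric_eq (hT : IsHook T) (a b c : Fin D) :
    ric T a b c = mom a * dvg T b c - mom b * dvg T a c + box D * T a b c -
      mom c * (mom a * trc T b - mom b * trc T a + (dvg T a b - dvg T b a)) := by
  rw [← sum_dvg_last hT]
  simp only [ric, fieldStr, dvg, trc, box, Finset.mul_sum, Finset.sum_mul,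
    ← Finset.sum_add_distrib, ← Finset.sum_sub_distrib]
  refine Finset.sum_congr rfl fun d _ => ?_
  rw [hT.anti d a c, hT.anti d a d]
  ring

theorem sum_mom_dvg (hT : IsHook T) (c : Fin D) : ∑ b, met b * mom b * dvg T b c = 0 := by
  refine self_eq_neg.1 ?_
  simp only [dvg, Finset.mul_sum]
  conv_rhs => rw [Finset.sum_comm]
  rw [← Finset.sum_neg_distrib]
  refine Finset.sum_congr rfl fun a _ => ?_
  rw [← Finset.sum_neg_distrib]
  refine Finset.sum_congr rfl fun b _ => ?_
  rw [hT.anti a b c]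
  ring

theorem sum_mom_ddvg (hT : IsHook T) : ∑ b, met b * mom b * ddvg T b = 0 := by
  simp only [ddvg, Finset.mul_sum]
  rw [Finset.sum_comm]
  refine Finset.sum_eq_zero fun c _ => ?_
  rw [← mul_zero (met c * mom c), ← sum_mom_dvg hT c, Finset.mul_sum]
  exact Finset.sum_congr rfl fun b _ => by ring

theorem sum_trace_dvg (hT : IsHook T) : ∑ b, met b * dvg T b b = -dvgTrc T := by
  simp only [dvg, dvgTrc, trc, Finset.mul_sum]
  rw [Finset.sum_comm, ← Finset.sum_neg_distrib]
  refine Finset.sum_congr rfl fun a _ => ?_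
  rw [← Finset.sum_neg_distrib]
  refine Finset.sum_congr rfl fun b _ => ?_
  rw [hT.anti a b b]
  ring

theorem ricTr_eq (hT : IsHook T) (a : Fin D) :
    ricTr T a = 2 * (box D * trc T a - mom a * dvgTrc T - ddvg T a) := by
  have trace_ric_eq : ricTr T a = mom a * (∑ b, met b * dvg T b b) - ddvg T a + box D * trc T a -
      (mom a * dvgTrc T - box D * trc T a + (ddvg T a - ∑ b, met b * mom b * dvg T b a)) := by
    have box_mul_trc : box D * trc T a = ∑ b, met b * mom b * mom b * trc T a := by
      rw [box, Finset.sum_mul]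
    have box_mul_trc' : box D * trc T a = ∑ b, met b * (box D * T a b b) := by
      rw [trc, Finset.mul_sum]
      exact Finset.sum_congr rfl fun b _ => by ring
    conv_rhs => enter [1, 2]; rw [box_mul_trc']
    conv_rhs => enter [2, 1, 2]; rw [box_mul_trc]
    simp only [ricTr, ric_eq hT, ddvg, dvgTrc, Finset.mul_sum,
      ← Finset.sum_add_distrib, ← Finset.sum_sub_distrib]
    exact Finset.sum_congr rfl fun b _ => by ring
  rw [trace_ric_eq, sum_trace_dvg hT, sum_mom_dvg hT a]
  ring

theorem sum_mom_ric (hT : IsHook T) (a b : Fin D) :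
    2 * ∑ c, met c * mom c * ric T c a b = -(mom b * ricTr T a) := by
  have divergence_ric_eq : ∑ c, met c * mom c * ric T c a b =
      box D * dvg T a b - mom a * (∑ c, met c * mom c * dvg T c b) - box D * dvg T a b -
      mom b * (box D * trc T a - mom a * dvgTrc T +
        ((∑ c, met c * mom c * dvg T c a) - ddvg T a)) := by
    have box_mul : ∀ x, box D * x = ∑ c, met c * mom c * mom c * x := fun x => by
      rw [box, Finset.sum_mul]
    have box_mul_dvg : box D * dvg T a b = ∑ c, -(met c * mom c * (box D * T c a b)) := by
      rw [dvg, Finset.mul_sum]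
      exact Finset.sum_congr rfl fun c _ => by rw [hT.anti c a b]; ring
    conv_rhs => enter [1, 2]; rw [box_mul_dvg]
    conv_rhs => enter [1, 1, 1]; rw [box_mul]
    conv_rhs => enter [2, 2, 1, 1]; rw [box_mul]
    simp only [ric_eq hT, ddvg, dvgTrc, Finset.mul_sum,
      ← Finset.sum_add_distrib, ← Finset.sum_sub_distrib]
    exact Finset.sum_congr rfl fun b _ => by ring
  rw [divergence_ric_eq, sum_mom_dvg hT b, sum_mom_dvg hT a, ricTr_eq hT]
  ring

theorem sum_mom_ricTr (hT : IsHook T) : ∑ a, met a * mom a * ricTr T a = 0 := by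
  have expand : ∑ a, met a * mom a * ricTr T a =
      2 * (box D * dvgTrc T - box D * dvgTrc T - ∑ b, met b * mom b * ddvg T b) := by
    conv_rhs => enter [2, 1, 2]; rw [box, Finset.sum_mul]
    simp only [ricTr_eq hT, dvgTrc, Finset.mul_sum, ← Finset.sum_sub_distrib]
    refine Finset.sum_congr rfl fun b _ => ?_
    rw [← Finset.mul_sum, ← Finset.mul_sum]
    ring
  rw [expand, sum_mom_ddvg hT]
  ring

theorem sum_mom_fieldEq (hT : IsHook T) (a b : Fin D) : ∑ c, mom c * fieldEq T c a b = 0 := by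
  have expand : ∑ c, mom c * fieldEq T c a b =
      met a * met b * (2 * ∑ c, met c * mom c * ric T c a b) + mom b * met b * met a * ricTr T a -
        if b = a then met b * ∑ c, met c * mom c * ricTr T c else 0 := by
    simp only [fieldEq, mul_add, mul_sub, Finset.sum_add_distrib, Finset.sum_sub_distrib]
    rw [← add_sub_assoc]
    congr 1
    · congr 1
      · simp only [Finset.mul_sum]
        exact Finset.sum_congr rfl fun c _ => by ring
      · simp [mul_ite, mul_assoc]
    · split_ifs
      · rw [Finset.mul_sum]
        exact Finset.sum_congr rfl fun c _ => by ring
      · simp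
  rw [expand, sum_mom_ric hT, sum_mom_ricTr hT]
  split_ifs <;> ring

theorem fieldStr_anti_left (hT : IsHook T) (a b c d : Fin D) :
    fieldStr T a b c d = -fieldStr T b a c d := by
  simp only [fieldStr]
  linear_combination mom a * hT.anti b c d + mom b * hT.anti c a d + mom c * hT.anti a b d

theorem fieldStr_anti_right (hT : IsHook T) (a b c d : Fin D) :
    fieldStr T a b c d = -fieldStr T a c b d := by
  simp only [fieldStr]
  linear_combination mom a * hT.anti b c d + mom b * hT.anti c a d + mom c * hT.anti a b d

theorem sum_contract_first (hP : IsHook P) (X : Fin D → Fin D → Op D) :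
    ∑ a, ∑ b, ∑ c, met a * met b * met c * (P a b c * (mom a * X b c)) =
      -∑ b, ∑ c, met b * met c * (dvg P b c * X b c) := by
  simp only [dvg, Finset.mul_sum, Finset.sum_mul, ← Finset.sum_neg_distrib]
  rw [Finset.sum_comm]
  refine Finset.sum_congr rfl fun b _ => ?_
  rw [Finset.sum_comm]
  refine Finset.sum_congr rfl fun c _ => Finset.sum_congr rfl fun a _ => ?_
  rw [hP.anti a b c]
  ring

theorem sum_contract_second (P : Fin D → Fin D → Fin D → Op D) (X : Fin D → Fin D → Op D) :
    ∑ a, ∑ b, ∑ c, met a * met b * met c * (P a b c * (mom b * X a c)) =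
      ∑ a, ∑ c, met a * met c * (dvg P a c * X a c) := by
  simp only [dvg, Finset.mul_sum, Finset.sum_mul]
  refine Finset.sum_congr rfl fun a _ => ?_
  rw [Finset.sum_comm]
  exact Finset.sum_congr rfl fun c _ => Finset.sum_congr rfl fun b _ => by ring

theorem sum_contract_last (hP : IsHook P) (X : Fin D → Fin D → Op D) :
    ∑ a, ∑ b, ∑ c, met a * met b * met c * (P a b c * (mom c * X a b)) =
      ∑ a, ∑ b, met a * met b * ((dvg P a b - dvg P b a) * X a b) := by
  simp only [← sum_dvg_last hP, Finset.mul_sum, Finset.sum_mul]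
  exact Finset.sum_congr rfl fun a _ => Finset.sum_congr rfl fun b _ =>
    Finset.sum_congr rfl fun c _ => by ring

theorem sum_dvg_mul_mom (P : Fin D → Fin D → Fin D → Op D) (x : Fin D → Op D) :
    ∑ a, ∑ c, met a * met c * (dvg P a c * (mom c * x a)) = ∑ a, met a * (ddvg P a * x a) := by
  simp only [ddvg, Finset.mul_sum, Finset.sum_mul]
  exact Finset.sum_congr rfl fun a _ => Finset.sum_congr rfl fun c _ => by ring

theorem sum_mul_ite_first (hP : IsHook P) (x : Fin D → Op D) :
    ∑ a, ∑ b, ∑ c, P a b c * (if c = a then met c * met b * x b else 0) =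
      -∑ b, met b * (trc P b * x b) := by
  simp only [mul_ite, mul_zero, Finset.sum_ite_eq', Finset.mem_univ, if_true]
  rw [Finset.sum_comm, ← Finset.sum_neg_distrib]
  refine Finset.sum_congr rfl fun b _ => ?_
  rw [trc, Finset.sum_mul, Finset.mul_sum, ← Finset.sum_neg_distrib]
  refine Finset.sum_congr rfl fun a _ => ?_
  rw [hP.anti a b a]
  ring

theorem sum_mul_ite_second (P : Fin D → Fin D → Fin D → Op D) (x : Fin D → Op D) :
    ∑ a, ∑ b, ∑ c, P a b c * (if c = b then met c * met a * x a else 0) =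
      ∑ a, met a * (trc P a * x a) := by
  simp only [mul_ite, mul_zero, Finset.sum_ite_eq', Finset.mem_univ, if_true]
  refine Finset.sum_congr rfl fun a _ => ?_
  rw [trc, Finset.sum_mul, Finset.mul_sum]
  exact Finset.sum_congr rfl fun b _ => by ring

theorem sum_mul_ric (hT : IsHook T) (hP : IsHook P) :
    ∑ a, ∑ b, ∑ c, met a * met b * met c * (P a b c * ric T a b c) =
      -2 * (∑ a, ∑ b, met a * met b * (dvg P a b * dvg T a b)) +
      box D * (∑ a, ∑ b, ∑ c, met a * met b * met c * (P a b c * T a b c)) +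
      2 * (∑ a, met a * (ddvg P a * trc T a)) -
      ∑ a, ∑ b, met a * met b * ((dvg P a b - dvg P b a) * (dvg T a b - dvg T b a)) := by
  have expand : ∑ a, ∑ b, ∑ c, met a * met b * met c * (P a b c * ric T a b c) =
      (∑ a, ∑ b, ∑ c, met a * met b * met c * (P a b c * (mom a * dvg T b c))) -
      (∑ a, ∑ b, ∑ c, met a * met b * met c * (P a b c * (mom b * dvg T a c))) +
      box D * (∑ a, ∑ b, ∑ c, met a * met b * met c * (P a b c * T a b c)) -
      (∑ a, ∑ b, ∑ c, met a * met b * met c * (P a b c * (mom a * (mom c * trc T b)))) +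
      (∑ a, ∑ b, ∑ c, met a * met b * met c * (P a b c * (mom b * (mom c * trc T a)))) -
      ∑ a, ∑ b, ∑ c, met a * met b * met c * (P a b c * (mom c * (dvg T a b - dvg T b a))) := by
    simp only [Finset.mul_sum, ← Finset.sum_add_distrib, ← Finset.sum_sub_distrib]
    exact Finset.sum_congr rfl fun a _ => Finset.sum_congr rfl fun b _ =>
      Finset.sum_congr rfl fun c _ => by rw [ric_eq hT]; ring
  rw [expand, sum_contract_first hP (dvg T), sum_contract_second P (dvg T),
    sum_contract_first hP fun b c => mom c * trc T b,
    sum_contract_second P fun a c => mom c * trc T a,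
    sum_contract_last hP fun a b => dvg T a b - dvg T b a, sum_dvg_mul_mom]
  ring

theorem sum_trc_mul_ricTr (P : Fin D → Fin D → Fin D → Op D) (hT : IsHook T) :
    ∑ a, met a * (trc P a * ricTr T a) =
      2 * (box D * (∑ a, met a * (trc P a * trc T a)) - dvgTrc P * dvgTrc T -
        ∑ a, met a * (trc P a * ddvg T a)) := by
  have dvgTrc_mul : dvgTrc P * dvgTrc T = ∑ a, met a * mom a * trc P a * dvgTrc T := by
    rw [dvgTrc, Finset.sum_mul]
  rw [dvgTrc_mul]
  simp only [Finset.mul_sum, ← Finset.sum_sub_distrib]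
  exact Finset.sum_congr rfl fun a _ => by rw [ricTr_eq hT]; ring

theorem sum_mul_fieldEq (hT : IsHook T) (hP : IsHook P) :
    ∑ a, ∑ b, ∑ c, P a b c * fieldEq T a b c =
      -4 * (∑ a, ∑ b, met a * met b * (dvg P a b * dvg T a b)) +
      2 * box D * (∑ a, ∑ b, ∑ c, met a * met b * met c * (P a b c * T a b c)) +
      4 * (∑ a, met a * (ddvg P a * trc T a)) -
      2 * (∑ a, ∑ b, met a * met b * ((dvg P a b - dvg P b a) * (dvg T a b - dvg T b a))) -
      4 * box D * (∑ a, met a * (trc P a * trc T a)) + 4 * dvgTrc P * dvgTrc T +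
      4 * (∑ a, met a * (trc P a * ddvg T a)) := by
  have expand : ∑ a, ∑ b, ∑ c, P a b c * fieldEq T a b c =
      2 * (∑ a, ∑ b, ∑ c, met a * met b * met c * (P a b c * ric T a b c)) +
      (∑ a, ∑ b, ∑ c, P a b c * (if c = a then met c * met b * ricTr T b else 0)) -
      ∑ a, ∑ b, ∑ c, P a b c * (if c = b then met c * met a * ricTr T a else 0) := by
    simp only [Finset.mul_sum, ← Finset.sum_add_distrib, ← Finset.sum_sub_distrib]
    exact Finset.sum_congr rfl fun a _ => Finset.sum_congr rfl fun b _ =>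
      Finset.sum_congr rfl fun c _ => by rw [fieldEq]; ring
  rw [expand, sum_mul_ric hT hP, sum_mul_ite_first hP, sum_mul_ite_second, sum_trc_mul_ricTr P hT]
  ring

theorem sum_mul_fieldEq_comm (hT : IsHook T) (hP : IsHook P) :
    ∑ a, ∑ b, ∑ c, P a b c * fieldEq T a b c = ∑ a, ∑ b, ∑ c, T a b c * fieldEq P a b c := by
  rw [sum_mul_fieldEq hT hP, sum_mul_fieldEq hP hT]
  simp only [mul_comm (dvg T _ _), mul_comm (T _ _ _), mul_comm (ddvg T _), mul_comm (trc T _),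
    mul_comm (dvg T _ _ - dvg T _ _)]
  ring

end Identities

/-! ### Solutions of the field equations with polynomial coefficients are pure gauge -/

section Solutions

variable {T : Fin D → Fin D → Fin D → Op D}

theorem box_ne_zero (hD : 1 < D) : box D ≠ 0 := by
  intro box_eq_zero
  have eval_box := congrArg (MvPolynomial.eval (Pi.single (⟨1, hD⟩ : Fin D) (1 : ℝ))) box_eq_zero
  rw [box, map_sum, map_zero, Finset.sum_eq_single (⟨1, hD⟩ : Fin D)] at eval_box
  · simp [met, η] at eval_box
  · intro b _ hb
    simp [hb]
  · simp

theorem two_mul_ric_of_fieldEq (h : ∀ a b c, fieldEq T a b c = 0) (a b c : Fin D) :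
    2 * ric T a b c + met a * (if c = a then ricTr T b else 0) -
      met b * (if c = b then ricTr T a else 0) = 0 := by
  have field_eq := h a b c
  have factor_ca : (if c = a then met c * met b * ricTr T b else 0) =
      met c * met b * (if c = a then ricTr T b else 0) := by split_ifs <;> simp
  have factor_cb : (if c = b then met c * met a * ricTr T a else 0) =
      met c * met a * (if c = b then ricTr T a else 0) := by split_ifs <;> simp
  rw [fieldEq, factor_ca, factor_cb] at field_eq
  have sq_a := met_mul_self a
  have sq_b := met_mul_self b
  have sq_c := met_mul_self c
  linear_combination (met a * met b * met c) * field_eq -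
    2 * ric T a b c * (sq_a + met a * met a * sq_b + met a * met a * met b * met b * sq_c) -
    met a * (if c = a then ricTr T b else 0) * (sq_b + met b * met b * sq_c) +
    met b * (if c = b then ricTr T a else 0) * (sq_a + met a * met a * sq_c)

theorem three_sub_dim_mul_ricTr (h : ∀ a b c, fieldEq T a b c = 0) (a : Fin D) :
    ((3 : ℕ) - (D : ℕ) : Op D) * ricTr T a = 0 := by
  have trace_eq : ∑ b, met b * (2 * ric T a b b + met a * (if b = a then ricTr T b else 0) -
      met b * (if b = b then ricTr T a else 0)) = 0 :=
    Finset.sum_eq_zero fun b _ => by rw [two_mul_ric_of_fieldEq h, mul_zero]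
  have expand : ∑ b, met b * (2 * ric T a b b + met a * (if b = a then ricTr T b else 0) -
      met b * (if b = b then ricTr T a else 0)) =
      2 * (∑ b, met b * ric T a b b) + (∑ b, if b = a then met b * met a * ricTr T b else 0) -
        ∑ _b : Fin D, ricTr T a := by
    simp only [Finset.mul_sum, ← Finset.sum_add_distrib, ← Finset.sum_sub_distrib]
    refine Finset.sum_congr rfl fun b _ => ?_
    simp only [if_true]
    split_ifs <;> linear_combination -ricTr T a * met_mul_self b
  rw [expand] at trace_eq
  simp only [Finset.sum_ite_eq', Finset.mem_univ, if_true, met_mul_self, Finset.sum_const,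
    Finset.card_univ, Fintype.card_fin, nsmul_eq_mul] at trace_eq
  change 2 * ricTr T a + 1 * ricTr T a - D * ricTr T a = 0 at trace_eq
  push_cast
  linear_combination trace_eq

theorem ricTr_eq_zero (hD : D ≠ 3) (h : ∀ a b c, fieldEq T a b c = 0) (a : Fin D) :
    ricTr T a = 0 :=
  (mul_eq_zero.1 (three_sub_dim_mul_ricTr h a)).resolve_left
    (sub_ne_zero.2 (Nat.cast_injective.ne hD.symm))

theorem ric_eq_zero (hD : D ≠ 3) (h : ∀ a b c, fieldEq T a b c = 0) (a b c : Fin D) :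
    ric T a b c = 0 := by
  have two_mul_ric := two_mul_ric_of_fieldEq h a b c
  simp only [ricTr_eq_zero hD h, ite_self, mul_zero, add_zero, sub_zero] at two_mul_ric
  exact (mul_eq_zero.1 two_mul_ric).resolve_left two_ne_zero

theorem mom_mul_fieldStr (hT : IsHook T) (a b c d e : Fin D) :
    mom e * fieldStr T a b c d = mom a * fieldStr T b c e d + mom b * fieldStr T c a e d +
      mom c * fieldStr T a b e d := by
  simp only [fieldStr]
  linear_combination (-mom a * mom b) * hT.anti e c d - mom a * mom c * hT.anti e b d -
    mom b * mom c * hT.anti e a d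

theorem sum_mom_fieldStr (hD : D ≠ 3) (h : ∀ a b c, fieldEq T a b c = 0) (a b d : Fin D) :
    ∑ e, met e * mom e * fieldStr T a b e d = mom d * ∑ e, met e * fieldStr T a b e e := by
  rw [← sub_eq_zero, Finset.mul_sum, ← Finset.sum_sub_distrib, ← ric_eq_zero hD h a b d, ric]
  exact Finset.sum_congr rfl fun e _ => by ring

theorem box_mul_fieldStr (hD : D ≠ 3) (hT : IsHook T) (h : ∀ a b c, fieldEq T a b c = 0)
    (a b c d : Fin D) : box D * fieldStr T a b c d =
      mom d * (mom a * (∑ e, met e * fieldStr T b c e e) +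
        mom b * (∑ e, met e * fieldStr T c a e e) + mom c * ∑ e, met e * fieldStr T a b e e) := by
  have bianchi : box D * fieldStr T a b c d = mom a * (∑ e, met e * mom e * fieldStr T b c e d) +
      mom b * (∑ e, met e * mom e * fieldStr T c a e d) +
      mom c * ∑ e, met e * mom e * fieldStr T a b e d := by
    simp only [box, Finset.sum_mul, Finset.mul_sum, ← Finset.sum_add_distrib]
    refine Finset.sum_congr rfl fun e _ => ?_
    linear_combination met e * mom e * mom_mul_fieldStr hT a b c d e
  simp only [bianchi, sum_mom_fieldStr hD h]
  ring

/-- On shell, `box` times the curvature vanishes, and `box` is not a zero divisor. -/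
theorem mom_mul_fieldStr_symm (hD : 3 < D) (hT : IsHook T) (h : ∀ a b c, fieldEq T a b c = 0)
    (a b c d e : Fin D) : mom e * fieldStr T a b c d = mom d * fieldStr T a b c e := by
  refine mul_left_cancel₀ (box_ne_zero (by omega)) ?_
  linear_combination mom e * box_mul_fieldStr hD.ne' hT h a b c d -
    mom d * box_mul_fieldStr hD.ne' hT h a b c e

/-- The gauge transformation of `T` whose parameter `B` combines the symmetric and the antisymmetric
one. -/
def gauge (B : Fin D → Fin D → Op D) (a b c : Fin D) : Op D :=
  mom a * B b c - mom b * B a c - mom c * (B a b - B b a)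

theorem mom_ne_zero (a : Fin D) : mom a ≠ 0 := MvPolynomial.X_ne_zero a

theorem two_mul_half : 2 * algebraMap ℝ (Op D) (1 / 2) = 1 := by
  rw [← map_ofNat (algebraMap ℝ (Op D)) 2, ← map_mul]
  norm_num

theorem exists_fieldStr_eq (hD : 3 < D) (hT : IsHook T) (h : ∀ a b c, fieldEq T a b c = 0) :
    ∃ W : Fin D → Fin D → Op D, (∀ a b, W a b = -W b a) ∧ ∀ a b c d, fieldStr T a b c d =
      mom d * (mom a * W b c + mom b * W c a + mom c * W a b) := by
  have z : Fin D := ⟨0, by omega⟩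
  choose G hG using fun a b c => exists_primitive_one_form (by omega) (fieldStr T a b c)
    fun d e => mom_mul_fieldStr_symm hD hT h a b c d e
  have swap_left (a b c) : G a b c = -G b a c := mul_left_cancel₀ (mom_ne_zero z) <| by
    rw [← hG, mul_neg, ← hG, fieldStr_anti_left hT]
  have swap_right (a b c) : G a b c = -G a c b := mul_left_cancel₀ (mom_ne_zero z) <| by
    rw [← hG, mul_neg, ← hG, fieldStr_anti_right hT]
  have closed (a b c d) : mom d * G a b c = mom a * G d b c + mom b * G d c a + mom c * G d a b :=
    mul_left_cancel₀ (mom_ne_zero z) <| by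
      have bianchi := mom_mul_fieldStr hT a b c z d
      simp only [hG] at bianchi
      linear_combination bianchi - mom z * mom a * (swap_left d b c - swap_right b c d) -
        mom z * mom b * (swap_left d c a - swap_right c a d) -
        mom z * mom c * (swap_left d a b - swap_right a b d)
  obtain ⟨W, hW, hGW⟩ := exists_primitive_three_form hD G swap_left swap_right closed
  exact ⟨W, hW, fun a b c d => by rw [hG, hGW]⟩

theorem exists_eq_curl_add (hD : 3 < D) (hT : IsHook T) (h : ∀ a b c, fieldEq T a b c = 0) :
    ∃ W B : Fin D → Fin D → Op D, (∀ a b, W a b = -W b a) ∧ ∀ a b c,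
      T a b c = mom a * B c b - mom b * B c a + mom c * W a b := by
  obtain ⟨W, hW, hF⟩ := exists_fieldStr_eq hD hT h
  choose B hB using fun c => exists_primitive_two_form (by omega)
    (fun a b => T a b c - mom c * W a b)
    (fun a b => by linear_combination hT.anti a b c - mom c * hW a b)
    (fun a b d => by
      have closed := hF a b d c
      rw [fieldStr] at closed
      linear_combination closed - mom a * hT.anti d b c + mom c * mom a * hW d b)
  exact ⟨W, B, hW, fun a b c => by linear_combination hB c a b⟩

theorem exists_eq_gauge (hD : 3 < D) (hT : IsHook T) (h : ∀ a b c, fieldEq T a b c = 0) :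
    ∃ B, ∀ a b c, T a b c = gauge B a b c := by
  obtain ⟨W, B, hW, hB⟩ := exists_eq_curl_add hD hT h
  obtain ⟨w, hw⟩ := exists_primitive_two_form (by omega) (fun a b => W a b + (B b a - B a b))
    (fun a b => by linear_combination hW a b)
    (fun a b d => by
      linear_combination hT.cyc a b d - hB d a b - hB a b d - hB b d a - mom a * hW d b)
  refine ⟨fun b c => B c b + algebraMap ℝ (Op D) (1 / 2) * (mom c * w b), fun a b c => ?_⟩
  rw [gauge]
  linear_combination hB a b c + mom c * hw a b - mom c * (mom a * w b - mom b * w a) * two_mul_half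

theorem exists_of_gauge_eq_zero (hD : 2 < D) (B : Fin D → Fin D → Op D)
    (h : ∀ a b c, gauge B a b c = 0) :
    ∃ u : Fin D → Op D, ∀ a b, B a b = -(4 * (mom a * u b) + 2 * (mom b * u a)) := by
  have z : Fin D := ⟨0, by omega⟩
  simp only [gauge] at h
  obtain ⟨u, hu⟩ := exists_primitive_two_form hD (fun a b => B a b - B b a) (fun a b => by ring)
    (fun a b c => mul_left_cancel₀ (mom_ne_zero z) (by
      linear_combination -mom c * h a b z - mom a * h b c z - mom b * h c a z))
  choose m hm using fun c => exists_primitive_one_form (by omega) (fun b => B b c - mom c * u b)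
    (fun b a => by linear_combination h a b c + mom c * hu a b)
  obtain ⟨ρ, hρ⟩ := exists_primitive_one_form (by omega) (fun b => 2 * u b - m b)
    (fun b c => by linear_combination hu b c - hm c b + hm b c)
  have six_mul_sixth : 6 * algebraMap ℝ (Op D) (1 / 6) = 1 := by
    rw [← map_ofNat (algebraMap ℝ (Op D)) 6, ← map_mul]
    norm_num
  refine ⟨fun b => algebraMap ℝ (Op D) (1 / 6) * (mom b * ρ - 3 * u b), fun a b => ?_⟩
  linear_combination hm b a - mom a * hρ b -
    (mom b * u a + 2 * mom a * u b - mom a * mom b * ρ) * six_mul_sixth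

end Solutions

/-! ### Exactness of the Koszul–Tate complex on the linear part -/

theorem IsSym.map {M N : Type*} [AddCommGroup M] [Module ℝ M] [AddCommGroup N] [Module ℝ N]
    {v : Lab D → M} (h : IsSym v) (f : M →ₗ[ℝ] N) : IsSym fun l => f (v l) := by
  rw [isSym_iff, young_map, h.young_eq]

/-- The bilinear pairing of linear combinations. -/
def pair (φ v : Lin D) : Op D := ∑ l, φ l * v l

theorem pair_young (φ v : Lin D) : pair φ (young v) = pair (young φ) v := by
  have adjoint := sum_young_adjoint (fun l => LinearMap.mul ℝ (Op D) (φ l)) v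
  rw [young_map] at adjoint
  exact adjoint

theorem pair_single (v : Lin D) (l : Lab D) : pair (Pi.single l 1) v = v l := by
  rw [pair, Finset.sum_eq_single l]
  · simp
  · intro m _ hm; simp [hm]
  · simp

theorem eq_of_pair_eq {v w : Lin D} (hv : IsSym v) (hw : IsSym w)
    (h : ∀ φ, IsSym φ → pair φ v = pair φ w) : v = w := by
  funext l
  rw [← pair_single v, ← pair_single w, ← hv.young_eq, ← hw.young_eq, pair_young, pair_young]
  exact h _ (isSym_young _)

/-- Evaluation of the linear part of an element of the algebra. -/
def evalLin (φ : Lin D) : Alg D →ₗ[ℝ] Op D :=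
  (∑ l, LinearMap.mulLeft ℝ (φ l) ∘ₗ LinearMap.proj l) ∘ₗ linPart

theorem evalLin_apply (φ : Lin D) (a : Alg D) : evalLin φ a = pair φ (linPart a) := by
  simp [evalLin, pair]

theorem evalLin_gen {φ : Lin D} (hφ : IsSym φ) (l : Lab D) (k : Multiset (Fin D)) :
    evalLin φ (gen (l.at k)) = φ l * mono k := by
  rw [evalLin_apply, linPart_gen, toLin_at, pair_young, hφ.young_eq, pair, Finset.sum_eq_single l]
  · simp
  · intro m _ hm; simp [hm]
  · simp

/-- The transpose of the Koszul–Tate differential. -/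
def koszulDual (φ : Lin D) : Lin D := fun l => evalLin φ (koszulData.der (gen (l.at 0)))

theorem pair_koszulLin (φ v : Lin D) : pair φ (koszulLin v) = pair (koszulDual φ) v := by
  simp only [pair, koszulDual, evalLin_apply, koszulLin_apply, Finset.sum_apply, Pi.smul_apply,
    smul_eq_mul, Finset.mul_sum, Finset.sum_mul]
  rw [Finset.sum_comm]
  exact Finset.sum_congr rfl fun l _ => Finset.sum_congr rfl fun m _ => by ring

theorem isSym_koszulDual (φ : Lin D) : IsSym (koszulDual φ) :=
  (isSym_gen 0).map (evalLin φ ∘ₗ koszulData.der)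

section Dual

variable {φ : Lin D}

theorem IsSym.isHook_T (hφ : IsSym φ) : IsHook fun a b c => φ (.T a b c) := ⟨hφ.T_anti, hφ.T_cyc⟩

theorem IsSym.isHook_Ts (hφ : IsSym φ) : IsHook fun a b c => φ (.Ts a b c) :=
  ⟨hφ.Ts_anti, hφ.Ts_cyc⟩

theorem mono_singleton_cons (a : Fin D) : mono (a ::ₘ 0) = mom a := by
  rw [mono_cons, mono_zero, mul_one]

theorem evalLin_Fstr (hφ : IsSym φ) (a b c d : Fin D) (k : Multiset (Fin D)) :
    evalLin φ (Fstr a b c d k) = mono k * fieldStr (fun a b c => φ (.T a b c)) a b c d := by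
  have evalLin_gen_T (a b c k) : evalLin φ (gen (.T a b c k)) = φ (.T a b c) * mono k :=
    evalLin_gen hφ (.T a b c) k
  simp only [Fstr, map_add, evalLin_gen_T, mono_cons, fieldStr]
  ring

theorem evalLin_ricci (hφ : IsSym φ) (a b c : Fin D) :
    evalLin φ (ricci a b c 0) = (1 / 2 : ℝ) • ric (fun a b c => φ (.T a b c)) a b c := by
  simp only [ricci, curv, map_sum, map_smul, map_sub, evalLin_Fstr hφ, ric, Finset.smul_sum,
    mono_singleton_cons]
  refine Finset.sum_congr rfl fun d _ => ?_
  rw [smul_comm, Algebra.smul_def (η d)]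
  rfl

theorem evalLin_ricciTr (hφ : IsSym φ) (a : Fin D) :
    evalLin φ (ricciTr a 0) = (1 / 2 : ℝ) • ricTr (fun a b c => φ (.T a b c)) a := by
  simp only [ricciTr, map_sum, map_smul, evalLin_ricci hφ, ricTr, Finset.smul_sum]
  refine Finset.sum_congr rfl fun d _ => ?_
  rw [smul_comm, Algebra.smul_def (η d)]
  rfl

theorem koszulDual_Ts (hφ : IsSym φ) (a b c : Fin D) : koszulDual φ (.Ts a b c) =
    (3 / 4 : ℝ) • fieldEq (fun a b c => φ (.T a b c)) a b c := by
  have metric_mul_smul (x y z : Fin D) (r : Op D) : (metric x y * η z) • r =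
      if x = y then met x * met z * r else 0 := by
    rw [metric]
    split_ifs with h
    · rw [Algebra.smul_def, map_mul]; rfl
    · simp
  have smul_ric : (η a * η b * η c) • ric (fun a b c => φ (.T a b c)) a b c =
      met a * met b * met c * ric (fun a b c => φ (.T a b c)) a b c := by
    rw [Algebra.smul_def, map_mul, map_mul]; rfl
  rw [koszulDual, DerData.der_gen]
  change evalLin φ (eom a b c 0) = _
  simp only [eom, map_smul, map_add, map_sub, evalLin_ricci hφ, evalLin_ricciTr hφ, fieldEq,
    ← metric_mul_smul, ← smul_ric, two_mul]
  module

theorem koszulDual_Ss (hφ : IsSym φ) (a b : Fin D) : koszulDual φ (.Ss a b) =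
    -∑ c, mom c * (φ (.Ts c a b) + φ (.Ts c b a)) := by
  have evalLin_gen_Ts (a b c k) : evalLin φ (gen (.Ts a b c k)) = φ (.Ts a b c) * mono k :=
    evalLin_gen hφ (.Ts a b c) k
  rw [koszulDual, DerData.der_gen]
  change evalLin φ (-∑ c, (gen (.Ts c a b (c ::ₘ 0)) + gen (.Ts c b a (c ::ₘ 0)))) = _
  simp only [map_neg, map_sum, map_add, evalLin_gen_Ts, mono_singleton_cons]
  exact congrArg _ (Finset.sum_congr rfl fun c _ => by ring)

theorem koszulDual_As (hφ : IsSym φ) (a b : Fin D) : koszulDual φ (.As a b) =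
    -3 * ∑ c, mom c * (φ (.Ts c a b) - φ (.Ts c b a)) := by
  have evalLin_gen_Ts (a b c k) : evalLin φ (gen (.Ts a b c k)) = φ (.Ts a b c) * mono k :=
    evalLin_gen hφ (.Ts a b c) k
  rw [koszulDual, DerData.der_gen]
  change evalLin φ (-(3 : ℝ) • ∑ c, (gen (.Ts c a b (c ::ₘ 0)) - gen (.Ts c b a (c ::ₘ 0)))) = _
  simp only [map_smul, map_sum, map_sub, evalLin_gen_Ts, mono_singleton_cons]
  rw [Algebra.smul_def, map_neg, map_ofNat]
  exact congrArg _ (Finset.sum_congr rfl fun c _ => by ring)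

theorem koszulDual_Cs (hφ : IsSym φ) (a : Fin D) : koszulDual φ (.Cs a) =
    6 * (∑ c, mom c * φ (.Ss c a)) + 2 * ∑ c, mom c * φ (.As c a) := by
  have evalLin_gen_Ss (a b k) : evalLin φ (gen (.Ss a b k)) = φ (.Ss a b) * mono k :=
    evalLin_gen hφ (.Ss a b) k
  have evalLin_gen_As (a b k) : evalLin φ (gen (.As a b k)) = φ (.As a b) * mono k :=
    evalLin_gen hφ (.As a b) k
  rw [koszulDual, DerData.der_gen]
  change evalLin φ ((6 : ℝ) • (∑ c, gen (.Ss c a (c ::ₘ 0))) +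
    (2 : ℝ) • ∑ c, gen (.As c a (c ::ₘ 0))) = _
  simp only [map_smul, map_sum, map_add, evalLin_gen_Ss, evalLin_gen_As,
    mono_singleton_cons]
  rw [Algebra.smul_def, Algebra.smul_def, map_ofNat, map_ofNat]
  simp only [mul_comm (mom _)]

theorem koszulDual_of_lev {l : Lab D} (hl : l.lev = 0 ∨ l.lev = 5) : koszulDual φ l = 0 := by
  rw [koszulDual, DerData.der_gen]
  refine (congrArg _ ?_).trans (map_zero _)
  cases l <;> first | rfl | simp [Lab.lev] at hl

theorem sum_mom_mul_mom_mul {X : Fin D → Fin D → Op D} (swap : ∀ a b, X a b = -X b a) :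
    ∑ a, ∑ b, mom a * (mom b * X b a) = 0 := by
  refine self_eq_neg.1 ?_
  conv_rhs => rw [Finset.sum_comm]
  simp only [← Finset.sum_neg_distrib]
  refine Finset.sum_congr rfl fun a _ => Finset.sum_congr rfl fun b _ => ?_
  rw [swap b a]
  ring

theorem koszulDual_koszulDual_Cs (hφ : IsSym φ) (a : Fin D) :
    koszulDual (koszulDual φ) (.Cs a) = 0 := by
  have expand : koszulDual (koszulDual φ) (.Cs a) =
      -12 * ∑ c, ∑ d, mom c * (mom d * φ (.Ts d c a)) := by
    rw [koszulDual_Cs (isSym_koszulDual φ)]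
    simp only [koszulDual_Ss hφ, koszulDual_As hφ, Finset.mul_sum, ← Finset.sum_add_distrib,
      ← Finset.sum_neg_distrib]
    exact Finset.sum_congr rfl fun c _ => Finset.sum_congr rfl fun d _ => by ring
  rw [expand, sum_mom_mul_mom_mul fun b c => hφ.Ts_anti b c a, mul_zero]

theorem koszulDual_koszulDual (hφ : IsSym φ) : koszulDual (koszulDual φ) = 0 := by
  have isSym_dual := isSym_koszulDual φ
  have noether (a b) : ∑ c, mom c * koszulDual φ (.Ts c a b) = 0 := by
    simp only [koszulDual_Ts hφ, mul_smul_comm, ← Finset.smul_sum, sum_mom_fieldEq hφ.isHook_T,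
      smul_zero]
  funext l
  cases l with
  | Ts a b c =>
    have dual_T : (fun a b c => koszulDual φ (.T a b c)) = fun _ _ _ => 0 := by
      funext a b c; exact koszulDual_of_lev (.inl rfl)
    rw [koszulDual_Ts isSym_dual, dual_T]
    simp [fieldEq, ric, ricTr, fieldStr]
  | Ss a b =>
    rw [koszulDual_Ss isSym_dual]
    simp only [mul_add, Finset.sum_add_distrib, noether, add_zero, neg_zero, Pi.zero_apply]
  | As a b =>
    rw [koszulDual_As isSym_dual]
    simp only [mul_sub, Finset.sum_sub_distrib, noether, sub_zero, mul_zero, Pi.zero_apply]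
  | Cs a => exact koszulDual_koszulDual_Cs hφ a
  | _ => exact koszulDual_of_lev (by simp [Lab.lev])

theorem isSym_koszulLin (v : Lin D) : IsSym (koszulLin v) := isSym_iff.2 (young_koszulLin v)

theorem koszulLin_koszulLin (v : Lin D) : koszulLin (koszulLin v) = 0 := by
  refine eq_of_pair_eq (isSym_koszulLin _) (isSym_iff.2 (map_zero _)) fun φ hφ => ?_
  rw [pair_koszulLin, pair_koszulLin, koszulDual_koszulDual hφ]
  simp [pair]

theorem koszul_koszul (a : Alg D) : koszulData.der (koszulData.der a) = 0 := by
  have isDer_bracket := (koszulData (D := D)).isDer.bracket koszulData.isDer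
    hasParity_koszul_gen hasParity_koszul_gen
  have bracket_eq_zero := isDer_bracket.ext (isDer_zero _) fun g => by
    have koszul_koszul_gen : koszulData.der (koszulData.der (gen g)) = 0 := by
      rw [koszul_gen_eq, ← toAlg_koszulLin, koszulLin_koszulLin, map_zero]
    simp only [LinearMap.sub_apply, LinearMap.smul_apply, LinearMap.comp_apply, koszul_koszul_gen,
      smul_zero, sub_zero, LinearMap.zero_apply]
  have two_smul_eq_zero : (2 : ℝ) • koszulData.der (koszulData.der a) = 0 := by
    simpa [two_smul] using LinearMap.congr_fun bracket_eq_zero a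
  exact (smul_eq_zero.1 two_smul_eq_zero).resolve_left two_ne_zero

end Dual

theorem isHook_gauge (B : Fin D → Fin D → Op D) : IsHook (gauge B) where
  anti a b c := by simp only [gauge]; ring
  cyc a b c := by simp only [gauge]; ring

theorem IsHook.sum_mul_sub_swap {H : Fin D → Fin D → Fin D → Op D} (hH : IsHook H)
    (f : Fin D → Fin D → Fin D → Op D) :
    ∑ a, ∑ b, ∑ c, H a b c * (f a b c - f b a c) = 2 * ∑ a, ∑ b, ∑ c, H a b c * f a b c := by
  have swapped : ∑ a, ∑ b, ∑ c, H a b c * f b a c = -∑ a, ∑ b, ∑ c, H a b c * f a b c := by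
    rw [Finset.sum_comm]
    simp only [← Finset.sum_neg_distrib]
    refine Finset.sum_congr rfl fun a _ => Finset.sum_congr rfl fun b _ =>
      Finset.sum_congr rfl fun c _ => ?_
    rw [hH.anti b a c, neg_mul]
  simp only [mul_sub, Finset.sum_sub_distrib]
  rw [swapped]
  ring

theorem sum_rotate (f : Fin D → Fin D → Fin D → Op D) :
    ∑ a, ∑ b, ∑ c, f b c a = ∑ a, ∑ b, ∑ c, f a b c :=
  Finset.sum_comm.trans (Finset.sum_congr rfl fun _ _ => Finset.sum_comm)

theorem IsHook.sum_mul_gauge {H : Fin D → Fin D → Fin D → Op D} (hH : IsHook H)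
    (B : Fin D → Fin D → Op D) :
    ∑ a, ∑ b, ∑ c, H a b c * gauge B a b c =
      2 * ∑ a, ∑ b, ∑ c, H a b c * (mom a * (2 * B b c - B c b)) := by
  have rotated : ∑ a, ∑ b, ∑ c, H a b c * (mom c * B a b) =
      ∑ a, ∑ b, ∑ c, H a b c * (mom a * (B c b - B b c)) :=
    calc ∑ a, ∑ b, ∑ c, H a b c * (mom c * B a b)
        = ∑ a, ∑ b, ∑ c, (H a c b * (mom a * B b c) - H a b c * (mom a * B b c)) := by
          rw [← sum_rotate]
          refine Finset.sum_congr rfl fun a _ => Finset.sum_congr rfl fun b _ =>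
            Finset.sum_congr rfl fun c _ => ?_
          linear_combination (mom a * B b c) * (hH.cyc a b c - hH.anti c a b)
      _ = ∑ a, ∑ b, ∑ c, H a b c * (mom a * (B c b - B b c)) := by
          simp only [mul_sub, Finset.sum_sub_distrib]
          exact congrArg (· - _) (Finset.sum_congr rfl fun a _ => Finset.sum_comm)
  calc ∑ a, ∑ b, ∑ c, H a b c * gauge B a b c
      = ∑ a, ∑ b, ∑ c, H a b c *
          ((mom a * B b c - mom c * B a b) - (mom b * B a c - mom c * B b a)) := by
        simp only [gauge]
        exact Finset.sum_congr rfl fun a _ => Finset.sum_congr rfl fun b _ =>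
          Finset.sum_congr rfl fun c _ => by ring
    _ = 2 * ((∑ a, ∑ b, ∑ c, H a b c * (mom a * B b c)) -
          ∑ a, ∑ b, ∑ c, H a b c * (mom a * (B c b - B b c))) := by
        rw [hH.sum_mul_sub_swap fun a b c => mom a * B b c - mom c * B a b, ← rotated]
        simp only [mul_sub, Finset.sum_sub_distrib]
    _ = 2 * ∑ a, ∑ b, ∑ c, H a b c * (mom a * (2 * B b c - B c b)) := by
        simp only [← Finset.sum_sub_distrib]
        exact congrArg _ (Finset.sum_congr rfl fun a _ => Finset.sum_congr rfl fun b _ =>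
          Finset.sum_congr rfl fun c _ => by ring)

/-- The Koszul–Tate differential of a family with the symmetries in components. -/
def koszulComp (v : Lin D) : Lin D
  | .T a b c => (3 / 4 : ℝ) • fieldEq (fun a b c => v (.Ts a b c)) a b c
  | .Ts a b c => gauge (fun a b => -(v (.Ss a b) + v (.As a b))) a b c
  | .Ss a b => 3 * (mom a * v (.Cs b) + mom b * v (.Cs a))
  | .As a b => mom a * v (.Cs b) - mom b * v (.Cs a)
  | _ => 0

theorem isSym_koszulComp {v : Lin D} (hv : IsSym v) : IsSym (koszulComp v) := by
  have T_eq_dual (a b c) : koszulComp v (.T a b c) =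
      koszulDual (fun | .T a b c => v (.Ts a b c) | _ => 0) (.Ts a b c) := by
    rw [koszulDual_Ts]
    · rfl
    · exact ⟨hv.Ts_anti, hv.Ts_cyc, by simp, by simp, by simp, by simp, by simp, by simp⟩
  constructor
  · intro a b c; simp only [T_eq_dual]; exact (isSym_koszulDual _).Ts_anti a b c
  · intro a b c; simp only [T_eq_dual]; exact (isSym_koszulDual _).Ts_cyc a b c
  · intros; rfl
  · intros; simp [koszulComp]
  · exact (isHook_gauge _).anti
  · exact (isHook_gauge _).cyc
  · intros; simp only [koszulComp]; ring
  · intros; simp only [koszulComp]; ring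

theorem sum_mul_add_swap {X : Fin D → Fin D → Op D} (symm : ∀ a b, X a b = X b a)
    (f : Fin D → Fin D → Op D) :
    ∑ a, ∑ b, X a b * (f a b + f b a) = 2 * ∑ a, ∑ b, X a b * f a b := by
  have swapped : ∑ a, ∑ b, X a b * f b a = ∑ a, ∑ b, X a b * f a b := by
    rw [Finset.sum_comm]
    exact Finset.sum_congr rfl fun a _ => Finset.sum_congr rfl fun b _ => by rw [symm]
  simp only [mul_add, Finset.sum_add_distrib]
  rw [swapped, two_mul]

theorem sum_mul_sub_swap {X : Fin D → Fin D → Op D} (anti : ∀ a b, X a b = -X b a)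
    (f : Fin D → Fin D → Op D) :
    ∑ a, ∑ b, X a b * (f a b - f b a) = 2 * ∑ a, ∑ b, X a b * f a b := by
  have swapped : ∑ a, ∑ b, X a b * f b a = -∑ a, ∑ b, X a b * f a b := by
    rw [Finset.sum_comm]
    simp only [← Finset.sum_neg_distrib]
    refine Finset.sum_congr rfl fun a _ => Finset.sum_congr rfl fun b _ => ?_
    rw [anti b a, neg_mul]
  simp only [mul_sub, Finset.sum_sub_distrib]
  rw [swapped]
  ring

section Components

variable {φ v : Lin D}

theorem sum_koszulDual_Ts_mul (hφ : IsSym φ) (hv : IsSym v) :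
    ∑ a, ∑ b, ∑ c, koszulDual φ (.Ts a b c) * v (.Ts a b c) =
      ∑ a, ∑ b, ∑ c, φ (.T a b c) * koszulComp v (.T a b c) := by
  have fieldEq_comm := sum_mul_fieldEq_comm hφ.isHook_T hv.isHook_Ts
  simp only [koszulDual_Ts hφ, koszulComp, mul_smul_comm, smul_mul_assoc, ← Finset.smul_sum]
  rw [← fieldEq_comm]
  simp only [mul_comm (v _)]

theorem sum_koszulDual_Ss_mul (hφ : IsSym φ) (hv : IsSym v) :
    ∑ a, ∑ b, koszulDual φ (.Ss a b) * v (.Ss a b) =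
      -2 * ∑ a, ∑ b, ∑ c, φ (.Ts a b c) * (mom a * v (.Ss b c)) :=
  calc ∑ a, ∑ b, koszulDual φ (.Ss a b) * v (.Ss a b)
      = -∑ a, ∑ b, v (.Ss a b) *
          ((∑ c, mom c * φ (.Ts c a b)) + ∑ c, mom c * φ (.Ts c b a)) := by
        simp only [koszulDual_Ss hφ, mul_comm _ (v (.Ss _ _)), mul_add, mul_neg,
          Finset.sum_add_distrib, Finset.sum_neg_distrib]
    _ = -(2 * ∑ a, ∑ b, v (.Ss a b) * ∑ c, mom c * φ (.Ts c a b)) := by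
        rw [sum_mul_add_swap hv.Ss_symm fun a b => ∑ c, mom c * φ (.Ts c a b)]
    _ = -2 * ∑ a, ∑ b, ∑ c, φ (.Ts a b c) * (mom a * v (.Ss b c)) := by
        rw [sum_rotate fun a b c => φ (.Ts c a b) * (mom c * v (.Ss a b)), neg_mul]
        simp only [Finset.mul_sum]
        exact congrArg _ (Finset.sum_congr rfl fun a _ => Finset.sum_congr rfl fun b _ =>
          Finset.sum_congr rfl fun c _ => by ring)

theorem sum_koszulDual_As_mul (hφ : IsSym φ) (hv : IsSym v) :
    ∑ a, ∑ b, koszulDual φ (.As a b) * v (.As a b) =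
      -6 * ∑ a, ∑ b, ∑ c, φ (.Ts a b c) * (mom a * v (.As b c)) :=
  calc ∑ a, ∑ b, koszulDual φ (.As a b) * v (.As a b)
      = -3 * ∑ a, ∑ b, v (.As a b) *
          ((∑ c, mom c * φ (.Ts c a b)) - ∑ c, mom c * φ (.Ts c b a)) := by
        simp only [koszulDual_As hφ, mul_comm _ (v (.As _ _)), mul_sub, Finset.sum_sub_distrib,
          Finset.mul_sum, mul_left_comm _ (-3 : Op D)]
    _ = -3 * (2 * ∑ a, ∑ b, v (.As a b) * ∑ c, mom c * φ (.Ts c a b)) := by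
        rw [sum_mul_sub_swap hv.As_anti fun a b => ∑ c, mom c * φ (.Ts c a b)]
    _ = -6 * ∑ a, ∑ b, ∑ c, φ (.Ts a b c) * (mom a * v (.As b c)) := by
        rw [sum_rotate fun a b c => φ (.Ts c a b) * (mom c * v (.As a b))]
        simp only [Finset.mul_sum]
        exact Finset.sum_congr rfl fun a _ => Finset.sum_congr rfl fun b _ =>
          Finset.sum_congr rfl fun c _ => by ring

theorem sum_koszulDual_Ss_add_As_mul (hφ : IsSym φ) (hv : IsSym v) :
    (∑ a, ∑ b, koszulDual φ (.Ss a b) * v (.Ss a b)) +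
        ∑ a, ∑ b, koszulDual φ (.As a b) * v (.As a b) =
      ∑ a, ∑ b, ∑ c, φ (.Ts a b c) * koszulComp v (.Ts a b c) := by
  rw [sum_koszulDual_Ss_mul hφ hv, sum_koszulDual_As_mul hφ hv]
  simp only [koszulComp]
  rw [hφ.isHook_Ts.sum_mul_gauge]
  simp only [Finset.mul_sum, ← Finset.sum_add_distrib]
  refine Finset.sum_congr rfl fun a _ => Finset.sum_congr rfl fun b _ =>
    Finset.sum_congr rfl fun c _ => ?_
  rw [hv.Ss_symm c b, hv.As_anti c b]
  ring

theorem sum_koszulDual_Cs_mul (hφ : IsSym φ) :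
    ∑ a, koszulDual φ (.Cs a) * v (.Cs a) =
      (∑ a, ∑ b, φ (.Ss a b) * koszulComp v (.Ss a b)) +
        ∑ a, ∑ b, φ (.As a b) * koszulComp v (.As a b) := by
  have Ss_sum : ∑ a, ∑ b, φ (.Ss a b) * koszulComp v (.Ss a b) =
      3 * (2 * ∑ a, ∑ b, φ (.Ss a b) * (mom a * v (.Cs b))) := by
    rw [← sum_mul_add_swap hφ.Ss_symm fun a b => mom a * v (.Cs b)]
    simp only [koszulComp, Finset.mul_sum, mul_left_comm _ (3 : Op D)]
  have As_sum : ∑ a, ∑ b, φ (.As a b) * koszulComp v (.As a b) =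
      2 * ∑ a, ∑ b, φ (.As a b) * (mom a * v (.Cs b)) :=
    sum_mul_sub_swap hφ.As_anti fun a b => mom a * v (.Cs b)
  rw [Ss_sum, As_sum, Finset.sum_comm (f := fun a b => φ (.Ss a b) * (mom a * v (.Cs b))),
    Finset.sum_comm (f := fun a b => φ (.As a b) * (mom a * v (.Cs b)))]
  simp only [koszulDual_Cs hφ, Finset.mul_sum, ← Finset.sum_add_distrib, Finset.sum_mul]
  exact Finset.sum_congr rfl fun a _ => Finset.sum_congr rfl fun b _ => by ring

theorem koszulLin_eq_koszulComp (hv : IsSym v) : koszulLin v = koszulComp v := by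
  refine eq_of_pair_eq (isSym_koszulLin _) (isSym_koszulComp hv) fun φ hφ => ?_
  have dual_T (a b c) : koszulDual φ (.T a b c) = 0 := koszulDual_of_lev (.inl rfl)
  have dual_S (a b) : koszulDual φ (.S a b) = 0 := koszulDual_of_lev (.inr rfl)
  have dual_A (a b) : koszulDual φ (.A a b) = 0 := koszulDual_of_lev (.inr rfl)
  have dual_C (a) : koszulDual φ (.C a) = 0 := koszulDual_of_lev (.inr rfl)
  have comp_S (a b) : koszulComp v (.S a b) = 0 := rfl
  have comp_A (a b) : koszulComp v (.A a b) = 0 := rfl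
  have comp_C (a) : koszulComp v (.C a) = 0 := rfl
  have comp_Cs (a) : koszulComp v (.Cs a) = 0 := rfl
  rw [pair_koszulLin, pair, pair, sum_lab, sum_lab]
  simp only [dual_T, dual_S, dual_A, dual_C, comp_S, comp_A, comp_C, comp_Cs, zero_mul, mul_zero,
    Finset.sum_const_zero, zero_add, add_zero, sum_koszulDual_Ts_mul hφ hv,
    sum_koszulDual_Cs_mul hφ, ← sum_koszulDual_Ss_add_As_mul hφ hv]
  ring

end Components

/-- The antifields `S*`, `A*`, `C*` whose Koszul–Tate differential is the gauge transformation with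
parameter `B` at `T*` and is built from `u` at `S*` and `A*`. -/
def gaugeAntifields (B : Fin D → Fin D → Op D) (u : Fin D → Op D) : Lin D
  | .Ss a b => -(algebraMap ℝ (Op D) (1 / 2) * (B a b + B b a))
  | .As a b => -(algebraMap ℝ (Op D) (1 / 2) * (B a b - B b a))
  | .Cs a => u a
  | _ => 0

theorem isSym_gaugeAntifields (B : Fin D → Fin D → Op D) (u : Fin D → Op D) :
    IsSym (gaugeAntifields B u) := by
  constructor <;> intros <;> simp only [gaugeAntifields] <;> ring

theorem koszulComp_gaugeAntifields_Ts (B : Fin D → Fin D → Op D) (u : Fin D → Op D)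
    (a b c : Fin D) : koszulComp (gaugeAntifields B u) (.Ts a b c) = gauge B a b c := by
  simp only [koszulComp, gaugeAntifields, gauge]
  linear_combination (mom a * B b c - mom b * B a c - mom c * (B a b - B b a)) * two_mul_half

theorem koszulLin_exact (hD : 3 < D) {v : Lin D} (hv : IsSym v)
    (fields_eq_zero : ∀ l : Lab D, l.lev = 0 ∨ l.lev = 5 → v l = 0) (closed : koszulLin v = 0) :
    ∃ w, koszulLin w = v := by
  rw [koszulLin_eq_koszulComp hv] at closed
  obtain ⟨B, hB⟩ := exists_eq_gauge hD hv.isHook_Ts fun a b c =>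
    (smul_eq_zero.1 (congrFun closed (.T a b c))).resolve_left (by norm_num)
  obtain ⟨u, hu⟩ := exists_of_gauge_eq_zero (by omega) (fun a b => -(v (.Ss a b) + v (.As a b)))
    fun a b c => congrFun closed (.Ts a b c)
  have Cs_eq_zero (a) : v (.Cs a) = 0 := by
    have := congrFun closed (.Ss a a)
    simp only [koszulComp, Pi.zero_apply, ← two_mul] at this
    simpa [mom_ne_zero] using this
  refine ⟨gaugeAntifields B u, ?_⟩
  rw [koszulLin_eq_koszulComp (isSym_gaugeAntifields B u)]
  funext l
  cases l with
  | T a b c =>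
    rw [fields_eq_zero _ (.inl rfl)]
    simp [koszulComp, gaugeAntifields, fieldEq, ric, ricTr, fieldStr]
  | Ts a b c => rw [hB, koszulComp_gaugeAntifields_Ts]
  | Ss a b =>
    refine mul_left_cancel₀ (two_ne_zero (α := Op D)) ?_
    simp only [koszulComp, gaugeAntifields]
    linear_combination hu a b + hu b a - hv.Ss_symm a b + hv.As_anti a b
  | As a b =>
    refine mul_left_cancel₀ (two_ne_zero (α := Op D)) ?_
    simp only [koszulComp, gaugeAntifields]
    linear_combination hu a b - hu b a + hv.Ss_symm a b - hv.As_anti a b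
  | Cs a => rw [Cs_eq_zero]; rfl
  | _ => rw [fields_eq_zero _ (.inr rfl)]; rfl

/-! ### A contracting homotopy on linear forms -/

/-- The projection to the variables of level `n`. -/
def levProj (n : ℕ) : Lin D →ₗ[ℝ] Lin D where
  toFun v l := if l.lev = n then v l else 0
  map_add' v w := by funext l; simp only [Pi.add_apply]; split_ifs <;> simp
  map_smul' c v := by funext l; simp only [Pi.smul_apply, RingHom.id_apply]; split_ifs <;> simp

theorem levProj_apply (n : ℕ) (v : Lin D) (l : Lab D) :
    levProj n v l = if l.lev = n then v l else 0 := rfl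

theorem levProj_levProj (n : ℕ) (v : Lin D) : levProj n (levProj n v) = levProj n v := by
  funext l
  simp only [levProj_apply]
  split_ifs <;> rfl

theorem levProj_levProj_of_ne {n m : ℕ} (h : n ≠ m) (v : Lin D) : levProj n (levProj m v) = 0 := by
  funext l
  simp only [levProj_apply, Pi.zero_apply]
  split_ifs with lev_n lev_m
  · exact absurd (lev_n.symm.trans lev_m) h
  all_goals rfl

theorem Lab.lev_lt (l : Lab D) : l.lev < 6 := by cases l <;> simp [Lab.lev]

theorem sum_levProj (v : Lin D) : ∑ n ∈ Finset.range 6, levProj n v = v := by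
  funext l
  simp [Finset.sum_apply, levProj_apply, l.lev_lt]

theorem levProj_of_le {n : ℕ} (h : 6 ≤ n) (v : Lin D) : levProj n v = 0 := by
  funext l
  rw [levProj_apply, if_neg (l.lev_lt.trans_le h).ne]
  rfl

theorem young_levProj (n : ℕ) (v : Lin D) : young (levProj n v) = levProj n (young v) := by
  funext l
  by_cases h : l.lev = n
  · rw [levProj_apply, if_pos h]
    have young_sub : young (levProj n v - v) l = 0 := young_eq_zero_of_kind fun m hm => by
      simp [levProj_apply, Lab.lev_eq_of_kind hm, h]
    rwa [map_sub, Pi.sub_apply, sub_eq_zero] at young_sub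
  · rw [levProj_apply, if_neg h]
    exact young_eq_zero_of_kind fun m hm => by
      rw [levProj_apply, if_neg (by rw [Lab.lev_eq_of_kind hm]; exact h)]

theorem levProj_koszulLin (n : ℕ) (v : Lin D) :
    levProj n (koszulLin v) = koszulLin (levProj (n + 1) v) := by
  funext l
  rw [levProj_apply, koszulLin_apply_apply, koszulLin_apply_apply]
  split_ifs with h
  · refine Finset.sum_congr rfl fun m _ => ?_
    by_cases hm : m.lev = l.lev + 1
    · rw [levProj_apply, if_pos (by omega)]
    · rw [koszulMat_eq_zero hm, mul_zero, mul_zero]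
  · refine (Finset.sum_eq_zero fun m _ => ?_).symm
    by_cases hm : m.lev = l.lev + 1
    · rw [levProj_apply, if_neg (by omega), zero_mul]
    · rw [koszulMat_eq_zero hm, mul_zero]

theorem koszulLin_levProj_zero (v : Lin D) : koszulLin (levProj 0 v) = 0 := by
  funext l
  rw [koszulLin_apply_apply]
  refine Finset.sum_eq_zero fun m _ => ?_
  by_cases hm : m.lev = l.lev + 1
  · rw [levProj_apply, if_neg (by omega), zero_mul]
  · rw [koszulMat_eq_zero hm, mul_zero]

theorem levProj_toLin (l : Lab D) (k : Multiset (Fin D)) (n : ℕ) :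
    levProj n (toLin (l.at k)) = if l.lev = n then toLin (l.at k) else 0 := by
  funext m
  rw [levProj_apply]
  by_cases hm : m.kind = l.kind
  · rw [Lab.lev_eq_of_kind hm]
    split_ifs <;> rfl
  · rw [toLin_at_of_kind hm]
    split_ifs <;> simp [toLin_at_of_kind hm]

theorem exists_generalized_inverse {k V W : Type*} [DivisionRing k] [AddCommGroup V] [Module k V]
    [AddCommGroup W] [Module k W] (f : V →ₗ[k] W) :
    ∃ g : W →ₗ[k] V, ∀ v, f (g (f v)) = f v := by
  obtain ⟨s, hs⟩ := f.rangeRestrict.exists_rightInverse_of_surjective f.range_rangeRestrict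
  obtain ⟨g, hg⟩ := LinearMap.exists_extend s
  refine ⟨g, fun v => ?_⟩
  calc f (g (f v)) = f (s (f.rangeRestrict v)) :=
        congrArg f (LinearMap.congr_fun hg (f.rangeRestrict v))
    _ = f v := congrArg Subtype.val (LinearMap.congr_fun hs (f.rangeRestrict v))

/-- A generalized inverse of the linearised Koszul–Tate differential which raises the level by one
and takes values in the families with the symmetries of the variables. -/
structure IsKoszulInverse (g : Lin D →ₗ[ℝ] Lin D) : Prop where
  koszulLin_comp_koszulLin (v : Lin D) : koszulLin (g (koszulLin v)) = koszulLin v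
  young_apply (v : Lin D) : young (g v) = g v
  levProj_succ (n : ℕ) (v : Lin D) : levProj (n + 1) (g v) = g (levProj n v)
  levProj_zero (v : Lin D) : levProj 0 (g v) = 0

theorem exists_isKoszulInverse : ∃ g : Lin D →ₗ[ℝ] Lin D, IsKoszulInverse g := by
  obtain ⟨g, hg⟩ := exists_generalized_inverse ((koszulLin (D := D)).restrictScalars ℝ)
  simp only [LinearMap.coe_restrictScalars] at hg
  let g' : Lin D →ₗ[ℝ] Lin D := ∑ n ∈ Finset.range 6, levProj (n + 1) ∘ₗ young ∘ₗ g ∘ₗ levProj n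
  have g'_apply (v) : g' v = ∑ n ∈ Finset.range 6, levProj (n + 1) (young (g (levProj n v))) := by
    simp [g']
  refine ⟨g', fun v => ?_, fun v => ?_, fun n v => ?_, fun v => ?_⟩
  · rw [g'_apply, map_sum]
    conv_rhs => rw [← sum_levProj (koszulLin v)]
    refine Finset.sum_congr rfl fun n _ => ?_
    rw [← levProj_koszulLin, levProj_koszulLin n v, koszulLin_young, hg, ← levProj_koszulLin,
      levProj_levProj]
  · rw [g'_apply, map_sum]
    refine Finset.sum_congr rfl fun n _ => ?_
    rw [young_levProj, young_young]
  · rw [g'_apply, g'_apply, map_sum]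
    rcases lt_or_ge n 6 with hn | hn
    · rw [Finset.sum_eq_single_of_mem n (Finset.mem_range.2 hn),
        Finset.sum_eq_single_of_mem n (Finset.mem_range.2 hn), levProj_levProj, levProj_levProj]
      · intro m _ hm
        simp only [levProj_levProj_of_ne hm, map_zero]
      · intro m _ hm
        rw [levProj_levProj_of_ne (by omega)]
    · simp only [levProj_of_le hn, levProj_of_le (hn.trans n.le_succ), map_zero]
  · rw [g'_apply, map_sum]
    exact Finset.sum_eq_zero fun m _ => levProj_levProj_of_ne (by omega) _

/-- The correction of a generalized inverse `g` of the linearised Koszul–Tate differential which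
makes it a contracting homotopy in the degrees where the differential is exact. -/
def linHomotopy (g : Lin D →ₗ[ℝ] Lin D) : Lin D →ₗ[ℝ] Lin D :=
  g - koszulLin.restrictScalars ℝ ∘ₗ g ∘ₗ g

theorem linHomotopy_apply (g : Lin D →ₗ[ℝ] Lin D) (v : Lin D) :
    linHomotopy g v = g v - koszulLin (g (g v)) := rfl

theorem koszulLin_linHomotopy (g : Lin D →ₗ[ℝ] Lin D) (v : Lin D) :
    koszulLin (linHomotopy g v) = koszulLin (g v) := by
  rw [linHomotopy_apply, map_sub, koszulLin_koszulLin, sub_zero]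

theorem koszulLin_toLin_of_lev {l : Lab D} (hl : l.lev = 0 ∨ l.lev = 5) (k : Multiset (Fin D)) :
    koszulLin (toLin (l.at k)) = 0 := by
  rcases hl with hl | hl
  · have proj_toLin := levProj_toLin l k 0
    rw [if_pos hl] at proj_toLin
    rw [← proj_toLin, koszulLin_levProj_zero]
  · rw [koszulLin_toLin, DerData.der_gen]
    refine (congrArg _ ?_).trans (map_zero _)
    cases l <;> first | rfl | simp [Lab.lev] at hl

namespace IsKoszulInverse

variable {g : Lin D →ₗ[ℝ] Lin D}

theorem levProj_linHomotopy (hg : IsKoszulInverse g) (n : ℕ) (v : Lin D) :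
    levProj (n + 1) (linHomotopy g v) = linHomotopy g (levProj n v) := by
  simp only [linHomotopy_apply, map_sub, hg.levProj_succ, levProj_koszulLin]

theorem lev_eq_of_linHomotopy_toLin_ne_zero (hg : IsKoszulInverse g) {l m : Lab D}
    {k : Multiset (Fin D)} (h : linHomotopy g (toLin (l.at k)) m ≠ 0) : m.lev = l.lev + 1 := by
  have proj_toLin := levProj_toLin l k l.lev
  rw [if_pos rfl] at proj_toLin
  rw [← proj_toLin, ← hg.levProj_linHomotopy, levProj_apply] at h
  exact (ite_ne_right_iff.1 h).1

theorem koszulLin_linHomotopy_twice (hg : IsKoszulInverse g) (v : Lin D) :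
    koszulLin (linHomotopy g (koszulLin (linHomotopy g v))) = koszulLin (linHomotopy g v) := by
  rw [koszulLin_linHomotopy, koszulLin_linHomotopy, hg.koszulLin_comp_koszulLin]

theorem koszulLin_linHomotopy_add (hg : IsKoszulInverse g) (hD : 3 < D) {l : Lab D}
    (lev_ne_zero : l.lev ≠ 0) (lev_ne_five : l.lev ≠ 5) (k : Multiset (Fin D)) :
    koszulLin (linHomotopy g (toLin (l.at k))) + linHomotopy g (koszulLin (toLin (l.at k))) =
      toLin (l.at k) := by
  set v := toLin (l.at k)
  obtain ⟨w, hw⟩ : ∃ w, koszulLin w = v - g (koszulLin v) := by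
    refine koszulLin_exact hD (isSym_iff.2 ?_) ?_ ?_
    · rw [map_sub, hg.young_apply, young_toLin]
    · have proj_zero : levProj 0 (v - g (koszulLin v)) = 0 := by
        rw [map_sub, hg.levProj_zero, levProj_toLin, if_neg lev_ne_zero, sub_zero]
      have proj_five : levProj 5 (v - g (koszulLin v)) = 0 := by
        rw [map_sub, hg.levProj_succ, levProj_koszulLin, levProj_toLin, if_neg lev_ne_five,
          map_zero, map_zero, sub_zero]
      rintro m (hm | hm)
      · simpa [levProj_apply, hm] using congrFun proj_zero m
      · simpa [levProj_apply, hm] using congrFun proj_five m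
    · rw [map_sub, hg.koszulLin_comp_koszulLin, sub_self]
  have section_of_exact : koszulLin (g (v - g (koszulLin v))) = v - g (koszulLin v) := by
    rw [← hw, hg.koszulLin_comp_koszulLin]
  rw [map_sub, map_sub] at section_of_exact
  rw [koszulLin_linHomotopy, linHomotopy_apply]
  linear_combination (exp := 1) section_of_exact

end IsKoszulInverse

/-! ### Operators with positive integer eigenvalues -/

section Eigen

open Polynomial

section Module

variable {k M : Type*} [Field k] [AddCommGroup M] [Module k M]

/-- The span of the eigenvectors of `L` with integer eigenvalues at least `n`. -/
def eigenSpan (L : Module.End k M) (n : ℕ) : Submodule k M :=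
  Submodule.span k {a | ∃ m : ℕ, n ≤ m ∧ L a = (m : k) • a}

theorem mem_eigenSpan {L : Module.End k M} {n m : ℕ} (h : n ≤ m) {a : M}
    (ha : L a = (m : k) • a) : a ∈ eigenSpan L n :=
  Submodule.subset_span ⟨m, h, ha⟩

theorem eigenSpan_antitone (L : Module.End k M) : Antitone (eigenSpan L) := fun _ _ h =>
  Submodule.span_mono fun _ ⟨m, hm, ha⟩ => ⟨m, h.trans hm, ha⟩

theorem exists_aeval_one_sub_X_mul_eq_zero [CharZero k] (L : Module.End k M) {x : M}
    (hx : x ∈ eigenSpan L 1) : ∃ f : k[X], aeval L (1 - X * f) x = 0 := by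
  induction hx using Submodule.span_induction with
  | mem a ha =>
    obtain ⟨n, hn, ha⟩ := ha
    have n_ne_zero : (n : k) ≠ 0 := Nat.cast_ne_zero.2 (Nat.one_le_iff_ne_zero.1 hn)
    refine ⟨C (n : k)⁻¹, ?_⟩
    simp [ha, n_ne_zero]
  | zero => exact ⟨0, map_zero _⟩
  | add a b _ _ ha hb =>
    obtain ⟨f, hf⟩ := ha
    obtain ⟨h, hh⟩ := hb
    refine ⟨f + h - X * f * h, ?_⟩
    have factor : (1 - X * (f + h - X * f * h) : k[X]) = (1 - X * f) * (1 - X * h) := by ring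
    rw [map_add, factor, map_mul, Module.End.mul_apply, Module.End.mul_apply, hh, map_zero,
      add_zero, ← Module.End.mul_apply, ← map_mul, mul_comm, map_mul, Module.End.mul_apply, hf,
      map_zero]
  | smul c a _ ha =>
    obtain ⟨f, hf⟩ := ha
    exact ⟨f, by rw [map_smul, hf, smul_zero]⟩

theorem exists_aeval_right_inverse [CharZero k] (L : Module.End k M) {x : M}
    (hx : x ∈ eigenSpan L 1) : ∃ f : k[X], L (aeval L f x) = x := by
  obtain ⟨f, hf⟩ := exists_aeval_one_sub_X_mul_eq_zero L hx
  rw [map_sub, map_one, map_mul, aeval_X, LinearMap.sub_apply, sub_eq_zero] at hf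
  exact ⟨f, hf.symm⟩

theorem aeval_mem {L : Module.End k M} {S : Submodule k M} (h : ∀ x ∈ S, L x ∈ S)
    (f : k[X]) {x : M} (hx : x ∈ S) : aeval L f x ∈ S := by
  induction f using Polynomial.induction_on' with
  | add f g hf hg => rw [map_add]; exact add_mem hf hg
  | monomial n c =>
    rw [aeval_monomial, Module.End.mul_apply, Module.algebraMap_end_apply]
    refine Submodule.smul_mem _ _ ?_
    induction n with
    | zero => simpa
    | succ n ih => rw [pow_succ', Module.End.mul_apply]; exact h _ ih

theorem aeval_comm {L T : Module.End k M} (h : ∀ x, T (L x) = L (T x)) (f : k[X]) (x : M) :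
    T (aeval L f x) = aeval L f (T x) :=
  LinearMap.congr_fun (Algebra.commute_of_mem_adjoin_singleton_of_commute
    (aeval_mem_adjoin_singleton k L) (LinearMap.ext h : Commute T L)).eq x

theorem tmul_mem_eigenSpan {N : Type*} [AddCommGroup N] [Module k N] {L : Module.End k M} (f : N)
    {n : ℕ} {a : M} (ha : a ∈ eigenSpan L n) : f ⊗ₜ[k] a ∈ eigenSpan (L.lTensor N) n := by
  refine (Submodule.span_le (p := (eigenSpan (L.lTensor N) n).comap (TensorProduct.mk k N M f))).2
    ?_ ha
  rintro a ⟨m, hm, ha⟩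
  refine mem_eigenSpan hm ?_
  rw [TensorProduct.mk_apply, LinearMap.lTensor_tmul, ha, TensorProduct.tmul_smul]

end Module

section Algebra

variable {k A : Type*} [Field k] [Ring A] [Algebra k A] {L : Module.End k A}

theorem one_mem_eigenSpan (leibniz : ∀ a b, L (a * b) = L a * b + a * L b) :
    1 ∈ eigenSpan L 0 := by
  have map_one_add : L 1 = L 1 + L 1 := by simpa using leibniz 1 1
  exact mem_eigenSpan le_rfl (by simpa using map_one_add)

theorem mul_mem_eigenSpan (leibniz : ∀ a b, L (a * b) = L a * b + a * L b) {i j : ℕ} {a b : A}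
    (ha : a ∈ eigenSpan L i) (hb : b ∈ eigenSpan L j) : a * b ∈ eigenSpan L (i + j) := by
  induction ha, hb using Submodule.span_induction₂ with
  | mem_mem a b ha hb =>
    obtain ⟨m, hm, ha⟩ := ha
    obtain ⟨n, hn, hb⟩ := hb
    refine mem_eigenSpan (Nat.add_le_add hm hn) ?_
    rw [leibniz, ha, hb, smul_mul_assoc, mul_smul_comm, ← add_smul, Nat.cast_add]
  | zero_left b _ => simp only [zero_mul, zero_mem]
  | zero_right a _ => simp only [mul_zero, zero_mem]
  | add_left a a' b _ _ _ ha ha' => rw [add_mul]; exact add_mem ha ha'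
  | add_right a b b' _ _ _ hb hb' => rw [mul_add]; exact add_mem hb hb'
  | smul_left c a b _ _ h => rw [smul_mul_assoc]; exact Submodule.smul_mem _ _ h
  | smul_right c a b _ _ h => rw [mul_smul_comm]; exact Submodule.smul_mem _ _ h

theorem list_prod_mem_eigenSpan (leibniz : ∀ a b, L (a * b) = L a * b + a * L b) {s : List A}
    (hs : ∀ a ∈ s, a ∈ eigenSpan L 0) : s.prod ∈ eigenSpan L 0 := by
  induction s with
  | nil => exact one_mem_eigenSpan leibniz
  | cons a s ih =>
    rw [List.forall_mem_cons] at hs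
    simpa only [List.prod_cons, add_zero] using mul_mem_eigenSpan leibniz hs.1 (ih hs.2)

theorem list_prod_mem_eigenSpan_one (leibniz : ∀ a b, L (a * b) = L a * b + a * L b) {s : List A}
    (hs : ∀ a ∈ s, a ∈ eigenSpan L 0) {a : A} (mem : a ∈ s) (ha : a ∈ eigenSpan L 1) :
    s.prod ∈ eigenSpan L 1 := by
  obtain ⟨s, t, rfl⟩ := List.append_of_mem mem
  simp only [List.forall_mem_append, List.forall_mem_cons] at hs
  have prod_mem := mul_mem_eigenSpan leibniz (list_prod_mem_eigenSpan leibniz hs.1)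
    (mul_mem_eigenSpan leibniz ha (list_prod_mem_eigenSpan leibniz hs.2.2))
  rwa [← List.prod_cons, ← List.prod_append] at prod_mem

end Algebra

end Eigen

/-! ### A contracting homotopy on the algebra -/

theorem toAlg_induction {p : Alg D → Prop} {v : Lin D} (zero : p 0)
    (add : ∀ a b, p a → p b → p (a + b)) (smul : ∀ (c : ℝ) a, p a → p (c • a))
    (gen : ∀ l k, v l ≠ 0 → p (gen (l.at k))) : p (toAlg v) := by
  rw [toAlg_apply]
  refine Finset.sum_induction _ p add zero fun l _ => ?_
  by_cases hl : v l = 0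
  · rwa [hl, map_zero]
  · generalize v l = r
    induction r using op_induction with
    | mono k => rw [genOp_mono]; exact gen l k hl
    | add r s hr hs => rw [map_add]; exact add _ _ hr hs
    | smul c r hr => rw [map_smul]; exact smul c _ hr

theorem Lab.lev_ne_of_antigh_ne_zero {l : Lab D} (h : l.antigh ≠ 0) : l.lev ≠ 0 ∧ l.lev ≠ 5 := by
  cases l <;> simp_all [Lab.antigh, Lab.lev, Lab.at, Gen.antigh]

namespace IsKoszulInverse

variable {g : Lin D →ₗ[ℝ] Lin D}

theorem toAlg_linHomotopy_induction (hg : IsKoszulInverse g) {p : Alg D → Prop} (z : Gen D)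
    (zero : p 0) (add : ∀ a b, p a → p b → p (a + b)) (smul : ∀ (c : ℝ) a, p a → p (c • a))
    (gen : ∀ (l m : Lab D) k k', z = l.at k → m.lev = l.lev + 1 → p (gen (m.at k'))) :
    p (toAlg (linHomotopy g (toLin z))) := by
  rcases z.eq_dx_or_at with ⟨ν, rfl⟩ | ⟨l, k, rfl⟩
  · simpa [toLin] using zero
  · exact toAlg_induction zero add smul fun m k' hm =>
      gen l m k k' rfl (hg.lev_eq_of_linHomotopy_toLin_ne_zero hm)

theorem superComm_toAlg_linHomotopy (hg : IsKoszulInverse g) (z : Gen D) :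
    SuperComm (z.parity + 1) (toAlg (linHomotopy g (toLin z))) := by
  refine hg.toAlg_linHomotopy_induction z (.zero _) (fun _ _ => .add) (fun c _ => .smul c) ?_
  rintro l m k k' rfl hm
  refine (superComm_gen _).congr ?_
  rw [parity_at, parity_at]
  exact Lab.parity_add_one_of_lev hm

/-- The odd derivation of the algebra which extends the homotopy `linHomotopy g` of the linear
forms. -/
def homotopy (hg : IsKoszulInverse g) : DerData D 1 where
  val z := toAlg (linHomotopy g (toLin z))
  superComm := hg.superComm_toAlg_linHomotopy
  lin v hv := by
    have apply_linearCombination :=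
      Finsupp.apply_linearCombination ℝ (toAlg ∘ₗ linHomotopy g) toLin v
    rw [linearCombination_toLin hv, map_zero] at apply_linearCombination
    exact apply_linearCombination.symm

theorem homotopy_gen (hg : IsKoszulInverse g) (z : Gen D) :
    hg.homotopy.der (gen z) = toAlg (linHomotopy g (toLin z)) := hg.homotopy.der_gen z

theorem homotopy_toAlg (hg : IsKoszulInverse g) (v : Lin D) :
    hg.homotopy.der (toAlg v) = toAlg (linHomotopy g (young v)) := by
  induction v using lin_induction with
  | zero => simp
  | single l k => rw [toAlg_single, genOp_mono, homotopy_gen, toLin_at]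
  | add v w hv hw => simp only [map_add, hv, hw]
  | smul c v hv => simp only [map_smul, hv]

theorem hasParity_homotopy_gen (hg : IsKoszulInverse g) (z : Gen D) :
    HasParity (z.parity + 1) (hg.homotopy.der (gen z)) := by
  rw [homotopy_gen]
  refine hg.toAlg_linHomotopy_induction z (.zero _) (fun _ _ => .add) (fun c _ => .smul c) ?_
  rintro l m k k' rfl hm
  refine (HasParity.gen _).congr ?_
  rw [parity_at, parity_at]
  exact Lab.parity_add_one_of_lev hm

theorem homotopy_mem_algForms (hg : IsKoszulInverse g) {p q : ℤ} {a : Alg D}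
    (ha : a ∈ algForms D p q) : hg.homotopy.der a ∈ algForms D p (q + 1) := by
  have mem := hg.homotopy.isDer.mem_algForms (dp := 0) (dq := 1) (fun z => ?_) ha
  · simpa using mem
  rw [homotopy_gen]
  refine hg.toAlg_linHomotopy_induction z (zero_mem _) (fun _ _ => add_mem)
    (fun c _ => Submodule.smul_mem _ c) ?_
  rintro l m k k' rfl hm
  have mem_gen := gen_mem_algForms (m.at k')
  rw [formDeg_at, antigh_at, Lab.antigh_add_one_of_lev hm] at mem_gen
  simpa using mem_gen

/-- The anticommutator of the Koszul–Tate differential and the homotopy. -/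
def laplacian (hg : IsKoszulInverse g) : Module.End ℝ (Alg D) :=
  koszulData.der ∘ₗ hg.homotopy.der + hg.homotopy.der ∘ₗ koszulData.der

theorem laplacian_mul (hg : IsKoszulInverse g) (a b : Alg D) :
    hg.laplacian (a * b) = hg.laplacian a * b + a * hg.laplacian b := by
  have isDer_bracket := koszulData.isDer.bracket hg.homotopy.isDer hasParity_koszul_gen
    hg.hasParity_homotopy_gen
  have bracket_eq : koszulData.der ∘ₗ hg.homotopy.der -
      (-1 : ℝ) ^ (1 * 1) • hg.homotopy.der ∘ₗ koszulData.der = hg.laplacian := by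
    ext x
    simp [laplacian]
  rw [bracket_eq] at isDer_bracket
  simpa only [paritySign_of_even (Even.add_self 1), AlgHom.id_apply] using isDer_bracket.mul a b

theorem laplacian_toAlg (hg : IsKoszulInverse g) {v : Lin D} (hv : young v = v) :
    hg.laplacian (toAlg v) =
      toAlg (koszulLin (linHomotopy g v) + linHomotopy g (koszulLin v)) := by
  rw [laplacian, LinearMap.add_apply, LinearMap.comp_apply, LinearMap.comp_apply, homotopy_toAlg,
    hv, ← toAlg_koszulLin, ← toAlg_koszulLin, homotopy_toAlg, young_koszulLin, map_add]

theorem laplacian_gen_at (hg : IsKoszulInverse g) (hD : 3 < D) {l : Lab D}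
    (lev_ne_zero : l.lev ≠ 0) (lev_ne_five : l.lev ≠ 5) (k : Multiset (Fin D)) :
    hg.laplacian (gen (l.at k)) = gen (l.at k) := by
  rw [← toAlg_toLin_at, hg.laplacian_toAlg (young_toLin _),
    hg.koszulLin_linHomotopy_add hD lev_ne_zero lev_ne_five]

/-- The exact part of a variable of level `0` or `5` has eigenvalue `1`, the remainder `0`. -/
theorem gen_at_mem_eigenSpan_of_lev (hg : IsKoszulInverse g) {l : Lab D}
    (hl : l.lev = 0 ∨ l.lev = 5) (k : Multiset (Fin D)) :
    gen (l.at k) ∈ eigenSpan hg.laplacian 0 := by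
  set c := toLin (l.at k)
  set e := toAlg (koszulLin (linHomotopy g c))
  have laplacian_gen : hg.laplacian (gen (l.at k)) = e := by
    rw [← toAlg_toLin_at, hg.laplacian_toAlg (young_toLin _), koszulLin_toLin_of_lev hl, map_zero,
      add_zero]
  have laplacian_e : hg.laplacian e = e := by
    rw [hg.laplacian_toAlg (young_koszulLin _), hg.koszulLin_linHomotopy_twice,
      koszulLin_koszulLin, map_zero, add_zero]
  rw [← sub_add_cancel (gen (l.at k)) e]
  refine add_mem (mem_eigenSpan le_rfl ?_) (mem_eigenSpan zero_le_one ?_)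
  · rw [map_sub, laplacian_gen, laplacian_e, sub_self, Nat.cast_zero, zero_smul]
  · rw [laplacian_e, Nat.cast_one, one_smul]

theorem gen_mem_eigenSpan_one (hg : IsKoszulInverse g) (hD : 3 < D) {z : Gen D}
    (hz : z.antigh ≠ 0) : gen z ∈ eigenSpan hg.laplacian 1 := by
  rcases z.eq_dx_or_at with ⟨ν, rfl⟩ | ⟨l, k, rfl⟩
  · exact absurd rfl hz
  · rw [antigh_at] at hz
    obtain ⟨lev_ne_zero, lev_ne_five⟩ := Lab.lev_ne_of_antigh_ne_zero hz
    refine mem_eigenSpan le_rfl ?_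
    rw [hg.laplacian_gen_at hD lev_ne_zero lev_ne_five, Nat.cast_one, one_smul]

theorem gen_mem_eigenSpan_zero (hg : IsKoszulInverse g) (hD : 3 < D) (z : Gen D) :
    gen z ∈ eigenSpan hg.laplacian 0 := by
  by_cases hz : z.antigh = 0
  · rcases z.eq_dx_or_at with ⟨ν, rfl⟩ | ⟨l, k, rfl⟩
    · refine mem_eigenSpan le_rfl ?_
      rw [laplacian, LinearMap.add_apply, LinearMap.comp_apply, LinearMap.comp_apply, homotopy_gen,
        koszul_gen_dx]
      simp [toLin]
    · by_cases hl : l.lev = 0 ∨ l.lev = 5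
      · exact hg.gen_at_mem_eigenSpan_of_lev hl k
      · push Not at hl
        refine mem_eigenSpan zero_le_one ?_
        rw [hg.laplacian_gen_at hD hl.1 hl.2, Nat.cast_one, one_smul]
  · exact eigenSpan_antitone _ zero_le_one (hg.gen_mem_eigenSpan_one hD hz)

end IsKoszulInverse

/-! ### Operators on local forms -/

variable {K : CoeffClass D}

theorem tmul_mem_forms (f : K.Fn) {p q : ℤ} {a : Alg D} (ha : a ∈ algForms D p q) :
    f ⊗ₜ[ℝ] a ∈ forms K p q := by
  induction ha using Submodule.span_induction with
  | mem a ha =>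
    obtain ⟨l, formDeg_sum, antigh_sum, rfl⟩ := ha
    exact Submodule.subset_span ⟨f, l, formDeg_sum, antigh_sum, rfl⟩
  | zero => rw [TensorProduct.tmul_zero]; exact zero_mem _
  | add a b _ _ ha hb => rw [TensorProduct.tmul_add]; exact add_mem ha hb
  | smul c a _ ha => rw [TensorProduct.tmul_smul]; exact Submodule.smul_mem _ _ ha

theorem forms_le {p q : ℤ} {S : Submodule ℝ (LocalForm K)}
    (h : ∀ f, ∀ a ∈ algForms D p q, f ⊗ₜ[ℝ] a ∈ S) : forms K p q ≤ S :=
  Submodule.span_le.2 <| by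
    rintro _ ⟨f, l, formDeg_sum, antigh_sum, rfl⟩
    exact h f _ (Submodule.subset_span ⟨l, formDeg_sum, antigh_sum, rfl⟩)

theorem lTensor_mem_forms {X : Alg D →ₗ[ℝ] Alg D} {p q p' q' : ℤ}
    (h : ∀ a ∈ algForms D p q, X a ∈ algForms D p' q') {b : LocalForm K} (hb : b ∈ forms K p q) :
    X.lTensor K.Fn b ∈ forms K p' q' := by
  refine forms_le (S := (forms K p' q').comap (X.lTensor K.Fn)) (fun f a ha => ?_) hb
  exact tmul_mem_forms f (h a ha)

theorem δ_tmul (f : K.Fn) (a : Alg D) : δ K (f ⊗ₜ[ℝ] a) = f ⊗ₜ[ℝ] koszulData.der a := rfl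

theorem totalDeriv_tmul (μ : Fin D) (f : K.Fn) (a : Alg D) :
    totalDeriv K μ (f ⊗ₜ[ℝ] a) = K.pd μ f ⊗ₜ[ℝ] a + f ⊗ₜ[ℝ] (partialData μ).der a := rfl

theorem δ_mem_forms {p q : ℤ} {b : LocalForm K} (hb : b ∈ forms K p q) :
    δ K b ∈ forms K p (q - 1) := lTensor_mem_forms (fun _ => koszul_mem_algForms) hb

theorem totalDeriv_mem_forms (μ : Fin D) {p q : ℤ} {b : LocalForm K} (hb : b ∈ forms K p q) :
    totalDeriv K μ b ∈ forms K p q := by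
  refine forms_le (S := (forms K p q).comap (totalDeriv K μ)) (fun f a ha => ?_) hb
  rw [Submodule.mem_comap, totalDeriv_tmul]
  exact add_mem (tmul_mem_forms _ ha) (tmul_mem_forms _ (partial_mem_algForms μ ha))

theorem δ_δ (b : LocalForm K) : δ K (δ K b) = 0 := by
  induction b using TensorProduct.induction_on with
  | zero => simp
  | tmul f a => rw [δ_tmul, δ_tmul, koszul_koszul, TensorProduct.tmul_zero]
  | add b c hb hc => rw [map_add, map_add, hb, hc, add_zero]

theorem lTensor_totalDeriv {X : Alg D →ₗ[ℝ] Alg D} {μ : Fin D}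
    (h : ∀ a, X ((partialData μ).der a) = (partialData μ).der (X a)) (b : LocalForm K) :
    X.lTensor K.Fn (totalDeriv K μ b) = totalDeriv K μ (X.lTensor K.Fn b) := by
  induction b using TensorProduct.induction_on with
  | zero => simp
  | tmul f a =>
    rw [totalDeriv_tmul, map_add, LinearMap.lTensor_tmul, LinearMap.lTensor_tmul,
      LinearMap.lTensor_tmul, totalDeriv_tmul, h]
  | add b c hb hc => rw [map_add, map_add, hb, hc, map_add, map_add]

theorem δ_totalDeriv (μ : Fin D) (b : LocalForm K) :
    δ K (totalDeriv K μ b) = totalDeriv K μ (δ K b) := lTensor_totalDeriv (koszul_partial μ) b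

theorem pd_comm (μ ν : Fin D) (f : K.Fn) : K.pd μ (K.pd ν f) = K.pd ν (K.pd μ f) := by
  have smooth : ContDiff ℝ ∞ f.1 := K.smooth f.1 f.2
  have differentiable_fderiv : Differentiable ℝ (fderiv ℝ f.1) :=
    (smooth.fderiv_right (m := ∞) (by simp)).differentiable (by simp)
  have fderiv_fderiv_apply (v w x : Fin D → ℝ) :
      fderiv ℝ (fun y => fderiv ℝ f.1 y v) x w = fderiv ℝ (fderiv ℝ f.1) x w v := by
    rw [fderiv_clm_apply (differentiable_fderiv x) (differentiableAt_const v)]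
    simp
  refine Subtype.ext (funext fun x => ?_)
  change fderiv ℝ (fun y => fderiv ℝ f.1 y (Pi.single ν 1)) x (Pi.single μ 1) =
    fderiv ℝ (fun y => fderiv ℝ f.1 y (Pi.single μ 1)) x (Pi.single ν 1)
  rw [fderiv_fderiv_apply, fderiv_fderiv_apply]
  exact (smooth.contDiffAt.isSymmSndFDerivAt (by simpa using ENat.LEInfty.out)) _ _

theorem totalDeriv_comm (μ ν : Fin D) (b : LocalForm K) :
    totalDeriv K μ (totalDeriv K ν b) = totalDeriv K ν (totalDeriv K μ b) := by
  induction b using TensorProduct.induction_on with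
  | zero => simp
  | tmul f a =>
    simp only [totalDeriv_tmul, map_add]
    rw [pd_comm μ ν, partial_comm μ ν]
    abel
  | add b c hb hc => rw [map_add, map_add, hb, hc, map_add, map_add]

/-- Left multiplication by an element of `Alg D`. -/
def mulL (K : CoeffClass D) : Alg D →ₗ[ℝ] LocalForm K →ₗ[ℝ] LocalForm K :=
  LinearMap.lTensorHom K.Fn ∘ₗ LinearMap.mul ℝ (Alg D)

theorem mulL_tmul (u : Alg D) (f : K.Fn) (a : Alg D) :
    mulL K u (f ⊗ₜ[ℝ] a) = f ⊗ₜ[ℝ] (u * a) := rfl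

theorem mulL_mem_forms {u : Alg D} {p q p' q' : ℤ} (hu : u ∈ algForms D p q) {b : LocalForm K}
    (hb : b ∈ forms K p' q') : mulL K u b ∈ forms K (p + p') (q + q') :=
  lTensor_mem_forms (fun _ ha => mul_mem_algForms hu ha) hb

theorem totalDeriv_mulL (μ : Fin D) (u : Alg D) (b : LocalForm K) :
    totalDeriv K μ (mulL K u b) =
      mulL K ((partialData μ).der u) b + mulL K u (totalDeriv K μ b) := by
  induction b using TensorProduct.induction_on with
  | zero => simp
  | tmul f a =>
    have leibniz := (partialData μ).isDer.mul u a
    rw [paritySign_of_even Even.zero] at leibniz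
    simp only [totalDeriv_tmul, mulL_tmul, map_add, leibniz, TensorProduct.tmul_add,
      AlgHom.id_apply]
    abel
  | add b c hb hc => simp only [map_add, hb, hc]; abel

theorem δ_mulL_gen (g : Gen D) (b : LocalForm K) : δ K (mulL K (gen g) b) =
    mulL K (koszulData.der (gen g)) b + (-1 : ℝ) ^ g.parity • mulL K (gen g) (δ K b) := by
  induction b using TensorProduct.induction_on with
  | zero => simp
  | tmul f a =>
    rw [mulL_tmul, δ_tmul, koszulData.isDer.apply_gen_mul, δ_tmul, mulL_tmul, mulL_tmul, one_mul,
      TensorProduct.tmul_add, TensorProduct.tmul_smul]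
  | add b c hb hc => simp only [map_add, hb, hc, smul_add]; abel

theorem algForms_le_eigenSpan {L : Module.End ℝ (Alg D)}
    (leibniz : ∀ a b, L (a * b) = L a * b + a * L b) (gen_mem : ∀ g, gen g ∈ eigenSpan L 0)
    (gen_mem_one : ∀ g : Gen D, g.antigh ≠ 0 → gen g ∈ eigenSpan L 1) {p q : ℤ} (hq : q ≠ 0) :
    algForms D p q ≤ eigenSpan L 1 := by
  refine Submodule.span_le.2 ?_
  rintro _ ⟨l, -, antigh_sum, rfl⟩
  obtain ⟨g, hg, antigh_ne_zero⟩ : ∃ g ∈ l, g.antigh ≠ 0 := by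
    contrapose! hq
    rw [← antigh_sum]
    exact List.sum_eq_zero (List.forall_mem_map.2 hq)
  exact list_prod_mem_eigenSpan_one leibniz (List.forall_mem_map.2 fun g _ => gen_mem g)
    (List.mem_map_of_mem hg) (gen_mem_one g antigh_ne_zero)

theorem forms_le_eigenSpan {L : Module.End ℝ (Alg D)}
    (leibniz : ∀ a b, L (a * b) = L a * b + a * L b) (gen_mem : ∀ g, gen g ∈ eigenSpan L 0)
    (gen_mem_one : ∀ g : Gen D, g.antigh ≠ 0 → gen g ∈ eigenSpan L 1) {p q : ℤ} (hq : q ≠ 0) :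
    forms K p q ≤ eigenSpan (L.lTensor K.Fn) 1 :=
  forms_le fun f _ ha =>
    tmul_mem_eigenSpan f (algForms_le_eigenSpan leibniz gen_mem gen_mem_one hq ha)

theorem IsKoszulInverse.lTensor_laplacian {g : Lin D →ₗ[ℝ] Lin D} (hg : IsKoszulInverse g)
    (b : LocalForm K) : hg.laplacian.lTensor K.Fn b =
      δ K (hg.homotopy.der.lTensor K.Fn b) + hg.homotopy.der.lTensor K.Fn (δ K b) := by
  simp only [laplacian, LinearMap.lTensor_add, LinearMap.lTensor_comp]
  rfl

theorem exists_δ_eq (hD : 3 < D) {p q : ℤ} (hq : q ≠ 0) {x : LocalForm K} (hx : x ∈ forms K p q)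
    (closed : δ K x = 0) : ∃ y ∈ forms K p (q + 1), δ K y = x := by
  obtain ⟨g, hg⟩ := exists_isKoszulInverse (D := D)
  let L : Module.End ℝ (LocalForm K) := hg.laplacian.lTensor K.Fn
  let s : LocalForm K →ₗ[ℝ] LocalForm K := hg.homotopy.der.lTensor K.Fn
  have L_apply (b) : L b = δ K (s b) + s (δ K b) := hg.lTensor_laplacian b
  have s_mem {p q : ℤ} {b : LocalForm K} (hb : b ∈ forms K p q) : s b ∈ forms K p (q + 1) :=
    lTensor_mem_forms (fun _ => hg.homotopy_mem_algForms) hb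
  have δ_L (b) : δ K (L b) = L (δ K b) := by
    rw [L_apply, L_apply, map_add, δ_δ, δ_δ, map_zero, zero_add, add_zero]
  have L_mem (b) (hb : b ∈ forms K p q) : L b ∈ forms K p q := by
    rw [L_apply]
    refine add_mem ?_ ?_
    · simpa only [add_sub_cancel_right] using δ_mem_forms (s_mem hb)
    · simpa only [sub_add_cancel] using s_mem (δ_mem_forms hb)
  obtain ⟨f, hf⟩ := exists_aeval_right_inverse L <| forms_le_eigenSpan hg.laplacian_mul
    (hg.gen_mem_eigenSpan_zero hD) (fun _ => hg.gen_mem_eigenSpan_one hD) hq hx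
  have δ_aeval : δ K (Polynomial.aeval L f x) = 0 := by
    rw [aeval_comm (T := δ K) δ_L, closed, map_zero]
  refine ⟨s (Polynomial.aeval L f x), s_mem (aeval_mem L_mem f hx), ?_⟩
  rw [L_apply, δ_aeval, map_zero, add_zero] at hf
  exact hf

/-! ### Differential operators acting on local forms -/

open scoped IsMulCommutative in
theorem exists_algHom_of_commute {R ι A : Type*} [CommRing R] [Ring A] [Algebra R A] (f : ι → A)
    (commute : ∀ i j, f i * f j = f j * f i) :
    ∃ ρ : MvPolynomial ι R →ₐ[R] A, ∀ i, ρ (MvPolynomial.X i) = f i := by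
  let S := Algebra.adjoin R (Set.range f)
  have : IsMulCommutative S := Algebra.isMulCommutative_adjoin R (by
    rintro _ ⟨i, rfl⟩ _ ⟨j, rfl⟩
    exact commute i j)
  let generator (i : ι) : S := ⟨f i, Algebra.subset_adjoin ⟨i, rfl⟩⟩
  refine ⟨S.val.comp (MvPolynomial.aeval generator), fun i => ?_⟩
  rw [AlgHom.comp_apply, MvPolynomial.aeval_X]
  rfl

theorem exists_opAct (K : CoeffClass D) : ∃ ρ : Op D →ₐ[ℝ] Module.End ℝ (LocalForm K),
    ∀ μ, ρ (MvPolynomial.X μ) = -totalDeriv K μ :=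
  exists_algHom_of_commute (A := Module.End ℝ (LocalForm K)) (fun μ => -totalDeriv K μ)
    fun μ ν => LinearMap.ext fun b => by
      simpa only [Module.End.mul_apply, LinearMap.neg_apply, map_neg, neg_neg] using
        totalDeriv_comm μ ν b

/-- The formal adjoint `r(-∂)` of a differential operator `r(∂)`. -/
def opAct (K : CoeffClass D) : Op D →ₐ[ℝ] Module.End ℝ (LocalForm K) := (exists_opAct K).choose

theorem opAct_X (μ : Fin D) (b : LocalForm K) :
    opAct K (MvPolynomial.X μ) b = -totalDeriv K μ b := by
  rw [opAct, (exists_opAct K).choose_spec μ]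
  rfl

theorem opAct_C (c : ℝ) (b : LocalForm K) : opAct K (MvPolynomial.C c) b = c • b := by
  rw [← MvPolynomial.algebraMap_eq, AlgHom.commutes, Module.algebraMap_end_apply]

theorem opAct_mul (r s : Op D) (b : LocalForm K) : opAct K (r * s) b = opAct K r (opAct K s b) := by
  rw [map_mul, Module.End.mul_apply]

theorem opAct_comm {X : LocalForm K →ₗ[ℝ] LocalForm K}
    (h : ∀ μ b, X (totalDeriv K μ b) = totalDeriv K μ (X b)) (r : Op D) (b : LocalForm K) :
    X (opAct K r b) = opAct K r (X b) := by
  induction r using MvPolynomial.induction_on generalizing b with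
  | C c => rw [opAct_C, opAct_C, map_smul]
  | add r s hr hs => rw [map_add, LinearMap.add_apply, map_add, hr, hs, LinearMap.add_apply]
  | mul_X r μ hr => rw [opAct_mul, opAct_mul, hr, opAct_X, opAct_X, map_neg, h]

theorem opAct_mem_forms (r : Op D) {p q : ℤ} {b : LocalForm K} (hb : b ∈ forms K p q) :
    opAct K r b ∈ forms K p q := by
  induction r using MvPolynomial.induction_on generalizing b with
  | C c => rw [opAct_C]; exact Submodule.smul_mem _ _ hb
  | add r s hr hs => rw [map_add, LinearMap.add_apply]; exact add_mem (hr hb) (hs hb)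
  | mul_X r μ hr => rw [opAct_mul, opAct_X]; exact hr (neg_mem (totalDeriv_mem_forms μ hb))

/-! ### Euler–Lagrange derivatives -/

/-- The map `f ⊗ (r ⊗ a) ↦ r(-∂) (f ⊗ a)`. -/
def contract (K : CoeffClass D) : K.Fn ⊗[ℝ] (Op D ⊗[ℝ] Alg D) →ₗ[ℝ] LocalForm K :=
  TensorProduct.lift (opAct K).toLinearMap ∘ₗ
    (TensorProduct.leftComm ℝ K.Fn (Op D) (Alg D)).toLinearMap

theorem contract_tmul (f : K.Fn) (r : Op D) (a : Alg D) :
    contract K (f ⊗ₜ[ℝ] (r ⊗ₜ[ℝ] a)) = opAct K r (f ⊗ₜ[ℝ] a) := rfl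

theorem contract_coeff_mul (f : K.Fn) (r : Op D) (x : Op D ⊗[ℝ] Alg D) :
    contract K (f ⊗ₜ[ℝ] ((r ⊗ₜ[ℝ] 1) * x)) = opAct K r (contract K (f ⊗ₜ[ℝ] x)) := by
  induction x using TensorProduct.induction_on with
  | zero => simp
  | tmul s a =>
    rw [Algebra.TensorProduct.tmul_mul_tmul, one_mul, contract_tmul, contract_tmul, opAct_mul]
  | add x y hx hy =>
    rw [mul_add, TensorProduct.tmul_add, map_add, hx, hy, TensorProduct.tmul_add, map_add, map_add]

theorem contract_koszul (f : K.Fn) (x : Op D ⊗[ℝ] Alg D) :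
    contract K (f ⊗ₜ[ℝ] koszulData.der.lTensor (Op D) x) = δ K (contract K (f ⊗ₜ[ℝ] x)) := by
  induction x using TensorProduct.induction_on with
  | zero => simp
  | tmul s a =>
    rw [LinearMap.lTensor_tmul, contract_tmul, contract_tmul, opAct_comm δ_totalDeriv, δ_tmul]
  | add x y hx hy =>
    rw [map_add, TensorProduct.tmul_add, map_add, hx, hy, TensorProduct.tmul_add, map_add, map_add]

theorem contract_partial (μ : Fin D) (f : K.Fn) (x : Op D ⊗[ℝ] Alg D) :
    contract K (K.pd μ f ⊗ₜ[ℝ] x) + contract K (f ⊗ₜ[ℝ] (partialData μ).der.lTensor (Op D) x) =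
      totalDeriv K μ (contract K (f ⊗ₜ[ℝ] x)) := by
  induction x using TensorProduct.induction_on with
  | zero => simp
  | tmul s a =>
    rw [LinearMap.lTensor_tmul, contract_tmul, contract_tmul, contract_tmul,
      opAct_comm (totalDeriv_comm μ), totalDeriv_tmul, map_add]
  | add x y hx hy =>
    simp only [map_add, TensorProduct.tmul_add, ← hx, ← hy]
    abel

/-- The Euler–Lagrange derivative with respect to the variable with label `l`. -/
def eulerLagrange (K : CoeffClass D) (l : Lab D) : LocalForm K →ₗ[ℝ] LocalForm K :=
  contract K ∘ₗ (frechet l).lTensor K.Fn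

theorem eulerLagrange_tmul (l : Lab D) (f : K.Fn) (a : Alg D) :
    eulerLagrange K l (f ⊗ₜ[ℝ] a) = contract K (f ⊗ₜ[ℝ] frechet l a) := rfl

theorem eulerLagrange_totalDeriv (l : Lab D) (μ : Fin D) (b : LocalForm K) :
    eulerLagrange K l (totalDeriv K μ b) = 0 := by
  induction b using TensorProduct.induction_on with
  | zero => simp
  | tmul f a =>
    rw [totalDeriv_tmul, map_add, eulerLagrange_tmul, eulerLagrange_tmul, frechet_partial,
      TensorProduct.tmul_add, map_add, ← add_assoc, contract_partial, contract_coeff_mul, opAct_X,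
      add_neg_cancel]
  | add b c hb hc => rw [map_add, map_add, hb, hc, add_zero]

/-- The differential induced by `δ` on families of Euler–Lagrange derivatives. -/
def dualKoszul (K : CoeffClass D) : (Lab D → LocalForm K) →ₗ[ℝ] Lab D → LocalForm K :=
  LinearMap.pi fun l => (-1 : ℝ) ^ l.parity • δ K ∘ₗ LinearMap.proj l +
    ∑ m, opAct K (koszulMat l m) ∘ₗ LinearMap.proj m

theorem dualKoszul_apply (x : Lab D → LocalForm K) (l : Lab D) : dualKoszul K x l =
    (-1 : ℝ) ^ l.parity • δ K (x l) + ∑ m, opAct K (koszulMat l m) (x m) := by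
  simp [dualKoszul]

theorem eulerLagrange_δ (l : Lab D) (b : LocalForm K) :
    eulerLagrange K l (δ K b) = dualKoszul K (fun m => eulerLagrange K m b) l := by
  rw [dualKoszul_apply]
  induction b using TensorProduct.induction_on with
  | zero => simp
  | tmul f a =>
    simp only [δ_tmul, eulerLagrange_tmul, frechet_koszul, TensorProduct.tmul_add,
      TensorProduct.tmul_smul, TensorProduct.tmul_sum, map_add, map_smul, map_sum,
      contract_coeff_mul, contract_koszul]
  | add b c hb hc =>
    simp only [map_add, hb, hc, smul_add, Finset.sum_add_distrib]
    abel

theorem sum_koszulMat_mul (l n : Lab D) : ∑ m, koszulMat l m * koszulMat m n = 0 := by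
  have h := congrFun (koszulLin_koszulLin (Pi.single n (1 : Op D))) l
  rw [koszulLin_apply_apply] at h
  simp only [Pi.zero_apply] at h
  rw [← h]
  refine Finset.sum_congr rfl fun m _ => ?_
  rw [koszulLin_single, one_smul, mul_comm]
  rfl

theorem dualKoszul_dualKoszul (x : Lab D → LocalForm K) : dualKoszul K (dualKoszul K x) = 0 := by
  ext l
  have matrix_sq : ∑ m, opAct K (koszulMat l m) (∑ n, opAct K (koszulMat m n) (x n)) = 0 := by
    simp only [map_sum, ← opAct_mul]
    rw [Finset.sum_comm]
    refine Finset.sum_eq_zero fun n _ => ?_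
    rw [← LinearMap.sum_apply, ← map_sum, sum_koszulMat_mul, map_zero, LinearMap.zero_apply]
  have anticommute : ∑ m, ((-1 : ℝ) ^ l.parity • opAct K (koszulMat l m) (δ K (x m)) +
      (-1 : ℝ) ^ m.parity • opAct K (koszulMat l m) (δ K (x m))) = 0 := by
    refine Finset.sum_eq_zero fun m _ => ?_
    by_cases hm : m.lev = l.lev + 1
    · rw [Lab.neg_one_pow_parity_of_lev hm, ← add_smul, pow_succ, mul_neg_one, add_neg_cancel,
        zero_smul]
    · simp [koszulMat_eq_zero hm]
  simp only [dualKoszul_apply, map_add, map_smul, map_sum, δ_δ, smul_zero, zero_add,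
    Finset.sum_add_distrib, opAct_comm δ_totalDeriv, Pi.zero_apply] at matrix_sq anticommute ⊢
  rw [matrix_sq, add_zero, Finset.smul_sum]
  exact anticommute

theorem dualKoszul_mem_forms {p q : ℤ} {x : Lab D → LocalForm K}
    (hx : ∀ l, x l ∈ forms K p (q + 1 - l.antigh)) (l : Lab D) :
    dualKoszul K x l ∈ forms K p (q - l.antigh) := by
  rw [dualKoszul_apply]
  refine add_mem (Submodule.smul_mem _ _ ?_) (sum_mem fun m _ => ?_)
  · convert δ_mem_forms (hx l) using 2
    ring
  · by_cases hm : m.lev = l.lev + 1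
    · convert opAct_mem_forms (koszulMat l m) (hx m) using 2
      rw [Lab.antigh_add_one_of_lev hm]
      ring
    · rw [koszulMat_eq_zero hm, map_zero]
      exact zero_mem _

theorem dualKoszul_apply_of_lev {x : Lab D → LocalForm K} {l : Lab D}
    (hx : ∀ m : Lab D, m.lev = l.lev + 1 → x m = 0) :
    dualKoszul K x l = (-1 : ℝ) ^ l.parity • δ K (x l) := by
  rw [dualKoszul_apply, Finset.sum_eq_zero, add_zero]
  intro m _
  by_cases hm : m.lev = l.lev + 1
  · rw [hx m hm, map_zero]
  · rw [koszulMat_eq_zero hm, map_zero, LinearMap.zero_apply]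

theorem Lab.antigh_le (l : Lab D) : l.antigh ≤ 3 := by
  cases l <;> simp [Lab.antigh, Lab.at, Gen.antigh]

theorem exists_dualKoszul_eq_top (hD : 3 < D) {p q : ℤ} (hq : 3 < q) {n : ℕ}
    {x : Lab D → LocalForm K} (hx : ∀ l, x l ∈ forms K p (q - l.antigh))
    (closed : dualKoszul K x = 0) (vanish : ∀ l : Lab D, n < l.lev → x l = 0) :
    ∃ z : Lab D → LocalForm K, (∀ l, z l ∈ forms K p (q + 1 - l.antigh)) ∧
      ∀ l : Lab D, n ≤ l.lev → dualKoszul K z l = x l := by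
  have δ_eq_zero (l : Lab D) (hl : l.lev = n) : δ K (x l) = 0 := by
    have := congrFun closed l
    rw [dualKoszul_apply_of_lev fun m hm => vanish m (by lia)] at this
    exact (smul_eq_zero.1 this).resolve_left (pow_ne_zero _ (by norm_num))
  have exists_lift (l : Lab D) : ∃ z ∈ forms K p (q + 1 - l.antigh),
      (l.lev = n → δ K z = x l) ∧ (l.lev ≠ n → z = 0) := by
    by_cases hl : l.lev = n
    · have := l.antigh_le
      obtain ⟨z, hz, δ_z⟩ := exists_δ_eq hD (by lia) (hx l) (δ_eq_zero l hl)
      rw [sub_add_eq_add_sub] at hz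
      exact ⟨z, hz, fun _ => δ_z, absurd hl⟩
    · exact ⟨0, zero_mem _, fun h => absurd h hl, fun _ => rfl⟩
  choose z z_mem δ_z z_eq_zero using exists_lift
  refine ⟨fun l => (-1 : ℝ) ^ l.parity • z l, fun l => Submodule.smul_mem _ _ (z_mem l),
    fun l hl => ?_⟩
  rw [dualKoszul_apply_of_lev fun m hm => by rw [z_eq_zero m (by lia), smul_zero], map_smul,
    smul_smul, ← mul_pow, neg_one_mul, neg_neg, one_pow, one_smul]
  rcases hl.eq_or_lt with hl | hl
  · exact δ_z l hl.symm
  · rw [z_eq_zero l hl.ne', map_zero, vanish l hl]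

theorem exists_dualKoszul_eq_of_lev (hD : 3 < D) {p q : ℤ} (hq : 3 < q) (n : ℕ)
    {x : Lab D → LocalForm K} (hx : ∀ l, x l ∈ forms K p (q - l.antigh))
    (closed : dualKoszul K x = 0) (vanish : ∀ l : Lab D, n ≤ l.lev → x l = 0) :
    ∃ y : Lab D → LocalForm K, (∀ l, y l ∈ forms K p (q + 1 - l.antigh)) ∧
      dualKoszul K y = x := by
  induction n generalizing x with
  | zero => exact ⟨0, fun l => zero_mem _, by
      rw [map_zero]; exact funext fun l => (vanish l l.lev.zero_le).symm⟩
  | succ n ih =>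
    obtain ⟨z, z_mem, hz⟩ := exists_dualKoszul_eq_top hD hq hx closed vanish
    obtain ⟨y, y_mem, hy⟩ := ih (x := x - dualKoszul K z)
      (fun l => sub_mem (hx l) (dualKoszul_mem_forms z_mem l))
      (by rw [map_sub, closed, dualKoszul_dualKoszul, sub_zero])
      (fun l hl => sub_eq_zero.2 (hz l hl).symm)
    exact ⟨z + y, fun l => add_mem (z_mem l) (y_mem l), by rw [map_add, hy, add_sub_cancel]⟩

theorem exists_dualKoszul_eq (hD : 3 < D) {p q : ℤ} (hq : 3 < q) {x : Lab D → LocalForm K}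
    (hx : ∀ l, x l ∈ forms K p (q - l.antigh)) (closed : dualKoszul K x = 0) :
    ∃ y : Lab D → LocalForm K, (∀ l, y l ∈ forms K p (q + 1 - l.antigh)) ∧
      dualKoszul K y = x :=
  exists_dualKoszul_eq_of_lev hD hq 6 hx closed fun l hl => absurd l.lev_lt (by lia)

/-- The span of the `r ⊗ a` with `a` of form degree `p` and antifield number `q`. -/
def opForms (D : ℕ) (p q : ℤ) : Submodule ℝ (Op D ⊗[ℝ] Alg D) :=
  Submodule.span ℝ {x | ∃ r : Op D, ∃ a ∈ algForms D p q, x = r ⊗ₜ[ℝ] a}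

theorem tmul_mul_mem_opForms {p q p' q' : ℤ} {u : Alg D} (hu : u ∈ algForms D p q)
    {x : Op D ⊗[ℝ] Alg D} (hx : x ∈ opForms D p' q') :
    ((1 : Op D) ⊗ₜ[ℝ] u) * x ∈ opForms D (p + p') (q + q') := by
  induction hx using Submodule.span_induction with
  | mem x hx =>
    obtain ⟨r, a, ha, rfl⟩ := hx
    exact Submodule.subset_span ⟨r, u * a, mul_mem_algForms hu ha,
      by rw [Algebra.TensorProduct.tmul_mul_tmul, one_mul]⟩
  | zero => rw [mul_zero]; exact zero_mem _
  | add x y _ _ hx hy => rw [mul_add]; exact add_mem hx hy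
  | smul c x _ hx => rw [mul_smul_comm]; exact Submodule.smul_mem _ _ hx

theorem frechet_gen_mul_mem_opForms (l : Lab D) (g : Gen D) {p q : ℤ} {a : Alg D}
    (ha : a ∈ algForms D p q) :
    frechet l (gen g) * ((1 : Op D) ⊗ₜ[ℝ] a) ∈
      opForms D (g.formDeg + p) (g.antigh + q - l.antigh) := by
  rw [frechet_gen, Algebra.TensorProduct.tmul_mul_tmul, mul_one, one_mul]
  rcases g.eq_dx_or_at with ⟨μ, rfl⟩ | ⟨m, k, rfl⟩
  · rw [toLin, Pi.zero_apply, TensorProduct.zero_tmul]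
    exact zero_mem _
  by_cases kind_eq : l.kind = m.kind
  · rw [formDeg_at, antigh_at, Lab.antigh_eq_of_kind kind_eq, zero_add, add_sub_cancel_left]
    exact Submodule.subset_span ⟨_, a, ha, rfl⟩
  · rw [toLin_at_of_kind kind_eq, TensorProduct.zero_tmul]
    exact zero_mem _

theorem frechet_mem_opForms (l : Lab D) {p q : ℤ} {a : Alg D} (ha : a ∈ algForms D p q) :
    frechet l a ∈ opForms D p (q - l.antigh) := by
  refine Submodule.span_le (p := (opForms D p (q - l.antigh)).comap (frechet l)).2 ?_ ha
  rintro _ ⟨s, rfl, rfl, rfl⟩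
  rw [SetLike.mem_coe, Submodule.mem_comap]
  clear ha
  induction s with
  | nil => simp [(isDerAlong_frechet l).one]
  | cons g s ih =>
    simp only [List.map_cons, List.prod_cons, List.sum_cons]
    rw [(isDerAlong_frechet l).gen_mul, Algebra.TensorProduct.includeRight_apply,
      Algebra.TensorProduct.includeRight_apply]
    refine add_mem (frechet_gen_mul_mem_opForms l g (prod_gen_mem_algForms s))
      (Submodule.smul_mem _ _ ?_)
    rw [add_sub_assoc]
    exact tmul_mul_mem_opForms (gen_mem_algForms g) ih

theorem eulerLagrange_mem_forms (l : Lab D) {p q : ℤ} {b : LocalForm K} (hb : b ∈ forms K p q) :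
    eulerLagrange K l b ∈ forms K p (q - l.antigh) := by
  refine forms_le (S := (forms K p (q - l.antigh)).comap (eulerLagrange K l)) (fun f a ha => ?_) hb
  rw [Submodule.mem_comap, eulerLagrange_tmul]
  refine Submodule.span_le (p := (forms K p (q - l.antigh)).comap
    (contract K ∘ₗ TensorProduct.mk ℝ _ _ f)).2 ?_ (frechet_mem_opForms l ha)
  rintro _ ⟨r, a, ha, rfl⟩
  exact opAct_mem_forms r (tmul_mem_forms f ha)

/-! ### The number operator -/

/-- The derivation which counts the variables other than the `dx`. -/
def numberData (D : ℕ) : DerData D 0 where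
  val g := toAlg (toLin g)
  superComm g := by
    rcases g.eq_dx_or_at with ⟨μ, rfl⟩ | ⟨l, k, rfl⟩
    · simp only [toLin, map_zero]; exact SuperComm.zero _
    · rw [toAlg_toLin_at]; exact superComm_gen _
  lin v hv := by
    have apply_linearCombination := Finsupp.apply_linearCombination ℝ toAlg toLin v
    rw [linearCombination_toLin hv, map_zero] at apply_linearCombination
    exact apply_linearCombination.symm

theorem number_gen_at (l : Lab D) (k : Multiset (Fin D)) :
    (numberData D).der (gen (l.at k)) = gen (l.at k) := by
  rw [DerData.der_gen]
  exact toAlg_toLin_at l k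

theorem number_gen_dx (μ : Fin D) : (numberData D).der (gen (.dx μ)) = 0 := by
  rw [DerData.der_gen]
  exact map_zero _

theorem hasParity_number_gen (g : Gen D) : HasParity g.parity ((numberData D).der (gen g)) := by
  rcases g.eq_dx_or_at with ⟨ν, rfl⟩ | ⟨l, k, rfl⟩
  · rw [number_gen_dx]; exact HasParity.zero _
  · rw [number_gen_at]; exact HasParity.gen _

theorem number_toAlg (v : Lin D) : (numberData D).der (toAlg v) = toAlg v := by
  induction v using lin_induction with
  | zero => simp
  | single l k => rw [toAlg_single, genOp_mono, number_gen_at]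
  | add v w hv hw => rw [map_add, map_add, hv, hw]
  | smul c v hv => rw [map_smul, map_smul, hv]

theorem number_mul (a b : Alg D) : (numberData D).der (a * b) =
    (numberData D).der a * b + a * (numberData D).der b := by
  rw [(numberData D).isDer.mul, paritySign_of_even Even.zero]
  rfl

theorem koszul_number (a : Alg D) :
    koszulData.der ((numberData D).der a) = (numberData D).der (koszulData.der a) := by
  refine koszulData.isDer.comp_eq_of_gen (numberData D).isDer hasParity_koszul_gen
    hasParity_number_gen (fun g => ?_) a
  rcases g.eq_dx_or_at with ⟨ν, rfl⟩ | ⟨l, k, rfl⟩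
  · rw [number_gen_dx, koszul_gen_dx, map_zero, map_zero]
  · rw [number_gen_at, koszul_gen_eq, number_toAlg]

theorem number_partial (μ : Fin D) (a : Alg D) :
    (numberData D).der ((partialData μ).der a) = (partialData μ).der ((numberData D).der a) := by
  refine (numberData D).isDer.comp_eq_of_gen (partialData μ).isDer hasParity_number_gen
    (hasParity_partial_gen μ) (fun g => ?_) a
  rcases g.eq_dx_or_at with ⟨ν, rfl⟩ | ⟨l, k, rfl⟩
  · rw [partial_gen_dx, number_gen_dx, map_zero, map_zero]
  · rw [partial_gen_at, number_gen_at, number_gen_at, partial_gen_at]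

theorem number_mem_algForms {p q : ℤ} {a : Alg D} (ha : a ∈ algForms D p q) :
    (numberData D).der a ∈ algForms D p q := by
  rw [← add_zero p, ← add_zero q]
  refine (numberData D).isDer.mem_algForms (fun g => ?_) ha
  rw [add_zero, add_zero]
  rcases g.eq_dx_or_at with ⟨ν, rfl⟩ | ⟨l, k, rfl⟩
  · rw [number_gen_dx]; exact zero_mem _
  · rw [number_gen_at]; exact gen_mem_algForms _

theorem gen_at_mem_eigenSpan_number (l : Lab D) (k : Multiset (Fin D)) :
    gen (l.at k) ∈ eigenSpan (numberData D).der 1 :=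
  mem_eigenSpan le_rfl (by rw [number_gen_at, Nat.cast_one, one_smul])

theorem gen_mem_eigenSpan_number (g : Gen D) : gen g ∈ eigenSpan (numberData D).der 0 := by
  rcases g.eq_dx_or_at with ⟨ν, rfl⟩ | ⟨l, k, rfl⟩
  · exact mem_eigenSpan le_rfl (by rw [number_gen_dx, Nat.cast_zero, zero_smul])
  · exact eigenSpan_antitone _ zero_le_one (gen_at_mem_eigenSpan_number l k)

theorem gen_mem_eigenSpan_number_one {g : Gen D} (hg : g.antigh ≠ 0) :
    gen g ∈ eigenSpan (numberData D).der 1 := by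
  rcases g.eq_dx_or_at with ⟨ν, rfl⟩ | ⟨l, k, rfl⟩
  · exact absurd rfl hg
  · exact gen_at_mem_eigenSpan_number l k

/-- The number operator on local forms. -/
def numberOp (K : CoeffClass D) : Module.End ℝ (LocalForm K) := (numberData D).der.lTensor K.Fn

theorem numberOp_tmul (f : K.Fn) (a : Alg D) :
    numberOp K (f ⊗ₜ[ℝ] a) = f ⊗ₜ[ℝ] (numberData D).der a := rfl

theorem δ_numberOp (b : LocalForm K) : δ K (numberOp K b) = numberOp K (δ K b) := by
  induction b using TensorProduct.induction_on with
  | zero => simp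
  | tmul f a => rw [numberOp_tmul, δ_tmul, δ_tmul, numberOp_tmul, koszul_number]
  | add b c hb hc => simp only [map_add, hb, hc]

theorem numberOp_mulL_dx (μ : Fin D) (b : LocalForm K) :
    numberOp K (mulL K (gen (.dx μ)) b) = mulL K (gen (.dx μ)) (numberOp K b) := by
  induction b using TensorProduct.induction_on with
  | zero => simp
  | tmul f a =>
    rw [mulL_tmul, numberOp_tmul, numberOp_tmul, mulL_tmul, number_mul, number_gen_dx, zero_mul,
      zero_add]
  | add b c hb hc => simp only [map_add, hb, hc]

theorem d_eq_sum (b : LocalForm K) : d K b = ∑ μ, mulL K (gen (.dx μ)) (totalDeriv K μ b) := by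
  rw [d, LinearMap.sum_apply]
  rfl

theorem d_numberOp (b : LocalForm K) : d K (numberOp K b) = numberOp K (d K b) := by
  rw [d_eq_sum, d_eq_sum, map_sum]
  refine Finset.sum_congr rfl fun μ _ => ?_
  rw [numberOp_mulL_dx, numberOp, lTensor_totalDeriv (number_partial μ)]

theorem numberOp_mem_forms {p q : ℤ} {b : LocalForm K} (hb : b ∈ forms K p q) :
    numberOp K b ∈ forms K p q :=
  lTensor_mem_forms (fun _ => number_mem_algForms) hb

theorem numberOp_mem_cocycles {p q : ℤ} {a : LocalForm K} (ha : a ∈ cocycles K p q) :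
    numberOp K a ∈ cocycles K p q := by
  obtain ⟨ha, b, hb, closed⟩ := ha
  refine ⟨numberOp_mem_forms ha, numberOp K b, numberOp_mem_forms hb, ?_⟩
  rw [δ_numberOp, d_numberOp, ← map_add, closed, map_zero]

theorem exists_numberOp_eq {p q : ℤ} (hq : q ≠ 0) {a : LocalForm K} (ha : a ∈ cocycles K p q) :
    ∃ b ∈ cocycles K p q, numberOp K b = a := by
  obtain ⟨f, hf⟩ := exists_aeval_right_inverse (numberOp K) <| forms_le_eigenSpan number_mul
    gen_mem_eigenSpan_number (fun _ => gen_mem_eigenSpan_number_one) hq ha.1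
  exact ⟨_, aeval_mem (fun _ => numberOp_mem_cocycles) f ha, hf⟩

/-! ### Integration by parts -/

theorem superComm_genOp (l : Lab D) (r : Op D) : SuperComm l.parity (genOp l r) := by
  induction r using op_induction with
  | mono k => rw [genOp_mono, ← parity_at l k]; exact superComm_gen _
  | add r s hr hs => rw [map_add]; exact hr.add hs
  | smul c r hr => rw [map_smul]; exact hr.smul c

theorem genOp_mem_algForms (l : Lab D) (r : Op D) : genOp l r ∈ algForms D 0 l.antigh := by
  induction r using op_induction with
  | mono k => rw [genOp_mono]; simpa using gen_mem_algForms (l.at k)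
  | add r s hr hs => rw [map_add]; exact add_mem hr hs
  | smul c r hr => rw [map_smul]; exact Submodule.smul_mem _ _ hr

theorem partial_genOp (l : Lab D) (μ : Fin D) (r : Op D) :
    (partialData μ).der (genOp l r) = genOp l (MvPolynomial.X μ * r) := by
  rw [← toAlg_single, partial_toAlg, ← Pi.single_smul, toAlg_single, smul_eq_mul]

/-- The map `r ⊗ a ↦ r(∂)z a`, with `z` the variable with label `l`. -/
def pairing (l : Lab D) : Op D ⊗[ℝ] Alg D →ₗ[ℝ] Alg D :=
  TensorProduct.lift (LinearMap.mul ℝ (Alg D) ∘ₗ genOp l)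

theorem pairing_tmul (l : Lab D) (r : Op D) (a : Alg D) :
    pairing l (r ⊗ₜ[ℝ] a) = genOp l r * a := rfl

theorem pairing_gen_mul (l : Lab D) (g : Gen D) (x : Op D ⊗[ℝ] Alg D) :
    pairing l (((1 : Op D) ⊗ₜ[ℝ] gen g) * x) =
      (-1 : ℝ) ^ (l.parity * g.parity) • (gen g * pairing l x) := by
  induction x using TensorProduct.induction_on with
  | zero => simp
  | tmul r a =>
    rw [Algebra.TensorProduct.tmul_mul_tmul, one_mul, pairing_tmul, pairing_tmul, ← mul_assoc,
      superComm_genOp l r g, smul_mul_assoc, mul_assoc]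
  | add x y hx hy => rw [mul_add, map_add, hx, hy, map_add, mul_add, smul_add]

theorem number_eq_sum_pairing_frechet (a : Alg D) :
    (numberData D).der a = ∑ l, pairing l (frechet l a) := by
  suffices (numberData D).der = ∑ l, pairing l ∘ₗ frechet l by simp [this]
  refine linearMap_ext_gen_mul ?_ fun g a ha => ?_
  · simp [(numberData D).isDer.one, (isDerAlong_frechet _).one]
  simp only [LinearMap.sum_apply, LinearMap.comp_apply] at ha ⊢
  rw [number_mul, ha, Finset.mul_sum, DerData.der_gen]
  change toAlg (toLin g) * a + _ = _
  rw [toAlg_apply, Finset.sum_mul, ← Finset.sum_add_distrib]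
  refine Finset.sum_congr rfl fun l _ => ?_
  rw [(isDerAlong_frechet l).gen_mul, map_add, map_smul, frechet_gen,
    Algebra.TensorProduct.includeRight_apply, Algebra.TensorProduct.includeRight_apply,
    Algebra.TensorProduct.tmul_mul_tmul, mul_one, one_mul, pairing_tmul, pairing_gen_mul,
    smul_smul, ← pow_add, (Even.add_self _).neg_one_pow, one_smul]

/-- The sums of total derivatives of local forms of form degree `p` and antifield number `q`. -/
def divergences (K : CoeffClass D) (p q : ℤ) : Submodule ℝ (LocalForm K) :=
  ⨆ μ, (forms K p q).map (totalDeriv K μ)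

theorem totalDeriv_mem_divergences (μ : Fin D) {p q : ℤ} {b : LocalForm K} (hb : b ∈ forms K p q) :
    totalDeriv K μ b ∈ divergences K p q :=
  Submodule.mem_iSup_of_mem μ (Submodule.mem_map_of_mem hb)

theorem integration_by_parts (l : Lab D) (r s : Op D) {p q : ℤ} {b : LocalForm K}
    (hb : b ∈ forms K p q) : mulL K (genOp l s) (opAct K r b) - mulL K (genOp l (r * s)) b ∈
      divergences K p (l.antigh + q) := by
  induction r using MvPolynomial.induction_on generalizing b s with
  | C c =>
    rw [opAct_C, ← MvPolynomial.smul_eq_C_mul, map_smul, map_smul, map_smul, LinearMap.smul_apply,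
      sub_self]
    exact zero_mem _
  | add r r' hr hr' =>
    convert add_mem (hr s hb) (hr' s hb) using 1
    simp only [map_add, LinearMap.add_apply, add_mul]
    abel
  | mul_X r μ hr =>
    have boundary_mem :
        totalDeriv K μ (mulL K (genOp l (r * s)) b) ∈ divergences K p (l.antigh + q) := by
      refine totalDeriv_mem_divergences μ ?_
      simpa only [zero_add] using mulL_mem_forms (genOp_mem_algForms l (r * s)) hb
    convert sub_mem (hr s (opAct_mem_forms (MvPolynomial.X μ) hb)) boundary_mem using 1
    rw [totalDeriv_mulL, partial_genOp, opAct_mul, opAct_X, map_neg, map_neg, map_neg,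
      mul_comm r, mul_assoc]
    abel

theorem mulL_gen_opAct_sub_mem_divergences (l : Lab D) (r : Op D) {p q : ℤ} {b : LocalForm K}
    (hb : b ∈ forms K p q) : mulL K (gen (l.at 0)) (opAct K r b) - mulL K (genOp l r) b ∈
      divergences K p (l.antigh + q) := by
  have by_parts := integration_by_parts l r 1 hb
  rwa [mul_one, ← mono_zero, genOp_mono] at by_parts

/-- The sum `∑ z_l x_l` over all labels `l`, with `z_l` the undifferentiated variable with
label `l`. -/
def varSum (K : CoeffClass D) : (Lab D → LocalForm K) →ₗ[ℝ] LocalForm K :=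
  ∑ l, mulL K (gen (l.at 0)) ∘ₗ LinearMap.proj l

theorem varSum_apply (x : Lab D → LocalForm K) :
    varSum K x = ∑ l : Lab D, mulL K (gen (l.at 0)) (x l) := by
  rw [varSum, LinearMap.sum_apply]
  rfl

theorem varSum_mem_forms {p q : ℤ} {x : Lab D → LocalForm K}
    (hx : ∀ l, x l ∈ forms K p (q - l.antigh)) : varSum K x ∈ forms K p q := by
  rw [varSum_apply]
  refine sum_mem fun l _ => ?_
  have := mulL_mem_forms (gen_mem_algForms (l.at 0)) (hx l)
  rwa [formDeg_at, antigh_at, zero_add, add_sub_cancel] at this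

theorem mulL_gen_contract_sub_mem_divergences (l : Lab D) (f : K.Fn) {p q : ℤ}
    {x : Op D ⊗[ℝ] Alg D} (hx : x ∈ opForms D p (q - l.antigh)) :
    mulL K (gen (l.at 0)) (contract K (f ⊗ₜ[ℝ] x)) - f ⊗ₜ[ℝ] pairing l x ∈
      divergences K p q := by
  refine Submodule.span_le (p := (divergences K p q).comap
    (mulL K (gen (l.at 0)) ∘ₗ contract K ∘ₗ TensorProduct.mk ℝ _ _ f -
      TensorProduct.mk ℝ K.Fn (Alg D) f ∘ₗ pairing l)).2 ?_ hx
  rintro _ ⟨r, a, ha, rfl⟩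
  have by_parts := mulL_gen_opAct_sub_mem_divergences l r (tmul_mem_forms f ha)
  rwa [add_sub_cancel] at by_parts

theorem varSum_eulerLagrange_sub_mem_divergences {p q : ℤ} {b : LocalForm K}
    (hb : b ∈ forms K p q) :
    varSum K (fun l => eulerLagrange K l b) - numberOp K b ∈ divergences K p q := by
  refine forms_le (S := (divergences K p q).comap
    (varSum K ∘ₗ LinearMap.pi (eulerLagrange K) - numberOp K)) (fun f a ha => ?_) hb
  rw [Submodule.mem_comap, LinearMap.sub_apply, LinearMap.comp_apply, varSum_apply, numberOp_tmul,
    number_eq_sum_pairing_frechet, TensorProduct.tmul_sum, ← Finset.sum_sub_distrib]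
  exact sum_mem fun l _ => mulL_gen_contract_sub_mem_divergences l f (frechet_mem_opForms l ha)

theorem sum_genOp_koszulMat (m : Lab D) :
    ∑ l, genOp l (koszulMat l m) = koszulData.der (gen (m.at 0)) := by
  rw [← toAlg_linPart (koszul_gen_mem_below m 0), toAlg_apply]
  rfl

theorem δ_varSum (y : Lab D → LocalForm K) : δ K (varSum K y) =
    ∑ l : Lab D, (-1 : ℝ) ^ l.parity • mulL K (gen (l.at 0)) (δ K (y l)) +
      ∑ l : Lab D, ∑ m : Lab D, mulL K (genOp l (koszulMat l m)) (y m) := by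
  rw [varSum_apply, Finset.sum_comm, map_sum, ← Finset.sum_add_distrib]
  refine Finset.sum_congr rfl fun m _ => ?_
  rw [δ_mulL_gen, ← LinearMap.sum_apply, ← map_sum, sum_genOp_koszulMat, parity_at, add_comm]

theorem varSum_dualKoszul_sub_mem_divergences {p q : ℤ} {y : Lab D → LocalForm K}
    (hy : ∀ l, y l ∈ forms K p (q + 1 - l.antigh)) :
    varSum K (dualKoszul K y) - δ K (varSum K y) ∈ divergences K p q := by
  have difference_eq : varSum K (dualKoszul K y) - δ K (varSum K y) =
      ∑ l : Lab D, ∑ m : Lab D, (mulL K (gen (l.at 0)) (opAct K (koszulMat l m) (y m)) -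
        mulL K (genOp l (koszulMat l m)) (y m)) := by
    rw [δ_varSum]
    simp only [varSum_apply, dualKoszul_apply, map_add, map_smul, map_sum,
      Finset.sum_add_distrib, Finset.sum_sub_distrib]
    exact add_sub_add_left_eq_sub ..
  rw [difference_eq]
  refine sum_mem fun l _ => sum_mem fun m _ => ?_
  by_cases hm : m.lev = l.lev + 1
  · convert mulL_gen_opAct_sub_mem_divergences l (koszulMat l m) (hy m) using 2
    rw [Lab.antigh_add_one_of_lev hm]
    ring
  · simp [koszulMat_eq_zero hm]

/-! ### Divergences in top form degree -/

theorem gen_dx_mul_self (μ : Fin D) : gen (.dx μ) * gen (.dx μ) = (0 : Alg D) := by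
  have anticommute := gen_comm (.dx μ) (.dx μ)
  simp only [Gen.parity, mul_one, pow_one, neg_smul, one_smul] at anticommute
  have : IsAddTorsionFree (Alg D) := .of_isTorsionFree ℝ _
  exact self_eq_neg.1 anticommute

theorem gen_dx_mul_prod {μ : Fin D} {l : List (Gen D)} (h : Gen.dx μ ∈ l) :
    gen (.dx μ) * (l.map gen).prod = 0 := by
  induction l with
  | nil => simp at h
  | cons g l ih =>
    rw [List.map_cons, List.prod_cons, ← mul_assoc]
    rcases List.mem_cons.1 h with rfl | h
    · rw [gen_dx_mul_self, zero_mul]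
    · rw [gen_comm, smul_mul_assoc, mul_assoc, ih h, mul_zero, smul_zero]

open scoped Classical in
theorem count_dx_le_one {l : List (Gen D)} (h : (l.map gen).prod ≠ 0) (μ : Fin D) :
    l.count (.dx μ) ≤ 1 := by
  induction l with
  | nil => simp
  | cons g l ih =>
    rw [List.map_cons, List.prod_cons] at h
    by_cases hg : g = .dx μ
    · subst hg
      have not_mem : Gen.dx μ ∉ l := fun hl => h (gen_dx_mul_prod hl)
      rw [List.count_cons_self, List.count_eq_zero_of_not_mem not_mem]
    · rw [List.count_cons_of_ne hg]
      exact ih (right_ne_zero_of_mul h)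

open scoped Classical in
theorem sum_formDeg (l : List (Gen D)) :
    (l.map Gen.formDeg).sum = ∑ μ, (l.count (.dx μ) : ℤ) := by
  induction l with
  | nil => simp
  | cons g l ih =>
    simp only [List.map_cons, List.sum_cons, ih, List.count_cons, Nat.cast_add,
      Finset.sum_add_distrib]
    rw [add_comm]
    congr 1
    cases g <;> simp [Gen.formDeg]

theorem eq_zero_of_mem_algForms {p q : ℤ} (hp : (D : ℤ) < p) {a : Alg D}
    (ha : a ∈ algForms D p q) : a = 0 := by
  refine (Submodule.mem_bot ℝ).1 (Submodule.span_le.2 ?_ ha)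
  rintro _ ⟨l, formDeg_sum, -, rfl⟩
  by_contra prod_ne_zero
  classical
  have sum_count_le : ∑ μ : Fin D, (l.count (.dx μ) : ℤ) ≤ ∑ _μ : Fin D, 1 :=
    Finset.sum_le_sum fun μ _ => mod_cast count_dx_le_one prod_ne_zero μ
  rw [← sum_formDeg, formDeg_sum, Finset.sum_const, Finset.card_fin, nsmul_one] at sum_count_le
  exact hp.not_ge (mod_cast sum_count_le)

/-- The contraction with the coordinate vector field `∂/∂x^ν`. -/
def contractionData (ν : Fin D) : DerData D 1 where
  val
    | .dx μ => if μ = ν then 1 else 0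
    | _ => 0
  superComm g := by
    cases g
    case dx μ =>
      have superComm_one : SuperComm 0 (1 : Alg D) := fun g => by simp
      dsimp only
      split_ifs
      · exact superComm_one.congr (by simp [Gen.parity])
      · exact SuperComm.zero _
    all_goals exact SuperComm.zero _
  lin v hv := by cases hv <;> simp

theorem contraction_gen_dx (μ ν : Fin D) :
    (contractionData ν).der (gen (.dx μ)) = if μ = ν then 1 else 0 := by
  rw [DerData.der_gen]
  rfl

theorem contraction_gen_at (ν : Fin D) (l : Lab D) (k : Multiset (Fin D)) :
    (contractionData ν).der (gen (l.at k)) = 0 := by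
  rw [DerData.der_gen]
  cases l <;> rfl

theorem hasParity_contraction_gen (ν : Fin D) (g : Gen D) :
    HasParity (g.parity + 1) ((contractionData ν).der (gen g)) := by
  rcases g.eq_dx_or_at with ⟨μ, rfl⟩ | ⟨l, k, rfl⟩
  · rw [contraction_gen_dx]
    split_ifs
    · intro ε
      simp [Gen.parity, mul_comm ε, pow_mul]
    · exact HasParity.zero _
  · rw [contraction_gen_at]; exact HasParity.zero _

theorem contraction_partial (μ ν : Fin D) (a : Alg D) :
    (contractionData ν).der ((partialData μ).der a) =
      (partialData μ).der ((contractionData ν).der a) := by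
  refine (contractionData ν).isDer.comp_eq_of_gen (partialData μ).isDer
    (hasParity_contraction_gen ν) (hasParity_partial_gen μ) (fun g => ?_) a
  rcases g.eq_dx_or_at with ⟨κ, rfl⟩ | ⟨l, k, rfl⟩
  · rw [partial_gen_dx, contraction_gen_dx, map_zero]
    split_ifs
    · exact (partialData μ).isDer.one.symm
    · exact (map_zero _).symm
  · rw [partial_gen_at, contraction_gen_at, contraction_gen_at, map_zero]

theorem contraction_mem_algForms (ν : Fin D) {p q : ℤ} {a : Alg D} (ha : a ∈ algForms D p q) :
    (contractionData ν).der a ∈ algForms D (p - 1) q := by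
  rw [sub_eq_add_neg, ← add_zero q]
  refine (contractionData ν).isDer.mem_algForms (fun g => ?_) ha
  rcases g.eq_dx_or_at with ⟨μ, rfl⟩ | ⟨l, k, rfl⟩
  · rw [contraction_gen_dx]
    split_ifs
    · simpa [Gen.formDeg, Gen.antigh] using one_mem_algForms
    · exact zero_mem _
  · rw [contraction_gen_at]; exact zero_mem _

theorem gen_dx_mul_contraction (μ ν : Fin D) {q : ℤ} {a : Alg D} (ha : a ∈ algForms D D q) :
    gen (.dx μ) * (contractionData ν).der a = if μ = ν then a else 0 := by
  have dx_mul_eq_zero : gen (.dx μ) * a = 0 :=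
    eq_zero_of_mem_algForms (by simp [Gen.formDeg]) (mul_mem_algForms (gen_mem_algForms (.dx μ)) ha)
  have leibniz := (contractionData ν).isDer.apply_gen_mul (.dx μ) a
  rw [dx_mul_eq_zero, map_zero, contraction_gen_dx, Gen.parity, mul_one, pow_one, neg_one_smul,
    ite_mul, one_mul, zero_mul] at leibniz
  exact (add_neg_eq_zero.1 leibniz.symm).symm

theorem mulL_dx_contraction (μ ν : Fin D) {q : ℤ} {c : LocalForm K} (hc : c ∈ forms K D q) :
    mulL K (gen (.dx μ)) ((contractionData ν).der.lTensor K.Fn c) = if μ = ν then c else 0 := by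
  have mem_eqLocus := forms_le (S := LinearMap.eqLocus (mulL K (gen (.dx μ)) ∘ₗ
    (contractionData ν).der.lTensor K.Fn) (if μ = ν then LinearMap.id else 0))
    (fun f a ha => ?_) hc
  · rw [LinearMap.mem_eqLocus, LinearMap.comp_apply] at mem_eqLocus
    rw [mem_eqLocus]
    split_ifs <;> rfl
  rw [LinearMap.mem_eqLocus, LinearMap.comp_apply, LinearMap.lTensor_tmul, mulL_tmul,
    gen_dx_mul_contraction μ ν ha]
  split_ifs
  · rfl
  · rw [TensorProduct.tmul_zero, LinearMap.zero_apply]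

theorem d_eq_sum_totalDeriv (b : LocalForm K) :
    d K b = ∑ μ, totalDeriv K μ (mulL K (gen (.dx μ)) b) := by
  rw [d_eq_sum]
  refine Finset.sum_congr rfl fun μ _ => ?_
  rw [totalDeriv_mulL, partial_gen_dx, map_zero, LinearMap.zero_apply, zero_add]

theorem eulerLagrange_d (l : Lab D) (b : LocalForm K) : eulerLagrange K l (d K b) = 0 := by
  rw [d_eq_sum_totalDeriv, map_sum]
  exact Finset.sum_eq_zero fun μ _ => eulerLagrange_totalDeriv l μ _

theorem divergences_le_map_d (q : ℤ) : divergences K D q ≤ (forms K (D - 1) q).map (d K) := by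
  refine iSup_le fun ν => ?_
  rintro _ ⟨c, hc, rfl⟩
  refine ⟨(contractionData ν).der.lTensor K.Fn c,
    lTensor_mem_forms (fun _ => contraction_mem_algForms ν) hc, ?_⟩
  rw [d_eq_sum, Finset.sum_congr rfl fun μ _ => by
    rw [← lTensor_totalDeriv (contraction_partial μ ν),
      mulL_dx_contraction μ ν (totalDeriv_mem_forms μ hc)]]
  exact Fintype.sum_ite_eq' ν fun μ => totalDeriv K μ c

theorem dualKoszul_eulerLagrange_of_mem_cocycles {p q : ℤ} {a : LocalForm K}
    (ha : a ∈ cocycles K p q) : dualKoszul K (fun l => eulerLagrange K l a) = 0 := by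
  obtain ⟨-, b, -, closed⟩ := ha
  ext l
  rw [← eulerLagrange_δ, eq_neg_of_add_eq_zero_left closed, map_neg, eulerLagrange_d, neg_zero]
  rfl

theorem numberOp_mem_coboundaries (hD : 3 < D) {q : ℤ} (hq : 3 < q) {a : LocalForm K}
    (ha : a ∈ cocycles K D q) : numberOp K a ∈ coboundaries K D q := by
  obtain ⟨y, hy, dualKoszul_y⟩ := exists_dualKoszul_eq hD hq
    (fun l => eulerLagrange_mem_forms l ha.1) (dualKoszul_eulerLagrange_of_mem_cocycles ha)
  have remainder_mem : numberOp K a - δ K (varSum K y) ∈ divergences K D q := by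
    have := sub_mem (varSum_dualKoszul_sub_mem_divergences hy)
      (varSum_eulerLagrange_sub_mem_divergences ha.1)
    rwa [dualKoszul_y, sub_sub_sub_cancel_left] at this
  rw [← add_sub_cancel (δ K (varSum K y)) (numberOp K a)]
  exact Submodule.add_mem_sup (Submodule.mem_map_of_mem (varSum_mem_forms hy))
    (divergences_le_map_d q remainder_mem)

end HookGauge

end

theorem mainTheorem4_general (D : ℕ) (hD : 3 < D) (K : HookGauge.CoeffClass D) (q : ℤ)
    (hq : 3 < q) : Subsingleton (HookGauge.H K (D : ℤ) q) := by
  rw [HookGauge.H, Submodule.Quotient.subsingleton_iff, eq_top_iff]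
  rintro ⟨a, ha⟩ -
  obtain ⟨b, hb, rfl⟩ := HookGauge.exists_numberOp_eq (by lia) ha
  exact HookGauge.numberOp_mem_coboundaries hD hq hb

theorem mainTheorem4 (D : ℕ) (hD : 4 < D) (K : HookGauge.CoeffClass D) (q : ℤ) (hq : 3 < q) :
    Subsingleton (HookGauge.H K (D : ℤ) q) :=
  mainTheorem4_general D (Nat.lt_of_succ_lt hD) K q hq
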